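/- Let $\Bbbk$ be an algebraically closed field of characteristic zero. All categories below are finite abelian $\Bbbk$-linear categories (abelian, finite-dimensional Hom spaces, objects of finite length, enough projectives, finitely many simple objects up to isomorphism) and all functors are additive and $\Bbbk$-linear. Let $\mathcal C$ be a finite tensor category (rigid monoidal with $\Bbbk$-bilinear tensor product and simple unit), and let $\mathcal M$ be a nonzero, indecomposable, exact left $\mathcal C$-module category with action $\triangleright$ (exact in each variable), associativity $m_{X,Y,M}\colon (X\otimes Y)\triangleright M\to X\triangleright(Y\triangleright M)$ and unit $\ell_M\colon \mathbf 1\triangleright M\to M$. Let $\mathcal C^*_{\mathcal M}$ be the category of right exact $\mathcal C$-module endofunctors $(D,d)$, $d_{X,M}\colon D(X\triangleright M)\to X\triangleright D(M)$, with natural module transformations as morphisms and composition as tensor product. Let $\mathcal D\subseteq\mathcal C^*_{\mathcal M}$ be a tensor subcategory, that is, a full subcategory which contains the unit, is closed under tensor products, finite direct sums, subobjects and quotients, and in which every object has a left and a right dual. Let $\operatorname{End}(\mathcal M)$ be the category of right exact endofunctors of $\mathcal M$. The relative center $Z_{\mathcal D}(\operatorname{End}(\mathcal M))$ has as objects the pairs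 $(F,\gamma)$, where $F\in\operatorname{End}(\mathcal M)$ and $\gamma_{(D,d)}\colon F\circ D\to D\circ F$, $(D,d)\in\mathcal D$, is a natural family of natural isomorphisms with $\gamma_{(D,d)\circ(D',d')}=(\mathrm{id}_D\circ\gamma_{(D',d')})(\gamma_{(D,d)}\circ\mathrm{id}_{D'})$; a morphism $(F,\gamma)\to(F',\gamma')$ is a natural transformation $f\colon F\to F'$ with $(\mathrm{id}_D\circ f)\gamma_{(D,d)}=\gamma'_{(D,d)}(f\circ\mathrm{id}_D)$. It is monoidal under composition of functors. Then the following hold. 1. $Z_{\mathcal D}(\operatorname{End}(\mathcal M))$ is a $\mathcal C$-bimodule category (a finite abelian $\Bbbk$-linear category with left and right $\mathcal C$-actions that are $\Bbbk$-bilinear and exact in each variable, and with coherent middle associativity isomorphisms). The actions are $X\triangleright(F,\gamma)=(X\triangleright F(-),{}^X\gamma)$ and $(F,\gamma)\triangleleft X=(F(X\triangleright -),\gamma^X)$, where $({}^X\gamma_{(D,d)})_M=d^{-1}_{X,F(M)}(\mathrm{id}_X\triangleright(\gamma_{(D,d)})_M)$ and $(\gamma^X_{(D,d)})_M=(\gamma_{(D,d)})_{X\triangleright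 M}\,F(d^{-1}_{X,M})$; the associativity and unit isomorphisms of the actions are induced by $m$ and $\ell$, and the middle associativity $(X\triangleright F)\triangleleft Y\to X\triangleright(F\triangleleft Y)$ is the identity of $X\triangleright F(Y\triangleright -)$. 2. For every $X\in\mathcal C$ the functor $X\triangleright -$, with half-braiding $(d^{-1}_{X,M})_M$ at $(D,d)\in\mathcal D$, is an object $\rho(X)$ of $Z_{\mathcal D}(\operatorname{End}(\mathcal M))$. The resulting functor $\rho\colon\mathcal C\to Z_{\mathcal D}(\operatorname{End}(\mathcal M))$, $X\mapsto X\triangleright -$, is (strong) monoidal, with structure isomorphisms $\rho(X)\circ\rho(Y)\to\rho(X\otimes Y)$ and $\mathrm{Id}\to\rho(\mathbf 1)$ given by $m^{-1}$ and $\ell^{-1}$; it is $\Bbbk$-linear, exact and faithful. -/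

import Mathlib

open CategoryTheory MonoidalCategory Limits
open scoped MonoidalLeftAction MonoidalRightAction

universe w v₁ v₂ v₃ u₁ u₂ u₃

/-! ## Finite abelian categories and finite tensor categories -/

/-- A `k`-linear category is a *finite abelian* `k`-linear category: it is abelian, has
finite-dimensional spaces of morphisms, every object has finite length (is noetherian and
artinian), there are enough projectives, and there are finitely many simple objects up to
isomorphism. (The first five fields are exactly the fields that turn a preadditive category
into an abelian one.) -/
class IsFiniteAbelian (k : Type w) [Field k] (A : Type u₁) [Category.{v₁} A] [Preadditive A]
    [Linear k A] : Prop where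
  hasFiniteProducts : HasFiniteProducts A
  hasKernels : HasKernels A
  hasCokernels : HasCokernels A
  normalMono : IsNormalMonoCategory A
  normalEpi : IsNormalEpiCategory A
  finite_hom : ∀ X Y : A, Module.Finite k (X ⟶ Y)
  noetherian : ∀ X : A, IsNoetherianObject X
  artinian : ∀ X : A, IsArtinianObject X
  enoughProjectives : EnoughProjectives A
  finite_simples : ∃ (n : ℕ) (S : Fin n → A), ∀ X : A, Simple X → ∃ i, Nonempty (X ≅ S i)

/-- A finite tensor category: a finite abelian `k`-linear category with a `k`-bilinear rigid
monoidal structure whose unit object is simple. -/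
class IsFiniteTensorCategory (k : Type w) [Field k] (C : Type u₁) [Category.{v₁} C]
    [Preadditive C] [Linear k C] [MonoidalCategory C] : Prop extends IsFiniteAbelian k C where
  [monoidalPreadditive : MonoidalPreadditive C]
  [monoidalLinear : MonoidalLinear k C]
  rigid : Nonempty (RigidCategory C)
  simple_unit : Simple (𝟙_ C)

/-! ## Module categories and bimodule categories -/

/-- An additive `k`-linear exact functor. -/
structure IsLinearExact (k : Type w) [Field k] {A : Type u₁} [Category.{v₁} A] [Preadditive A]
    [Linear k A] {B : Type u₂} [Category.{v₂} B] [Preadditive B] [Linear k B] (F : A ⥤ B) :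
    Prop where
  additive : F.Additive
  linear : F.Linear k
  preservesFiniteLimits : PreservesFiniteLimits F
  preservesFiniteColimits : PreservesFiniteColimits F

/-- A left action of a monoidal category `C` on `M` makes `M` a left `C`-module category:
`M` is finite abelian and the action bifunctor is `k`-linear and exact in each variable. -/
class IsLeftModuleCategory (k : Type w) [Field k] (C : Type u₁) [Category.{v₁} C]
    [Preadditive C] [Linear k C] [MonoidalCategory C] (M : Type u₂) [Category.{v₂} M]
    [Preadditive M] [Linear k M] [MonoidalLeftAction C M] : Prop where
  finite : IsFiniteAbelian k M
  exact_right : ∀ X : C, IsLinearExact k ((MonoidalLeftAction.curriedAction C M).obj X)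
  exact_left : ∀ N : M, IsLinearExact k ((MonoidalLeftAction.curriedAction C M).flip.obj N)

/-- A right action of a monoidal category `C` on `M` makes `M` a right `C`-module category:
`M` is finite abelian and the action bifunctor is `k`-linear and exact in each variable. -/
class IsRightModuleCategory (k : Type w) [Field k] (C : Type u₁) [Category.{v₁} C]
    [Preadditive C] [Linear k C] [MonoidalCategory C] (M : Type u₂) [Category.{v₂} M]
    [Preadditive M] [Linear k M] [MonoidalRightAction C M] : Prop where
  finite : IsFiniteAbelian k M
  exact_left : ∀ X : C, IsLinearExact k ((MonoidalRightAction.curriedAction C M).obj X)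
  exact_right : ∀ N : M, IsLinearExact k ((MonoidalRightAction.curriedAction C M).flip.obj N)

/-- The module category `M` over `C` is exact: `P ▷ N` is projective for every projective `P`. -/
def IsExactModuleCategory (C : Type u₁) [Category.{v₁} C] [MonoidalCategory C] (M : Type u₂)
    [Category.{v₂} M] [MonoidalLeftAction C M] : Prop :=
  ∀ (P : C), Projective P → ∀ N : M, Projective (P ⊙ₗ N)

/-- The module category `M` over `C` is indecomposable: it is nonzero, and it is not the direct
sum of two nonzero module subcategories `S` and `T`. (`M` is the direct sum of the full module
subcategories `S` and `T` if both are stable under the action, there are no nonzero morphisms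
between them, and every object is the direct sum of an object of `S` and an object of `T`.) -/
structure IsIndecomposableModuleCategory (C : Type u₁) [Category.{v₁} C] [MonoidalCategory C]
    (M : Type u₂) [Category.{v₂} M] [Preadditive M] [MonoidalLeftAction C M] : Prop where
  nonzero : ∃ N : M, ¬ IsZero N
  indecomposable : ∀ S T : ObjectProperty M,
    (∀ (X : C) (N : M), S N → S (X ⊙ₗ N)) →
    (∀ (X : C) (N : M), T N → T (X ⊙ₗ N)) →
    (∀ (N N' : M), S N → T N' → (∀ f : N ⟶ N', f = 0) ∧ (∀ f : N' ⟶ N, f = 0)) →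
    (∀ N : M, ∃ (A B : M) (b : BinaryBicone A B), S A ∧ T B ∧ Nonempty b.IsBilimit ∧
      Nonempty (N ≅ b.pt)) →
    (∀ N, S N → IsZero N) ∨ (∀ N, T N → IsZero N)

/-- The data of a left action of `C`, a right action of `D` and of isomorphisms
`δ : (X ▷ N) ◁ Y ≅ X ▷ (N ◁ Y)` make `M` a `(C, D)`-bimodule category: the left and the right
action satisfy the axioms of a left and of a right module category, `δ` is natural, and it
satisfies the two pentagon axioms and the two triangle axioms. -/
structure IsBimoduleCategory (k : Type w) [Field k] (C : Type u₁) [Category.{v₁} C]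
    [Preadditive C] [Linear k C] [MonoidalCategory C] (D : Type u₃) [Category.{v₃} D]
    [Preadditive D] [Linear k D] [MonoidalCategory D] (M : Type u₂) [Category.{v₂} M]
    [Preadditive M] [Linear k M]
    [l : MonoidalLeftActionStruct C M] [r : MonoidalRightActionStruct D M]
    (δ : ∀ (X : C) (N : M) (Y : D), (X ⊙ₗ N) ⊙ᵣ Y ≅ X ⊙ₗ (N ⊙ᵣ Y)) : Prop where
  left : ∃ L : MonoidalLeftAction C M, L.toMonoidalLeftActionStruct = l ∧
    IsLeftModuleCategory k C M
  right : ∃ R : MonoidalRightAction D M, R.toMonoidalRightActionStruct = r ∧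
    IsRightModuleCategory k D M
  natural_left : ∀ {X X' : C} (f : X ⟶ X') (N : M) (Y : D),
    (f ⊵ₗ N) ⊵ᵣ Y ≫ (δ X' N Y).hom = (δ X N Y).hom ≫ f ⊵ₗ (N ⊙ᵣ Y)
  natural_middle : ∀ (X : C) {N N' : M} (f : N ⟶ N') (Y : D),
    (X ⊴ₗ f) ⊵ᵣ Y ≫ (δ X N' Y).hom = (δ X N Y).hom ≫ X ⊴ₗ (f ⊵ᵣ Y)
  natural_right : ∀ (X : C) (N : M) {Y Y' : D} (f : Y ⟶ Y'),
    (X ⊙ₗ N) ⊴ᵣ f ≫ (δ X N Y').hom = (δ X N Y).hom ≫ X ⊴ₗ (N ⊴ᵣ f)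
  pentagon_left : ∀ (X X' : C) (N : M) (Y : D),
    (αₗ X X' N).hom ⊵ᵣ Y ≫ (δ X (X' ⊙ₗ N) Y).hom ≫ X ⊴ₗ (δ X' N Y).hom =
      (δ (X ⊗ X') N Y).hom ≫ (αₗ X X' (N ⊙ᵣ Y)).hom
  pentagon_right : ∀ (X : C) (N : M) (Y Y' : D),
    (αᵣ (X ⊙ₗ N) Y Y').hom ≫ (δ X N Y).hom ⊵ᵣ Y' ≫ (δ X (N ⊙ᵣ Y) Y').hom =
      (δ X N (Y ⊗ Y')).hom ≫ X ⊴ₗ (αᵣ N Y Y').hom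
  triangle_left : ∀ (N : M) (Y : D),
    (δ (𝟙_ C) N Y).hom ≫ (λₗ (N ⊙ᵣ Y)).hom = (λₗ N).hom ⊵ᵣ Y
  triangle_right : ∀ (X : C) (N : M),
    (δ X N (𝟙_ D)).hom ≫ X ⊴ₗ (ρᵣ N).hom = (ρᵣ (X ⊙ₗ N)).hom

/-! ## The dual category -/

/-- A `C`-module endofunctor of `M`: a right exact `k`-linear functor `F : M ⥤ M` with natural
isomorphisms `c : F (X ▷ N) ≅ X ▷ F N` compatible with the associativity and unit constraints. -/
structure ModuleEnd (k : Type w) [Field k] (C : Type u₁) [Category.{v₁} C] [MonoidalCategory C]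
    (M : Type u₂) [Category.{v₂} M] [Preadditive M] [Linear k M] [MonoidalLeftAction C M] where
  functor : M ⥤ M
  additive : functor.Additive
  linear : functor.Linear k
  rightExact : PreservesFiniteColimits functor
  c (X : C) (N : M) : functor.obj (X ⊙ₗ N) ≅ X ⊙ₗ functor.obj N
  natural_left {X X' : C} (f : X ⟶ X') (N : M) :
    functor.map (f ⊵ₗ N) ≫ (c X' N).hom = (c X N).hom ≫ f ⊵ₗ functor.obj N
  natural_right (X : C) {N N' : M} (f : N ⟶ N') :
    functor.map (X ⊴ₗ f) ≫ (c X N').hom = (c X N).hom ≫ X ⊴ₗ functor.map f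
  assoc (X Y : C) (N : M) :
    functor.map (αₗ X Y N).hom ≫ (c X (Y ⊙ₗ N)).hom ≫ X ⊴ₗ (c Y N).hom =
      (c (X ⊗ Y) N).hom ≫ (αₗ X Y (functor.obj N)).hom
  unit (N : M) :
    (c (𝟙_ C) N).hom ≫ (λₗ (functor.obj N)).hom = functor.map (λₗ N).hom

namespace ModuleEnd

section

variable {k : Type w} [Field k] {C : Type u₁} [Category.{v₁} C] [MonoidalCategory C]
  {M : Type u₂} [Category.{v₂} M] [Preadditive M] [Linear k M] [MonoidalLeftAction C M]

/-- Natural module transformations. -/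
@[ext]
structure Hom (F G : ModuleEnd k C M) where
  app (N : M) : F.functor.obj N ⟶ G.functor.obj N
  naturality {N N' : M} (f : N ⟶ N') : F.functor.map f ≫ app N' = app N ≫ G.functor.map f
  module (X : C) (N : M) : app (X ⊙ₗ N) ≫ (G.c X N).hom = (F.c X N).hom ≫ X ⊴ₗ app N

/-- The category `C*_M` of `C`-module endofunctors of `M` and natural module transformations. -/
instance : Category (ModuleEnd k C M) where
  Hom := Hom
  id F := { app N := 𝟙 _, naturality := by simp, module := by simp }
  comp a b :=
    { app N := a.app N ≫ b.app N
      naturality f := by simp [reassoc_of% a.naturality, b.naturality]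
      module X N := by simp [reassoc_of% a.module, b.module] }
  id_comp a := by ext; simp
  comp_id a := by ext; simp
  assoc a b c := by ext; simp

@[ext]
lemma hom_ext {F G : ModuleEnd k C M} {a b : F ⟶ G} (h : ∀ N, a.app N = b.app N) : a = b :=
  Hom.ext (funext h)

@[simp]
lemma id_app (F : ModuleEnd k C M) (N : M) : Hom.app (𝟙 F) N = 𝟙 (F.functor.obj N) := rfl

@[simp]
lemma comp_app {F G H : ModuleEnd k C M} (a : F ⟶ G) (b : G ⟶ H) (N : M) :
    Hom.app (a ≫ b) N = a.app N ≫ b.app N := rfl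

lemma c_inv_left (F : ModuleEnd k C M) {X X' : C} (f : X ⟶ X') (N : M) :
    f ⊵ₗ F.functor.obj N ≫ (F.c X' N).inv = (F.c X N).inv ≫ F.functor.map (f ⊵ₗ N) := by
  rw [Iso.eq_inv_comp, ← Category.assoc, Iso.comp_inv_eq, F.natural_left]

lemma c_inv_right (F : ModuleEnd k C M) (X : C) {N N' : M} (f : N ⟶ N') :
    X ⊴ₗ F.functor.map f ≫ (F.c X N').inv = (F.c X N).inv ≫ F.functor.map (X ⊴ₗ f) := by
  rw [Iso.eq_inv_comp, ← Category.assoc, Iso.comp_inv_eq, F.natural_right]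

lemma c_inv_assoc (F : ModuleEnd k C M) (X Y : C) (N : M) :
    (αₗ X Y (F.functor.obj N)).hom ≫ X ⊴ₗ (F.c Y N).inv ≫ (F.c X (Y ⊙ₗ N)).inv =
      (F.c (X ⊗ Y) N).inv ≫ F.functor.map (αₗ X Y N).hom := by
  rw [Iso.eq_inv_comp, ← Category.assoc, ← Category.assoc, Iso.comp_inv_eq, ← F.assoc]
  simp

lemma c_inv_unit (F : ModuleEnd k C M) (N : M) :
    (λₗ (F.functor.obj N)).hom = (F.c (𝟙_ C) N).inv ≫ F.functor.map (λₗ N).hom := by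
  rw [Iso.eq_inv_comp, F.unit]

lemma c_inv_module {F G : ModuleEnd k C M} (a : Hom F G) (X : C) (N : M) :
    X ⊴ₗ a.app N ≫ (G.c X N).inv = (F.c X N).inv ≫ a.app (X ⊙ₗ N) := by
  rw [Iso.eq_inv_comp, ← Category.assoc, Iso.comp_inv_eq, a.module]

/-- The identity module functor. -/
abbrev idEnd : ModuleEnd k C M where
  functor := 𝟭 M
  additive := inferInstance
  linear := inferInstance
  rightExact := inferInstance
  c X N := Iso.refl _
  natural_left f N := by simp
  natural_right X f := by simp
  assoc X Y N := by simp
  unit N := by simp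

/-- The composition `F ∘ G` of module functors. -/
abbrev compEnd (F G : ModuleEnd k C M) : ModuleEnd k C M where
  functor := G.functor ⋙ F.functor
  additive := by
    have := F.additive; have := G.additive; infer_instance
  linear := by
    have := F.additive; have := G.additive; have := F.linear; have := G.linear; infer_instance
  rightExact := by
    have := F.rightExact; have := G.rightExact; exact comp_preservesFiniteColimits _ _
  c X N := F.functor.mapIso (G.c X N) ≪≫ F.c X (G.functor.obj N)
  natural_left f N := by
    simp only [Functor.comp_obj, Functor.comp_map, Iso.trans_hom, Functor.mapIso_hom,
      Category.assoc]
    rw [← F.natural_left, ← Functor.map_comp_assoc, G.natural_left, Functor.map_comp_assoc]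
  natural_right X N N' f := by
    simp only [Functor.comp_obj, Functor.comp_map, Iso.trans_hom, Functor.mapIso_hom,
      Category.assoc]
    rw [← F.natural_right, ← Functor.map_comp_assoc, G.natural_right, Functor.map_comp_assoc]
  assoc X Y N := by
    have h := congrArg F.functor.map (G.assoc X Y N)
    simp only [Functor.map_comp] at h
    simp only [Functor.comp_obj, Functor.comp_map, Iso.trans_hom, Functor.mapIso_hom,
      MonoidalLeftAction.actionHomRight_comp, Category.assoc]
    rw [← F.assoc, ← reassoc_of% h, ← reassoc_of% (F.natural_right X (G.c Y N).hom)]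
  unit N := by
    simp only [Functor.comp_obj, Functor.comp_map, Iso.trans_hom, Functor.mapIso_hom,
      Category.assoc]
    rw [F.unit, ← Functor.map_comp, G.unit]

/-- Construct isomorphisms of module functors from components. -/
@[simps]
def isoMk {F G : ModuleEnd k C M} (e : ∀ N, F.functor.obj N ≅ G.functor.obj N)
    (naturality : ∀ (N N' : M) (f : N ⟶ N'),
      F.functor.map f ≫ (e N').hom = (e N).hom ≫ G.functor.map f)
    (module : ∀ (X : C) (N : M),
      (e (X ⊙ₗ N)).hom ≫ (G.c X N).hom = (F.c X N).hom ≫ X ⊴ₗ (e N).hom) : F ≅ G where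
  hom := { app N := (e N).hom, naturality := naturality _ _, module := module }
  inv :=
    { app N := (e N).inv
      naturality f := by
        rw [Iso.eq_inv_comp, ← Category.assoc, ← naturality, Category.assoc, Iso.hom_inv_id,
          Category.comp_id]
      module X N := by
        rw [Iso.inv_comp_eq, ← Category.assoc, module, Category.assoc,
          MonoidalLeftAction.actionHomRight_hom_inv, Category.comp_id] }
  hom_inv_id := by ext; simp
  inv_hom_id := by ext; simp

/-- The functor `F ∘ -` on module transformations. -/
abbrev whiskerL (F : ModuleEnd k C M) {G G' : ModuleEnd k C M} (a : G ⟶ G') :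
    compEnd F G ⟶ compEnd F G' :=
  { app N := F.functor.map (a.app N)
    naturality f := by
      simp only [Functor.comp_map, ← Functor.map_comp, a.naturality]
    module X N := by
      simp only [Iso.trans_hom, Functor.mapIso_hom, Category.assoc]
      rw [← F.natural_right, ← Functor.map_comp_assoc, a.module, Functor.map_comp_assoc] }

/-- The functor `- ∘ G` on module transformations. -/
abbrev whiskerR {F F' : ModuleEnd k C M} (a : F ⟶ F') (G : ModuleEnd k C M) :
    compEnd F G ⟶ compEnd F' G :=
  { app N := a.app (G.functor.obj N)
    naturality f := a.naturality _
    module X N := by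
      simp only [Iso.trans_hom, Functor.mapIso_hom, Category.assoc]
      rw [← a.module, ← reassoc_of% a.naturality] }

/-- The tensor product of `C*_M` is the composition of module functors, `F ⊗ G = F ∘ G`. -/
instance : MonoidalCategoryStruct (ModuleEnd k C M) where
  tensorObj F G := compEnd F G
  tensorUnit := idEnd
  whiskerLeft F _ _ a := whiskerL F a
  whiskerRight a G := whiskerR a G
  tensorHom {F _ _ G'} a b := whiskerR a _ ≫ whiskerL _ b
  associator F G H := isoMk (fun N => Iso.refl _) (fun _ _ _ => by simp) (fun _ _ => by simp)
  leftUnitor F := isoMk (fun N => Iso.refl _) (fun _ _ _ => by simp) (fun _ _ => by simp)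
  rightUnitor F := isoMk (fun N => Iso.refl _) (fun _ _ _ => by simp) (fun _ _ => by simp)

instance : MonoidalCategory (ModuleEnd k C M) where
  tensorHom_def _ _ := rfl
  id_tensorHom_id F G := by
    ext N
    exact (Category.id_comp _).trans (F.functor.map_id _)
  tensorHom_comp_tensorHom {F₁ F₂ F₃ G₁ G₂ G₃} a₁ b₁ a₂ b₂ := by
    ext N
    change (a₁.app _ ≫ F₂.functor.map (b₁.app N)) ≫ a₂.app _ ≫ F₃.functor.map (b₂.app N) =
      (a₁.app _ ≫ a₂.app _) ≫ F₃.functor.map (b₁.app N ≫ b₂.app N)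
    simp only [Category.assoc, Functor.map_comp]
    rw [reassoc_of% a₂.naturality]
  whiskerLeft_id F G := by
    ext N
    exact F.functor.map_id _
  id_whiskerRight F G := by
    ext N
    rfl
  associator_naturality {F₁ F₂ F₃ G₁ G₂ G₃} a b c := by
    ext N
    change ((a.app _ ≫ G₁.functor.map (b.app _)) ≫ G₁.functor.map (G₂.functor.map (c.app N)))
      ≫ 𝟙 _ = 𝟙 _ ≫ a.app _ ≫ G₁.functor.map (b.app _ ≫ G₂.functor.map (c.app N))
    simp
  leftUnitor_naturality {F G} a := by
    ext N
    exact (Category.comp_id _).trans (Category.id_comp _).symm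
  rightUnitor_naturality {F G} a := by
    ext N
    exact (Category.comp_id _).trans (Category.id_comp _).symm
  pentagon F G H K := by
    ext N
    change 𝟙 _ ≫ 𝟙 _ ≫ F.functor.map (𝟙 _) = 𝟙 _ ≫ 𝟙 _
    simp
  triangle F G := by
    ext N
    change 𝟙 _ ≫ F.functor.map (𝟙 _) = 𝟙 _
    simp

end

end ModuleEnd

/-- A full subcategory of `C*_M`, given by a property `P` of objects, is a tensor subcategory:
it contains the unit object and is closed under tensor products, finite direct sums, subobjects,
quotients (hence under isomorphisms), and each of its objects has a left and a right dual in it. -/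
class IsTensorSubcategory {k : Type w} [Field k] {C : Type u₁} [Category.{v₁} C]
    [MonoidalCategory C] {M : Type u₂} [Category.{v₂} M] [Preadditive M] [Linear k M]
    [MonoidalLeftAction C M] (P : ObjectProperty (ModuleEnd k C M)) : Prop
    extends P.IsMonoidal where
  closedUnderFiniteProducts : P.IsClosedUnderFiniteProducts
  closedUnderSubobjects : P.IsClosedUnderSubobjects
  closedUnderQuotients : P.IsClosedUnderQuotients
  rightDual : ∀ D, P D → ∃ E, P E ∧ Nonempty (ExactPairing D E)
  leftDual : ∀ D, P D → ∃ E, P E ∧ Nonempty (ExactPairing E D)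

/-! ## The relative center -/

/-- An object of the relative center `Z_D(End(M))`, where `D` is the full subcategory of `C*_M`
given by `P`: a right exact `k`-linear functor `F : M ⥤ M` with isomorphisms
`γ_D : F ∘ D ≅ D ∘ F`, natural in `D`, such that
`γ_{D ∘ D'} = (id_D ∘ γ_{D'}) (γ_D ∘ id_{D'})`. -/
structure RelCenter {k : Type w} [Field k] {C : Type u₁} [Category.{v₁} C]
    [MonoidalCategory C] {M : Type u₂} [Category.{v₂} M] [Preadditive M] [Linear k M]
    [MonoidalLeftAction C M] (P : ObjectProperty (ModuleEnd k C M)) [P.IsMonoidal] where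
  functor : M ⥤ M
  additive : functor.Additive
  linear : functor.Linear k
  rightExact : PreservesFiniteColimits functor
  γ (D : ModuleEnd k C M) (hD : P D) (N : M) :
    functor.obj (D.functor.obj N) ≅ D.functor.obj (functor.obj N)
  natural (D : ModuleEnd k C M) (hD : P D) {N N' : M} (f : N ⟶ N') :
    functor.map (D.functor.map f) ≫ (γ D hD N').hom =
      (γ D hD N).hom ≫ D.functor.map (functor.map f)
  natural_half {D D' : ModuleEnd k C M} (hD : P D) (hD' : P D') (f : D ⟶ D') (N : M) :
    functor.map (f.app N) ≫ (γ D' hD' N).hom = (γ D hD N).hom ≫ f.app (functor.obj N)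
  hexagon {D D' : ModuleEnd k C M} (hD : P D) (hD' : P D') (N : M) :
    (γ (D.compEnd D') (P.prop_tensor hD hD') N).hom =
      (γ D hD (D'.functor.obj N)).hom ≫ D.functor.map (γ D' hD' N).hom

namespace RelCenter

section

variable {k : Type w} [Field k] {C : Type u₁} [Category.{v₁} C] [MonoidalCategory C]
  {M : Type u₂} [Category.{v₂} M] [Preadditive M] [Linear k M] [MonoidalLeftAction C M]
  {P : ObjectProperty (ModuleEnd k C M)} [P.IsMonoidal]

/-- Morphisms of the relative center: natural transformations commuting with half-braidings. -/
@[ext]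
structure Hom (F G : RelCenter P) where
  app (N : M) : F.functor.obj N ⟶ G.functor.obj N
  naturality {N N' : M} (f : N ⟶ N') : F.functor.map f ≫ app N' = app N ≫ G.functor.map f
  comm (D : ModuleEnd k C M) (hD : P D) (N : M) :
    app (D.functor.obj N) ≫ (G.γ D hD N).hom = (F.γ D hD N).hom ≫ D.functor.map (app N)

instance : Category (RelCenter P) where
  Hom := Hom
  id F := { app N := 𝟙 _, naturality := by simp, comm := by simp }
  comp a b :=
    { app N := a.app N ≫ b.app N
      naturality f := by simp [reassoc_of% a.naturality, b.naturality]
      comm D hD N := by simp [reassoc_of% a.comm, b.comm] }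
  id_comp a := by ext; simp
  comp_id a := by ext; simp
  assoc a b c := by ext; simp

@[ext]
lemma hom_ext {F G : RelCenter P} {a b : F ⟶ G} (h : ∀ N, a.app N = b.app N) : a = b :=
  Hom.ext (funext h)

@[simp]
lemma id_app (F : RelCenter P) (N : M) : Hom.app (𝟙 F) N = 𝟙 (F.functor.obj N) := rfl

@[simp]
lemma comp_app {F G H : RelCenter P} (a : F ⟶ G) (b : G ⟶ H) (N : M) :
    Hom.app (a ≫ b) N = a.app N ≫ b.app N := rfl

/-- Construct isomorphisms of the relative center from components. -/
@[simps]
def isoMk {F G : RelCenter P} (e : ∀ N, F.functor.obj N ≅ G.functor.obj N)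
    (naturality : ∀ (N N' : M) (f : N ⟶ N'),
      F.functor.map f ≫ (e N').hom = (e N).hom ≫ G.functor.map f)
    (comm : ∀ (D : ModuleEnd k C M) (hD : P D) (N : M),
      (e (D.functor.obj N)).hom ≫ (G.γ D hD N).hom =
        (F.γ D hD N).hom ≫ D.functor.map (e N).hom) : F ≅ G where
  hom := { app N := (e N).hom, naturality := naturality _ _, comm := comm }
  inv :=
    { app N := (e N).inv
      naturality f := by
        rw [Iso.eq_inv_comp, ← Category.assoc, ← naturality, Category.assoc, Iso.hom_inv_id,
          Category.comp_id]
      comm D hD N := by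
        rw [Iso.inv_comp_eq, ← Category.assoc, comm, Category.assoc, ← Functor.map_comp,
          Iso.hom_inv_id, CategoryTheory.Functor.map_id, Category.comp_id] }
  hom_inv_id := by ext; simp
  inv_hom_id := by ext; simp

/-! ### The linear structure: pointwise addition and scalar multiplication -/

instance (F G : RelCenter P) : Zero (F ⟶ G) :=
  ⟨{ app N := 0
     naturality f := by simp
     comm D hD N := by have := D.additive; simp }⟩

instance (F G : RelCenter P) : Add (F ⟶ G) :=
  ⟨fun a b =>
   { app N := a.app N + b.app N
     naturality f := by simp [a.naturality, b.naturality]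
     comm D hD N := by
      have := D.additive
      simp [a.comm, b.comm, Functor.map_add] }⟩

instance (F G : RelCenter P) : Neg (F ⟶ G) :=
  ⟨fun a =>
   { app N := - a.app N
     naturality f := by simp [a.naturality]
     comm D hD N := by
      have := D.additive
      simp [a.comm] }⟩

instance (F G : RelCenter P) : SMul k (F ⟶ G) :=
  ⟨fun r a =>
   { app N := r • a.app N
     naturality f := by simp [a.naturality]
     comm D hD N := by
      have := D.additive
      have := D.linear
      simp [a.comm] }⟩

@[simp] lemma zero_app (F G : RelCenter P) (N : M) : Hom.app (0 : F ⟶ G) N = 0 := rfl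
@[simp] lemma add_app {F G : RelCenter P} (a b : F ⟶ G) (N : M) :
    Hom.app (a + b) N = a.app N + b.app N := rfl
@[simp] lemma neg_app {F G : RelCenter P} (a : F ⟶ G) (N : M) :
    Hom.app (-a) N = - a.app N := rfl
@[simp] lemma smul_app {F G : RelCenter P} (r : k) (a : F ⟶ G) (N : M) :
    Hom.app (r • a) N = r • a.app N := rfl

instance (F G : RelCenter P) : AddCommGroup (F ⟶ G) where
  add_assoc a b c := by ext; simp [add_assoc]
  zero_add a := by ext; simp
  add_zero a := by ext; simp
  add_comm a b := by ext; simp [add_comm]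
  neg_add_cancel a := by ext; simp
  nsmul := nsmulRec
  zsmul := zsmulRec

instance (F G : RelCenter P) : Module k (F ⟶ G) where
  one_smul a := by ext; simp
  mul_smul r s a := by ext; simp [mul_smul]
  smul_zero r := by ext; simp
  smul_add r a b := by ext; simp
  add_smul r s a := by ext; simp [add_smul]
  zero_smul a := by ext; simp

instance : Preadditive (RelCenter P) where
  add_comp _ _ _ a b c := by ext; simp
  comp_add _ _ _ a b c := by ext; simp

instance : Linear k (RelCenter P) where
  smul_comp _ _ _ r a b := by ext; simp
  comp_smul _ _ _ a r b := by ext; simp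

/-! ### The monoidal structure: composition of functors -/

/-- The unit object: the identity functor. -/
abbrev idObj : RelCenter P where
  functor := 𝟭 M
  additive := inferInstance
  linear := inferInstance
  rightExact := inferInstance
  γ D hD N := Iso.refl _
  natural D hD f := by simp
  natural_half hD hD' f N := by simp
  hexagon hD hD' N := by simp

/-- The composition `F ∘ G`, with half-braiding `F ∘ G ∘ D ≅ F ∘ D ∘ G ≅ D ∘ F ∘ G`. -/
abbrev compObj (F G : RelCenter P) : RelCenter P where
  functor := G.functor ⋙ F.functor
  additive := by
    have := F.additive; have := G.additive; infer_instance
  linear := by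
    have := F.additive; have := G.additive; have := F.linear; have := G.linear; infer_instance
  rightExact := by
    have := F.rightExact; have := G.rightExact; exact comp_preservesFiniteColimits _ _
  γ D hD N := F.functor.mapIso (G.γ D hD N) ≪≫ F.γ D hD (G.functor.obj N)
  natural D hD N N' f := by
    simp only [Functor.comp_obj, Functor.comp_map, Iso.trans_hom, Functor.mapIso_hom,
      Category.assoc]
    rw [← F.natural, ← Functor.map_comp_assoc, G.natural, Functor.map_comp_assoc]
  natural_half hD hD' f N := by
    simp only [Functor.comp_obj, Functor.comp_map, Iso.trans_hom, Functor.mapIso_hom,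
      Category.assoc]
    rw [← F.natural_half hD hD', ← Functor.map_comp_assoc, G.natural_half hD hD',
      Functor.map_comp_assoc]
  hexagon {D D'} hD hD' N := by
    simp only [Functor.comp_obj, Iso.trans_hom, Functor.mapIso_hom]
    rw [F.hexagon hD hD', G.hexagon hD hD']
    simp only [Functor.map_comp, Category.assoc]
    rw [← reassoc_of% (F.natural D hD (G.γ D' hD' N).hom)]

/-- The functor `F ∘ -` on morphisms. -/
abbrev whiskerL (F : RelCenter P) {G G' : RelCenter P} (a : G ⟶ G') :
    compObj F G ⟶ compObj F G' :=
  { app N := F.functor.map (a.app N)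
    naturality f := by
      simp only [Functor.comp_map, ← Functor.map_comp, a.naturality]
    comm D hD N := by
      simp only [Iso.trans_hom, Functor.mapIso_hom, Category.assoc]
      rw [← F.natural, ← Functor.map_comp_assoc, a.comm, Functor.map_comp_assoc] }

/-- The functor `- ∘ G` on morphisms. -/
abbrev whiskerR {F F' : RelCenter P} (a : F ⟶ F') (G : RelCenter P) :
    compObj F G ⟶ compObj F' G :=
  { app N := a.app (G.functor.obj N)
    naturality f := a.naturality _
    comm D hD N := by
      simp only [Iso.trans_hom, Functor.mapIso_hom, Category.assoc]
      rw [← a.comm, ← reassoc_of% a.naturality] }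

/-- The tensor product of `Z_D(End(M))` is the composition of functors, `F ⊗ G = F ∘ G`. -/
instance : MonoidalCategoryStruct (RelCenter P) where
  tensorObj F G := compObj F G
  tensorUnit := idObj
  whiskerLeft F _ _ a := whiskerL F a
  whiskerRight a G := whiskerR a G
  tensorHom {F _ _ G'} a b := whiskerR a _ ≫ whiskerL _ b
  associator F G H := isoMk (fun N => Iso.refl _) (fun _ _ _ => by simp) (fun _ _ _ => by simp)
  leftUnitor F := isoMk (fun N => Iso.refl _) (fun _ _ _ => by simp) (fun _ _ _ => by simp)
  rightUnitor F := isoMk (fun N => Iso.refl _) (fun _ _ _ => by simp) (fun _ _ _ => by simp)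

instance : MonoidalCategory (RelCenter P) where
  tensorHom_def _ _ := rfl
  id_tensorHom_id F G := by
    ext N
    exact (Category.id_comp _).trans (F.functor.map_id _)
  tensorHom_comp_tensorHom {F₁ F₂ F₃ G₁ G₂ G₃} a₁ b₁ a₂ b₂ := by
    ext N
    change (a₁.app _ ≫ F₂.functor.map (b₁.app N)) ≫ a₂.app _ ≫ F₃.functor.map (b₂.app N) =
      (a₁.app _ ≫ a₂.app _) ≫ F₃.functor.map (b₁.app N ≫ b₂.app N)
    simp only [Category.assoc, Functor.map_comp]
    rw [reassoc_of% a₂.naturality]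
  whiskerLeft_id F G := by
    ext N
    exact F.functor.map_id _
  id_whiskerRight F G := by
    ext N
    rfl
  associator_naturality {F₁ F₂ F₃ G₁ G₂ G₃} a b c := by
    ext N
    change ((a.app _ ≫ G₁.functor.map (b.app _)) ≫ G₁.functor.map (G₂.functor.map (c.app N)))
      ≫ 𝟙 _ = 𝟙 _ ≫ a.app _ ≫ G₁.functor.map (b.app _ ≫ G₂.functor.map (c.app N))
    simp
  leftUnitor_naturality {F G} a := by
    ext N
    exact (Category.comp_id _).trans (Category.id_comp _).symm
  rightUnitor_naturality {F G} a := by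
    ext N
    exact (Category.comp_id _).trans (Category.id_comp _).symm
  pentagon F G H K := by
    ext N
    change 𝟙 _ ≫ 𝟙 _ ≫ F.functor.map (𝟙 _) = 𝟙 _ ≫ 𝟙 _
    simp
  triangle F G := by
    ext N
    change 𝟙 _ ≫ F.functor.map (𝟙 _) = 𝟙 _
    simp

end

section Action

variable {k : Type w} [Field k] {C : Type u₁} [Category.{v₁} C] [Preadditive C] [Linear k C]
  [MonoidalCategory C] {M : Type u₂} [Category.{v₂} M] [Preadditive M] [Linear k M]
  [MonoidalLeftAction C M] [hM : IsLeftModuleCategory k C M]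
  {P : ObjectProperty (ModuleEnd k C M)} [P.IsMonoidal]

/-- The functor `X ▷ - : M ⥤ M`. -/
abbrev actionFunctor (M : Type u₂) [Category.{v₂} M] [MonoidalLeftAction C M] (X : C) :
    M ⥤ M where
  obj N := X ⊙ₗ N
  map f := X ⊴ₗ f

/-- The object `ρ(X) = X ▷ -`, with half-braiding `X ▷ D(N) ≅ D (X ▷ N)` the inverse of the
module structure of `D`. -/
abbrev rhoObj (X : C) : RelCenter P where
  functor := actionFunctor M X
  additive := (hM.exact_right X).additive
  linear := (hM.exact_right X).linear
  rightExact := (hM.exact_right X).preservesFiniteColimits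
  γ D _ N := (D.c X N).symm
  natural D hD _ _ f := D.c_inv_right X f
  natural_half hD hD' f N := ModuleEnd.c_inv_module f X N
  hexagon {D D'} hD hD' N := by
    change (D.functor.mapIso (D'.c X N) ≪≫ D.c X (D'.functor.obj N)).inv = _
    simp

/-- The functor `ρ` on morphisms. -/
abbrev rhoMap {X Y : C} (f : X ⟶ Y) : (rhoObj X : RelCenter P) ⟶ rhoObj Y :=
  { app N := f ⊵ₗ N
    naturality g := MonoidalLeftAction.action_exchange f g
    comm D hD N := D.c_inv_left f N }

/-- The action functor `ρ : C ⥤ Z_D(End(M))`, `X ↦ X ▷ -`. -/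
abbrev rho (P : ObjectProperty (ModuleEnd k C M)) [P.IsMonoidal] : C ⥤ RelCenter P where
  obj X := rhoObj X
  map f := rhoMap f
  map_id X := by ext N; exact MonoidalLeftAction.id_actionHomLeft X N
  map_comp f g := by ext N; exact MonoidalLeftAction.comp_actionHomLeft f g N

/-- The isomorphism `ρ(X ⊗ Y) ≅ ρ(X) ∘ ρ(Y)` given by `(X ⊗ Y) ▷ N ≅ X ▷ (Y ▷ N)`. -/
def rhoAssoc (X Y : C) : (rhoObj (X ⊗ Y) : RelCenter P) ≅ rhoObj X ⊗ rhoObj Y :=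
  isoMk (fun N => αₗ X Y N)
    (fun N N' f => by
      change (X ⊗ Y) ⊴ₗ f ≫ (αₗ X Y N').hom = (αₗ X Y N).hom ≫ X ⊴ₗ (Y ⊴ₗ f)
      simp)
    (fun D hD N => D.c_inv_assoc X Y N)

/-- The isomorphism `ρ(1) ≅ Id` given by `1 ▷ N ≅ N`. -/
def rhoUnit : (rhoObj (𝟙_ C) : RelCenter P) ≅ 𝟙_ (RelCenter P) :=
  isoMk (fun N => λₗ N)
    (fun N N' f => (MonoidalLeftAction.actionUnitIso_hom_naturality f).symm)
    (fun D hD N => by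
      change (λₗ (D.functor.obj N)).hom ≫ 𝟙 _ = _
      rw [Category.comp_id]
      exact D.c_inv_unit N)

/-- The left action `X ▷ (F, γ)`: the functor `X ▷ F(-)`, with half-braiding
`X ▷ F(D(N)) ≅ X ▷ D(F(N)) ≅ D (X ▷ F(N))` given by `id_X ▷ γ_D` and the module structure of `D`;
that is, `X ▷ (F, γ) = ρ(X) ∘ (F, γ)`. -/
instance leftActionStruct : MonoidalLeftActionStruct C (RelCenter P) where
  actionObj X F := compObj (rhoObj X) F
  actionHomLeft f F := whiskerR (rhoMap f) F
  actionHomRight X _ _ a := whiskerL (rhoObj X) a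
  actionAssocIso X Y F := whiskerRightIso (rhoAssoc X Y) F ≪≫ α_ (rhoObj X) (rhoObj Y) F
  actionUnitIso F := whiskerRightIso rhoUnit F ≪≫ λ_ F

/-- The right action `(F, γ) ◁ X`: the functor `F(X ▷ -)`, with half-braiding
`F (X ▷ D(N)) ≅ F (D (X ▷ N)) ≅ D (F (X ▷ N))` given by the module structure of `D` and `γ_D`;
that is, `(F, γ) ◁ X = (F, γ) ∘ ρ(X)`. -/
instance rightActionStruct : MonoidalRightActionStruct C (RelCenter P) where
  actionObj F X := compObj F (rhoObj X)
  actionHomLeft a X := whiskerR a (rhoObj X)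
  actionHomRight F _ _ f := whiskerL F (rhoMap f)
  actionAssocIso F X Y :=
    whiskerLeftIso F (rhoAssoc X Y) ≪≫ (α_ F (rhoObj X) (rhoObj Y)).symm
  actionUnitIso F := whiskerLeftIso F rhoUnit ≪≫ ρ_ F

/-- The isomorphism `(X ▷ F) ◁ Y ≅ X ▷ (F ◁ Y)`: the identity of `X ▷ F(Y ▷ N)`. -/
def middleIso (X : C) (F : RelCenter P) (Y : C) : (X ⊙ₗ F) ⊙ᵣ Y ≅ X ⊙ₗ (F ⊙ᵣ Y) :=
  α_ (rhoObj X) F (rhoObj Y)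

end Action

end RelCenter

/-!
The relative center is a category of module functors in disguise. The tensor subcategory `𝒟` acts
on `M` by evaluation, `(D, d) ▷ N = D N`, and a half-braiding on `F` is the same thing as a
`𝒟`-module structure on `F` (`RelCenter.toModuleEnd`). So the essential point, that the relative
center is a finite abelian category, is an instance of a theorem on any monoidal category `E` with
duals that acts on a finite abelian category `M` by linear exact functors.

Right exact functors on `M` are determined by their restrictions to projective objects, and every
additive functor on projective objects extends to a right exact functor (`Proj.ext`). The action
preserves projective objects, because the functors `X ▷ -` have exact right adjoints. Hence module
endofunctors of `M` are the same as linear module functors `Proj M ⥤ M`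
(`ModuleEnd.restriction`). For the latter no exactness is required, so kernels, cokernels and
biproducts are formed pointwise and the category `ModuleFunctor k E (Proj M) M` is abelian, with
exact evaluation functors.

For the finiteness, let `G` be a projective generator of `M`. Evaluation at `G` is a faithful exact
functor `e` to `M`. An abelian category with such a functor is finite if the dimension of
`Hom(G, e F)` is bounded for the objects `F` generated by one element of `Hom(G, e F)`: a generated
object of maximal dimension then represents `Hom(G, e -)`, and is a projective generator
(`isFiniteAbelian_of_bound`). The submodule functor generated by `v : G ⟶ F G` is the pointwise
image of all `X ▷ G ⟶ F (X ▷ G) ⟶ F P`. Assume that `E` has an object `Q` such that the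
morphisms `Q ▷ N ⟶ X ▷ N` coming from `Q ⟶ X` are jointly epimorphic. Then `X = Q` suffices, and
if `v` generates `F`, then `F G` is a quotient of a power of `Q ▷ G` that does not depend on `F`
(`ModuleFunctor.exists_quotient_of_element`, `ModuleFunctor.isFiniteAbelian`).

For `E = C`, a projective generator of `C` is such an object `Q`. So the category of `C`-module
endofunctors is finite abelian and has a projective generator itself, and as `𝒟` is closed under
subobjects and sums, the largest quotient of that generator lying in `𝒟` is such an object for
`E = 𝒟` (`ModuleEnd.exists_isActionGenerator_fullSubcategory`).

Evaluation at the projective generator `G` also detects exactness of functors to the relative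
center. The functors `(F, γ) ↦ F (X ▷ G)` and `X ↦ F (X ▷ G)` are exact although `F` is only right
exact, because `X ▷ G` is projective. The remaining coherence axioms are those of the action on `M`,
read pointwise. The action functor is faithful because `X ▷ N ≠ 0` for nonzero `X` and `N`: the
evaluation from the tensor product of a dual of `X` with `X` to the simple unit object is an
epimorphism.
-/

/-! ### Finite abelian categories and projective generators -/

/-- The abelian structure on a finite abelian category, extending its preadditive structure. -/
@[reducible]
def IsFiniteAbelian.abelian (k : Type w) [Field k] (A : Type u₁) [Category.{v₁} A]
    [i : Preadditive A] [Linear k A] [h : IsFiniteAbelian k A] : Abelian A :=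
  { i with
    has_finite_products := h.hasFiniteProducts
    has_kernels := h.hasKernels
    has_cokernels := h.hasCokernels
    normalMonoOfMono := fun f _ => h.normalMono.normalMonoOfMono f
    normalEpiOfEpi := fun f _ => h.normalEpi.normalEpiOfEpi f }

namespace CategoryTheory

attribute [local instance] Abelian.hasFiniteBiproducts

open scoped ZeroObject

lemma projective_biproduct {A : Type u₁} [Category.{v₁} A] [HasZeroMorphisms A] {n : ℕ}
    (g : Fin n → A) [HasBiproduct g] [∀ b, Projective (g b)] : Projective (⨁ g) where
  factors f e _ := ⟨biproduct.desc fun b => Projective.factorThru (biproduct.ι g b ≫ f) e, by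
    ext; simp⟩

section HomFinite

variable {k : Type w} [Field k] {A : Type u₁} [Category.{v₁} A] [Abelian A] [Linear k A]

/-- An object with a finite-dimensional space of morphisms from a separator `Q` is a quotient of a
power of `Q`: the summands are indexed by a basis of the morphisms from `Q`. -/
lemma IsSeparator.exists_epi_biproduct {Q : A} (hQ : IsSeparator Q) (X : A)
    [Module.Finite k (Q ⟶ X)] : ∃ (n : ℕ) (p : (⨁ fun _ : Fin n => Q) ⟶ X), Epi p := by
  let b := Module.finBasis k (Q ⟶ X)
  refine ⟨_, biproduct.desc fun i => b i, Preadditive.epi_of_cancel_zero _ fun {Y} g hg => ?_⟩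
  refine (Preadditive.isSeparator_iff Q).1 hQ g fun h => ?_
  rw [← b.sum_repr h, Preadditive.sum_comp]
  refine Finset.sum_eq_zero fun i _ => ?_
  have := biproduct.ι (fun _ => Q) i ≫= hg
  rw [biproduct.ι_desc_assoc, comp_zero] at this
  rw [Linear.smul_comp, this, smul_zero]

/-- Since an additive functor that preserves epimorphisms sends the epimorphism `Qⁿ ⟶ X` to an
epimorphism, it sends the morphisms from a separator `Q` to `X` to a jointly epimorphic family. -/
lemma IsSeparator.eq_zero_of_map_comp {Q : A} (hQ : IsSeparator Q) (X : A)
    [Module.Finite k (Q ⟶ X)] {B : Type u₂} [Category.{v₂} B] [Preadditive B] (T : A ⥤ B)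
    [T.Additive] [T.PreservesEpimorphisms] {Y : B} (g : T.obj X ⟶ Y)
    (hg : ∀ f : Q ⟶ X, T.map f ≫ g = 0) : g = 0 := by
  obtain ⟨n, p, hp⟩ := hQ.exists_epi_biproduct (k := k) X
  rw [← cancel_epi (T.map p), comp_zero, ← Category.id_comp (T.map p), ← T.map_id,
    ← biproduct.total, T.map_sum, Preadditive.sum_comp, Preadditive.sum_comp]
  refine Finset.sum_eq_zero fun i _ => ?_
  rw [← T.map_comp, Category.assoc, T.map_comp, Category.assoc, hg, comp_zero]

end HomFinite

/-- A finite abelian category has a projective generator: the sum of projective objects that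
map onto the finitely many simple objects. -/
lemma exists_projective_separator (k : Type w) [Field k] (A : Type u₁) [Category.{v₁} A]
    [Abelian A] [Linear k A] [h : IsFiniteAbelian k A] :
    ∃ G : A, Projective G ∧ IsSeparator G := by
  obtain ⟨n, S, hS⟩ := h.finite_simples
  have := h.enoughProjectives
  refine ⟨⨁ fun i => Projective.over (S i), projective_biproduct _,
    (Preadditive.isSeparator_iff _).2 fun X Y f hf => ?_⟩
  by_contra hne
  have hI : ¬ IsZero (Abelian.image f) := fun hz => hne <| by
    rw [← Abelian.image.fac f, hz.eq_of_src (Abelian.image.ι f) 0, comp_zero]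
  have := h.artinian (Abelian.image f)
  obtain ⟨i, ⟨e⟩⟩ := hS (simpleSubobject hI) inferInstance
  -- lift `P i ⟶ S i ⟶ image f` through `X ⟶ image f`
  let q : Projective.over (S i) ⟶ Abelian.image f :=
    Projective.π (S i) ≫ e.inv ≫ simpleSubobjectArrow hI
  have h0 : (biproduct.π _ i ≫ Projective.factorThru q (Abelian.factorThruImage f)) ≫ f = 0 :=
    hf _
  have h1 : q = 0 := by
    have := biproduct.ι _ i ≫= h0
    rw [Category.assoc, biproduct.ι_π_self_assoc, comp_zero] at this
    rw [← cancel_mono (Abelian.image.ι f), zero_comp,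
      ← Projective.factorThru_comp q (Abelian.factorThruImage f), Category.assoc,
      Abelian.image.fac f, this]
  have h2 : simpleSubobjectArrow hI = 0 := by
    have h3 : Epi (Projective.π (S i) ≫ e.inv) := epi_comp _ _
    rw [← cancel_epi (Projective.π (S i) ≫ e.inv), comp_zero, Category.assoc]
    exact h1
  have h4 : 𝟙 (simpleSubobject hI) = 0 := by
    rw [← cancel_mono (simpleSubobjectArrow hI), h2, comp_zero, comp_zero]
  exact id_nonzero _ h4

/-! ### A finiteness criterion for abelian categories -/

section Criterion

variable (k : Type w) [Field k] {A : Type u₁} [Category.{v₁} A] [Abelian A]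
  {M : Type u₂} [Category.{v₂} M] [Abelian M] [Linear k M] (e : A ⥤ M)

/-- The element `x : G ⟶ e X` of `X` generates `X`: no nonzero morphism from `X` kills it. -/
def IsGeneratedBy {G : M} {X : A} (x : G ⟶ e.obj X) : Prop :=
  ∀ ⦃Y : A⦄ (g : X ⟶ Y), x ≫ e.map g = 0 → g = 0

variable [e.Additive] [PreservesFiniteLimits e] [e.Faithful]
  (hfin : ∀ X Y : M, Module.Finite k (X ⟶ Y)) {G : M} (hG : IsSeparator G)

section

include k e hfin hG

omit [e.Additive] in
/-- A monomorphism `X ⟶ Y` is an isomorphism if it induces a surjection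
`Hom(G, e X) ⟶ Hom(G, e Y)`, in particular if these spaces have the same dimension. -/
lemma isIso_of_mono_of_finrank_le {X Y : A} (i : X ⟶ Y) [Mono i]
    (h : Module.finrank k (G ⟶ e.obj Y) ≤ Module.finrank k (G ⟶ e.obj X)) : IsIso i := by
  have := hfin G (e.obj X)
  have := hfin G (e.obj Y)
  have hinj : Function.Injective (Linear.rightComp k G (e.map i)) := fun a b hab =>
    (cancel_mono (e.map i)).1 hab
  have hsurj := (LinearMap.injective_iff_surjective_of_finrank_eq_finrank
    (le_antisymm (LinearMap.finrank_le_finrank_of_injective hinj) h)).1 hinj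
  have : Epi (e.map i) := Preadditive.epi_of_cancel_zero _ fun {Z} g hg =>
    (Preadditive.isSeparator_iff G).1 hG g fun x => by
      obtain ⟨y, rfl⟩ := hsurj x
      change (y ≫ e.map i) ≫ g = 0
      rw [Category.assoc, hg, comp_zero]
  have : Epi i := e.epi_of_epi_map this
  exact isIso_of_mono_of_epi i

omit [e.Additive] in
lemma finrank_lt_of_mono {X Y : A} (i : X ⟶ Y) [Mono i] (h : ¬ IsIso i) :
    Module.finrank k (G ⟶ e.obj X) < Module.finrank k (G ⟶ e.obj Y) :=
  lt_of_not_ge fun h' => h (isIso_of_mono_of_finrank_le k e hfin hG i h')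

omit [e.Additive] in
lemma isNoetherianObject_and_isArtinianObject_of_faithful (X : A) :
    IsNoetherianObject X ∧ IsArtinianObject X := by
  have hle : ∀ {Y Z : A} (i : Y ⟶ Z) [Mono i],
      Module.finrank k (G ⟶ e.obj Y) ≤ Module.finrank k (G ⟶ e.obj Z) := fun {Y Z} i _ => by
    by_cases h : IsIso i
    · exact ((Linear.homCongr k (Iso.refl G) (e.mapIso (asIso i))).finrank_eq).le
    · exact (finrank_lt_of_mono k e hfin hG i h).le
  let d : Subobject X → Fin (Module.finrank k (G ⟶ e.obj X) + 1) := fun K =>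
    ⟨Module.finrank k (G ⟶ e.obj (K : A)), Nat.lt_succ_of_le (hle K.arrow)⟩
  have hd : StrictMono d := fun K L hKL => by
    refine finrank_lt_of_mono k e hfin hG (Subobject.ofLE K L hKL.le) fun h => ?_
    refine hKL.not_ge (Subobject.le_of_comm (inv (Subobject.ofLE K L hKL.le)) ?_)
    rw [IsIso.inv_comp_eq, Subobject.ofLE_arrow]
  exact ⟨⟨hd.wellFoundedGT⟩, ⟨hd.wellFoundedLT⟩⟩

/-- Every element lies in a subobject that it generates. -/
lemma exists_isGeneratedBy (n : ℕ) : ∀ {X : A} (x : G ⟶ e.obj X),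
    Module.finrank k (G ⟶ e.obj X) ≤ n →
    ∃ (K : A) (i : K ⟶ X) (y : G ⟶ e.obj K), Mono i ∧ y ≫ e.map i = x ∧ IsGeneratedBy e y := by
  induction n with
  | zero =>
    intro X x hX
    refine ⟨X, 𝟙 X, x, inferInstance, by simp, fun Y g _ => ?_⟩
    have := hfin G (e.obj X)
    have hs : Subsingleton (G ⟶ e.obj X) := Module.finrank_zero_iff.1 (Nat.le_zero.1 hX)
    refine e.map_injective ?_
    rw [e.map_zero]
    refine (Preadditive.isSeparator_iff G).1 hG _ fun z => ?_
    rw [hs.elim z 0, zero_comp]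
  | succ n ih =>
    intro X x hX
    by_cases hx : IsGeneratedBy e x
    · exact ⟨X, 𝟙 X, x, inferInstance, by simp, hx⟩
    · simp only [IsGeneratedBy, not_forall] at hx
      obtain ⟨Y, g, hg, hne⟩ := hx
      have hni : ¬ IsIso (kernel.ι g) := fun h => hne <| by
        rw [← cancel_epi (kernel.ι g), kernel.condition, comp_zero]
      have hlt := finrank_lt_of_mono k e hfin hG (kernel.ι g) hni
      -- the element lies in `e (ker g) = ker (e g)`
      let l : G ⟶ e.obj (kernel g) := (kernel.lift (e.map g) x hg) ≫ (PreservesKernel.iso e g).inv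
      have hl : l ≫ e.map (kernel.ι g) = x := by simp [l]
      obtain ⟨K, i, y, hi, hy, hgen⟩ := ih l (by omega)
      exact ⟨K, i ≫ kernel.ι g, y, mono_comp _ _,
        by rw [e.map_comp, reassoc_of% hy, hl], hgen⟩

end

/-- If the objects generated by one element are bounded, there is a universal element: a largest
generated object represents `Hom(G, e -)`. -/
lemma exists_universal_element [PreservesFiniteColimits e]
    (hfin : ∀ X Y : M, Module.Finite k (X ⟶ Y)) (hG : IsSeparator G) [Projective G] (N : ℕ)
    (hN : ∀ {X : A} (x : G ⟶ e.obj X), IsGeneratedBy e x →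
      Module.finrank k (G ⟶ e.obj X) ≤ N) :
    ∃ (X : A) (x : G ⟶ e.obj X), ∀ {Y : A} (y : G ⟶ e.obj Y), ∃! f : X ⟶ Y, x ≫ e.map f = y := by
  classical
  -- a generated object of maximal dimension
  let S : Set ℕ := {n | ∃ (X : A) (x : G ⟶ e.obj X), IsGeneratedBy e x ∧
    Module.finrank k (G ⟶ e.obj X) = n}
  have hSN : ∀ n ∈ S, n ≤ N := by
    rintro _ ⟨X, x, hx, rfl⟩
    exact hN x hx
  have hS : S.Nonempty := by
    obtain ⟨K, i, y, -, -, hy⟩ := exists_isGeneratedBy k e hfin hG _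
      (0 : G ⟶ e.obj (0 : A)) le_rfl
    exact ⟨_, K, y, hy, rfl⟩
  obtain ⟨X, x, hx, hX⟩ : sSup S ∈ S := Nat.sSup_mem hS ⟨N, hSN⟩
  have hmax : ∀ {Y : A} (y : G ⟶ e.obj Y), IsGeneratedBy e y →
      Module.finrank k (G ⟶ e.obj Y) ≤ Module.finrank k (G ⟶ e.obj X) := fun {Y} y hy =>
    hX ▸ le_csSup ⟨N, hSN⟩ ⟨Y, y, hy, rfl⟩
  refine ⟨X, x, fun {Y} y => ?_⟩
  -- the subobject of `X ⊞ Y` generated by `(x, y)` maps onto `X`, hence isomorphically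
  obtain ⟨K, i, z, hi, hz, hgen⟩ := exists_isGeneratedBy k e hfin hG _
    (x ≫ e.map (biprod.inl : X ⟶ X ⊞ Y) + y ≫ e.map biprod.inr) le_rfl
  have hzx : z ≫ e.map (i ≫ biprod.fst) = x := by
    rw [e.map_comp, reassoc_of% hz, Preadditive.add_comp, Category.assoc, Category.assoc,
      ← e.map_comp, ← e.map_comp]
    simp
  have hzy : z ≫ e.map (i ≫ biprod.snd) = y := by
    rw [e.map_comp, reassoc_of% hz, Preadditive.add_comp, Category.assoc, Category.assoc,
      ← e.map_comp, ← e.map_comp]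
    simp
  have hepi : Epi (i ≫ biprod.fst) := Preadditive.epi_of_cancel_zero _ fun {W} g hg => hx g <| by
    rw [← hzx, Category.assoc, ← e.map_comp, hg, e.map_zero, comp_zero]
  have := hfin G (e.obj X)
  have := hfin G (e.obj K)
  have hsurj : Function.Surjective (Linear.rightComp k G (e.map (i ≫ biprod.fst))) := fun t =>
    ⟨Projective.factorThru t (e.map (i ≫ biprod.fst)), Projective.factorThru_comp _ _⟩
  have hinj := (LinearMap.injective_iff_surjective_of_finrank_eq_finrank
    (le_antisymm (hmax z hgen) (LinearMap.finrank_le_finrank_of_surjective hsurj))).2 hsurj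
  have hmono : Mono (e.map (i ≫ biprod.fst)) := Preadditive.mono_of_cancel_zero _ fun {W} g hg =>
    (Preadditive.isSeparator_iff G).1 hG g fun t => hinj <| by
      change (t ≫ g) ≫ _ = 0 ≫ _
      rw [Category.assoc, hg, comp_zero, zero_comp]
  have : Mono (i ≫ biprod.fst) := e.mono_of_mono_map hmono
  have : IsIso (i ≫ biprod.fst) := isIso_of_mono_of_epi _
  refine ⟨inv (i ≫ biprod.fst) ≫ i ≫ biprod.snd, ?_, fun f hf => ?_⟩
  · change x ≫ e.map (inv (i ≫ biprod.fst) ≫ i ≫ biprod.snd) = y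
    nth_rw 1 [← hzx]
    rw [Category.assoc, ← e.map_comp, IsIso.hom_inv_id_assoc, hzy]
  · rw [← sub_eq_zero]
    refine hx _ ?_
    change x ≫ e.map f = y at hf
    rw [e.map_sub, Preadditive.comp_sub, sub_eq_zero, hf]
    rw [← hzx, Category.assoc, ← e.map_comp, IsIso.hom_inv_id_assoc, hzy]

/-- An object representing `Hom(G, e -)` is projective because `G` is projective and `e` is exact,
and a separator because `G` is a separator and `e` is faithful. -/
lemma exists_projective_separator_of_bound [PreservesFiniteColimits e]
    (hfin : ∀ X Y : M, Module.Finite k (X ⟶ Y)) (hG : IsSeparator G) [Projective G] (N : ℕ)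
    (hN : ∀ {X : A} (x : G ⟶ e.obj X), IsGeneratedBy e x →
      Module.finrank k (G ⟶ e.obj X) ≤ N) :
    ∃ X : A, Projective X ∧ IsSeparator X := by
  obtain ⟨X, x, hx⟩ := exists_universal_element k e hfin hG N hN
  refine ⟨X, ⟨fun {E Y} f p hp => ?_⟩, (Preadditive.isSeparator_iff X).2 fun Y Z f hf => ?_⟩
  · obtain ⟨g, hg, -⟩ := hx (Projective.factorThru (x ≫ e.map f) (e.map p))
    refine ⟨g, (hx (x ≫ e.map f)).unique ?_ rfl⟩
    rw [e.map_comp, reassoc_of% hg, Projective.factorThru_comp]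
  · refine e.map_injective ?_
    rw [e.map_zero]
    refine (Preadditive.isSeparator_iff G).1 hG _ fun y => ?_
    obtain ⟨g, rfl, -⟩ := hx y
    rw [Category.assoc, ← e.map_comp, hf, e.map_zero, comp_zero]

/-- Up to isomorphism, only finitely many simple objects are quotients of `X`. The induction
passes from `X` to the kernel of a morphism from `X` to a simple object. -/
lemma exists_list_simple_quotients
    (hfin : ∀ X Y : M, Module.Finite k (X ⟶ Y)) (hG : IsSeparator G) (n : ℕ) : ∀ (X : A),
    Module.finrank k (G ⟶ e.obj X) ≤ n →
    ∃ l : List A, ∀ (S : A), Simple S → ∀ f : X ⟶ S, f ≠ 0 → ∃ T ∈ l, Nonempty (S ≅ T) := by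
  induction n with
  | zero =>
    refine fun X hX => ⟨[], fun S _ f hf => (hf ?_).elim⟩
    have := hfin G (e.obj X)
    have hs : Subsingleton (G ⟶ e.obj X) := Module.finrank_zero_iff.1 (Nat.le_zero.1 hX)
    refine e.map_injective ?_
    rw [e.map_zero]
    refine (Preadditive.isSeparator_iff G).1 hG _ fun z => ?_
    rw [hs.elim z 0, zero_comp]
  | succ n ih =>
    intro X hX
    by_cases h : ∃ (S₀ : A) (f₀ : X ⟶ S₀), Simple S₀ ∧ f₀ ≠ 0
    · obtain ⟨S₀, f₀, hS₀, hf₀⟩ := h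
      have hni : ¬ IsIso (kernel.ι f₀) := fun h => hf₀ <| by
        rw [← cancel_epi (kernel.ι f₀), kernel.condition, comp_zero]
      obtain ⟨l, hl⟩ := ih (kernel f₀) (by
        have := finrank_lt_of_mono k e hfin hG (kernel.ι f₀) hni
        omega)
      refine ⟨S₀ :: l, fun S hS f hf => ?_⟩
      by_cases h0 : kernel.ι f₀ ≫ f = 0
      · have := epi_of_nonzero_to_simple hf₀
        have hd : f₀ ≫ Abelian.epiDesc f₀ f h0 = f := Abelian.comp_epiDesc _ _ _
        have hd0 : Abelian.epiDesc f₀ f h0 ≠ 0 := fun h' => hf (by rw [← hd, h', comp_zero])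
        have := isIso_of_hom_simple hd0
        exact ⟨S₀, by simp, ⟨(asIso (Abelian.epiDesc f₀ f h0)).symm⟩⟩
      · obtain ⟨T, hT, hi⟩ := hl S hS _ h0
        exact ⟨T, by simp [hT], hi⟩
    · exact ⟨[], fun S hS f hf => (h ⟨S, f, hS, hf⟩).elim⟩

/-- An abelian category with a faithful exact functor `e` to a finite abelian category with
projective generator `G` is finite if the objects generated by one element of `Hom(G, e -)` are
bounded. -/
lemma isFiniteAbelian_of_bound [Linear k A] [e.Linear k] [PreservesFiniteColimits e]
    (hfin : ∀ X Y : M, Module.Finite k (X ⟶ Y)) (hG : IsSeparator G) [Projective G] (N : ℕ)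
    (hN : ∀ {X : A} (x : G ⟶ e.obj X), IsGeneratedBy e x →
      Module.finrank k (G ⟶ e.obj X) ≤ N) : IsFiniteAbelian k A := by
  obtain ⟨Q, hQ, hQs⟩ := exists_projective_separator_of_bound k e hfin hG N hN
  have hfinA : ∀ X Y : A, Module.Finite k (X ⟶ Y) := fun X Y =>
    have := hfin (e.obj X) (e.obj Y)
    Module.Finite.of_injective (e.mapLinearMap k : (X ⟶ Y) →ₗ[k] _) e.map_injective
  exact
    { hasFiniteProducts := inferInstance
      hasKernels := inferInstance
      hasCokernels := inferInstance
      normalMono := inferInstance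
      normalEpi := inferInstance
      finite_hom := hfinA
      noetherian := fun X => (isNoetherianObject_and_isArtinianObject_of_faithful k e hfin hG X).1
      artinian := fun X => (isNoetherianObject_and_isArtinianObject_of_faithful k e hfin hG X).2
      enoughProjectives := ⟨fun X => by
        obtain ⟨n, p, hp⟩ := hQs.exists_epi_biproduct (k := k) X
        exact ⟨{ p := _, f := p, projective := projective_biproduct _, epi := hp }⟩⟩
      finite_simples := by
        obtain ⟨l, hl⟩ := exists_list_simple_quotients k e hfin hG _ Q le_rfl
        refine ⟨l.length, l.get, fun S hS => ?_⟩
        by_cases h : ∃ f : Q ⟶ S, f ≠ 0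
        · obtain ⟨f, hf⟩ := h
          obtain ⟨T, hT, hi⟩ := hl S hS f hf
          obtain ⟨i, rfl⟩ := List.get_of_mem hT
          exact ⟨i, hi⟩
        · push Not at h
          exact (id_nonzero S ((Preadditive.isSeparator_iff Q).1 hQs _ fun f => by
            rw [h f, zero_comp])).elim }

end Criterion

/-- Let `Q` be an artinian object, and let the property `P` be closed under subobjects and binary
products. Then the quotient of `Q` by the least kernel of a morphism from `Q` to an object with
the property `P` is the largest quotient of `Q` with the property `P`. -/
lemma exists_largest_quotient {A : Type u₁} [Category.{v₁} A] [Abelian A] {Q : A}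
    [IsArtinianObject Q] (P : ObjectProperty A) (h0 : ∃ X, P X)
    (hsub : ∀ {X Y : A} (i : X ⟶ Y), Mono i → P Y → P X)
    (hprod : ∀ {X Y : A}, P X → P Y → P (X ⊞ Y)) :
    ∃ (Q' : A) (q : Q ⟶ Q'), P Q' ∧ Epi q ∧
      ∀ {X : A}, P X → ∀ f : Q ⟶ X, ∃ g : Q' ⟶ X, q ≫ g = f := by
  let S : Set (Subobject Q) := {K | ∃ (X : A) (f : Q ⟶ X), P X ∧ K = kernelSubobject f}
  have hS : S.Nonempty := by
    obtain ⟨X, hX⟩ := h0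
    exact ⟨_, X, 0, hX, rfl⟩
  obtain ⟨K, ⟨X, f, hX, rfl⟩, hmin⟩ := (wellFounded_lt (α := Subobject Q)).has_min S hS
  refine ⟨Abelian.image f, Abelian.factorThruImage f, hsub (Abelian.image.ι f) inferInstance hX,
    inferInstance, fun {Y} hY g => ?_⟩
  -- minimality is applied to the kernel of `Q ⟶ X ⊞ Y`
  have hle : kernelSubobject (biprod.lift f g) ≤ kernelSubobject f :=
    le_kernelSubobject _ _ (by
      have := kernelSubobject_arrow_comp (biprod.lift f g) =≫ biprod.fst
      rwa [Category.assoc, biprod.lift_fst, zero_comp] at this)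
  have heq : kernelSubobject f ≤ kernelSubobject (biprod.lift f g) := by
    by_contra h
    exact hmin _ ⟨_, biprod.lift f g, hprod hX hY, rfl⟩ (lt_of_le_not_ge hle h)
  have hk : kernel.ι f ≫ g = 0 := by
    have h1 : (kernelSubobject f).arrow ≫ g = 0 := by
      have := kernelSubobject_arrow_comp (biprod.lift f g) =≫ biprod.snd
      rw [Category.assoc, biprod.lift_snd, zero_comp] at this
      rw [← Subobject.ofLE_arrow heq, Category.assoc, this, comp_zero]
    rw [← kernelSubobject_arrow' f, Category.assoc, h1, comp_zero]
  refine ⟨Abelian.epiDesc (Abelian.factorThruImage f) g ?_, Abelian.comp_epiDesc _ _ _⟩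
  have h2 : kernel.ι (Abelian.factorThruImage f) ≫ f = 0 := by
    have := kernel.condition (Abelian.factorThruImage f) =≫ Abelian.image.ι f
    rwa [Category.assoc, Abelian.image.fac, zero_comp] at this
  rw [← kernel.lift_ι f _ h2, Category.assoc, hk, comp_zero]

end CategoryTheory

/-! ### Exact actions -/

/-- A left action of `E` on `M` by `k`-linear exact functors `X ▷ -`. No exactness is required in
the variable `X`, so that `E` need not be additive. -/
class IsExactAction (k : Type w) [Field k] (E : Type u₁) [Category.{v₁} E] [MonoidalCategory E]
    (M : Type u₂) [Category.{v₂} M] [Preadditive M] [Linear k M] [MonoidalLeftAction E M] :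
    Prop where
  isLinearExact : ∀ X : E, IsLinearExact k ((MonoidalLeftAction.curriedAction E M).obj X)

namespace IsExactAction

variable (k : Type w) [Field k] {E : Type u₁} [Category.{v₁} E] [MonoidalCategory E]
  {M : Type u₂} [Category.{v₂} M] [Preadditive M] [Linear k M] [MonoidalLeftAction E M]
  [h : IsExactAction k E M]

include k h

lemma actionHomRight_add (X : E) {N N' : M} (f g : N ⟶ N') : X ⊴ₗ (f + g) = X ⊴ₗ f + X ⊴ₗ g :=
  (h.isLinearExact X).additive.map_add

lemma actionHomRight_zero (X : E) (N N' : M) : X ⊴ₗ (0 : N ⟶ N') = 0 :=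
  have := (h.isLinearExact X).additive
  ((MonoidalLeftAction.curriedAction E M).obj X).map_zero N N'

lemma actionHomRight_neg (X : E) {N N' : M} (f : N ⟶ N') : X ⊴ₗ (-f) = - X ⊴ₗ f :=
  have := (h.isLinearExact X).additive
  ((MonoidalLeftAction.curriedAction E M).obj X).map_neg

lemma actionHomRight_sum (X : E) {N N' : M} {ι : Type*} (s : Finset ι) (f : ι → (N ⟶ N')) :
    X ⊴ₗ (∑ i ∈ s, f i) = ∑ i ∈ s, X ⊴ₗ f i :=
  have := (h.isLinearExact X).additive
  ((MonoidalLeftAction.curriedAction E M).obj X).map_sum f s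

lemma actionHomRight_smul (X : E) {N N' : M} (r : k) (f : N ⟶ N') :
    X ⊴ₗ (r • f) = r • X ⊴ₗ f :=
  (h.isLinearExact X).linear.map_smul f r

lemma mono_actionHomRight (X : E) {N N' : M} (f : N ⟶ N') [Mono f] : Mono (X ⊴ₗ f) :=
  have := (h.isLinearExact X).preservesFiniteLimits
  inferInstanceAs (Mono (((MonoidalLeftAction.curriedAction E M).obj X).map f))

lemma epi_actionHomRight (X : E) {N N' : M} (f : N ⟶ N') [Epi f] : Epi (X ⊴ₗ f) :=
  have := (h.isLinearExact X).preservesFiniteColimits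
  inferInstanceAs (Epi (((MonoidalLeftAction.curriedAction E M).obj X).map f))

lemma exists_lift_kernel (X : E) {N N' : M} (f : N ⟶ N') [HasKernel f] {Z : M}
    (g : Z ⟶ X ⊙ₗ N) (hg : g ≫ X ⊴ₗ f = 0) :
    ∃ t : Z ⟶ X ⊙ₗ kernel f, t ≫ X ⊴ₗ kernel.ι f = g := by
  have := (h.isLinearExact X).additive
  have := (h.isLinearExact X).preservesFiniteLimits
  let T := (MonoidalLeftAction.curriedAction E M).obj X
  exact ⟨(isLimitForkMapOfIsLimit' T (kernel.condition f) (kernelIsKernel f)).lift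
      (KernelFork.ofι g hg),
    (isLimitForkMapOfIsLimit' T (kernel.condition f) (kernelIsKernel f)).fac (KernelFork.ofι g hg)
      WalkingParallelPair.zero⟩

lemma exists_desc_cokernel (X : E) {N N' : M} (f : N ⟶ N') [HasCokernel f] {Z : M}
    (g : X ⊙ₗ N' ⟶ Z) (hg : X ⊴ₗ f ≫ g = 0) :
    ∃ t : X ⊙ₗ cokernel f ⟶ Z, X ⊴ₗ cokernel.π f ≫ t = g := by
  have := (h.isLinearExact X).additive
  have := (h.isLinearExact X).preservesFiniteColimits
  let T := (MonoidalLeftAction.curriedAction E M).obj X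
  exact ⟨(isColimitCoforkMapOfIsColimit' T (cokernel.condition f)
    (cokernelIsCokernel f)).desc (CokernelCofork.ofπ g hg),
    (isColimitCoforkMapOfIsColimit' T (cokernel.condition f)
    (cokernelIsCokernel f)).fac (CokernelCofork.ofπ g hg)
      WalkingParallelPair.one⟩

end IsExactAction

/-! ### Linear module functors -/

/-- A `k`-linear functor `F : N ⥤ M` between categories with an action of `E`, with natural
isomorphisms `c : F (X ▷ P) ≅ X ▷ F P` compatible with the associativity and unit constraints. -/
structure ModuleFunctor (k : Type w) [Field k] (E : Type u₁) [Category.{v₁} E]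
    [MonoidalCategory E] (N : Type u₃) [Category.{v₃} N] [Preadditive N] [Linear k N]
    [MonoidalLeftAction E N] (M : Type u₂) [Category.{v₂} M] [Preadditive M] [Linear k M]
    [MonoidalLeftAction E M] where
  functor : N ⥤ M
  additive : functor.Additive
  linear : functor.Linear k
  c (X : E) (P : N) : functor.obj (X ⊙ₗ P) ≅ X ⊙ₗ functor.obj P
  natural_left {X X' : E} (f : X ⟶ X') (P : N) :
    functor.map (f ⊵ₗ P) ≫ (c X' P).hom = (c X P).hom ≫ f ⊵ₗ functor.obj P
  natural_right (X : E) {P P' : N} (f : P ⟶ P') :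
    functor.map (X ⊴ₗ f) ≫ (c X P').hom = (c X P).hom ≫ X ⊴ₗ functor.map f
  assoc (X Y : E) (P : N) :
    functor.map (αₗ X Y P).hom ≫ (c X (Y ⊙ₗ P)).hom ≫ X ⊴ₗ (c Y P).hom =
      (c (X ⊗ Y) P).hom ≫ (αₗ X Y (functor.obj P)).hom
  unit (P : N) :
    (c (𝟙_ E) P).hom ≫ (λₗ (functor.obj P)).hom = functor.map (λₗ P).hom

namespace ModuleFunctor

section

variable {k : Type w} [Field k] {E : Type u₁} [Category.{v₁} E] [MonoidalCategory E]
  {N : Type u₃} [Category.{v₃} N] [Preadditive N] [Linear k N] [MonoidalLeftAction E N]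
  {M : Type u₂} [Category.{v₂} M] [Preadditive M] [Linear k M] [MonoidalLeftAction E M]

attribute [instance] additive linear

/-- Natural module transformations. -/
@[ext]
structure Hom (F G : ModuleFunctor k E N M) where
  app (P : N) : F.functor.obj P ⟶ G.functor.obj P
  naturality {P P' : N} (f : P ⟶ P') : F.functor.map f ≫ app P' = app P ≫ G.functor.map f
  module (X : E) (P : N) : app (X ⊙ₗ P) ≫ (G.c X P).hom = (F.c X P).hom ≫ X ⊴ₗ app P

instance : Category (ModuleFunctor k E N M) where
  Hom := Hom
  id F := { app P := 𝟙 _, naturality := by simp, module := by simp }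
  comp a b :=
    { app P := a.app P ≫ b.app P
      naturality f := by simp [reassoc_of% a.naturality, b.naturality]
      module X P := by simp [reassoc_of% a.module, b.module] }
  id_comp a := by ext; simp
  comp_id a := by ext; simp
  assoc a b c := by ext; simp

@[ext]
lemma hom_ext {F G : ModuleFunctor k E N M} {a b : F ⟶ G} (h : ∀ P, a.app P = b.app P) : a = b :=
  Hom.ext (funext h)

@[simp]
lemma id_app (F : ModuleFunctor k E N M) (P : N) : Hom.app (𝟙 F) P = 𝟙 (F.functor.obj P) := rfl

@[simp]
lemma comp_app {F G H : ModuleFunctor k E N M} (a : F ⟶ G) (b : G ⟶ H) (P : N) :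
    Hom.app (a ≫ b) P = a.app P ≫ b.app P := rfl

/-- A module transformation is invertible if its components are. -/
@[simps]
def isoMk {F G : ModuleFunctor k E N M} (e : ∀ P, F.functor.obj P ≅ G.functor.obj P)
    (naturality : ∀ (P P' : N) (f : P ⟶ P'),
      F.functor.map f ≫ (e P').hom = (e P).hom ≫ G.functor.map f)
    (module : ∀ (X : E) (P : N),
      (e (X ⊙ₗ P)).hom ≫ (G.c X P).hom = (F.c X P).hom ≫ X ⊴ₗ (e P).hom) : F ≅ G where
  hom := { app P := (e P).hom, naturality := naturality _ _, module := module }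
  inv :=
    { app P := (e P).inv
      naturality f := by
        rw [Iso.eq_inv_comp, ← Category.assoc, ← naturality, Category.assoc, Iso.hom_inv_id,
          Category.comp_id]
      module X P := by
        rw [Iso.inv_comp_eq, ← Category.assoc, module, Category.assoc,
          MonoidalLeftAction.actionHomRight_hom_inv, Category.comp_id] }
  hom_inv_id := by ext; simp
  inv_hom_id := by ext; simp

lemma isIso_of_isIso_app {F G : ModuleFunctor k E N M} (a : F ⟶ G) (h : ∀ P, IsIso (a.app P)) :
    IsIso a :=
  (isoMk (fun P => asIso (a.app P)) (fun _ _ f => a.naturality f)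
    (fun X P => a.module X P)).isIso_hom

lemma c_inv_right (F : ModuleFunctor k E N M) (X : E) {P P' : N} (f : P ⟶ P') :
    X ⊴ₗ F.functor.map f ≫ (F.c X P').inv = (F.c X P).inv ≫ F.functor.map (X ⊴ₗ f) := by
  rw [Iso.eq_inv_comp, ← Category.assoc, Iso.comp_inv_eq, F.natural_right]

lemma c_inv_left (F : ModuleFunctor k E N M) {X X' : E} (f : X ⟶ X') (P : N) :
    f ⊵ₗ F.functor.obj P ≫ (F.c X' P).inv = (F.c X P).inv ≫ F.functor.map (f ⊵ₗ P) := by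
  rw [Iso.eq_inv_comp, ← Category.assoc, Iso.comp_inv_eq, F.natural_left]

lemma c_inv_assoc (F : ModuleFunctor k E N M) (X Y : E) (P : N) :
    (αₗ X Y (F.functor.obj P)).hom ≫ X ⊴ₗ (F.c Y P).inv ≫ (F.c X (Y ⊙ₗ P)).inv =
      (F.c (X ⊗ Y) P).inv ≫ F.functor.map (αₗ X Y P).hom := by
  rw [Iso.eq_inv_comp, ← Category.assoc, ← Category.assoc, Iso.comp_inv_eq, ← F.assoc]
  simp

lemma c_inv_unit (F : ModuleFunctor k E N M) (P : N) :
    (λₗ (F.functor.obj P)).hom = (F.c (𝟙_ E) P).inv ≫ F.functor.map (λₗ P).hom := by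
  rw [Iso.eq_inv_comp, F.unit]

variable [hM : IsExactAction k E M]

instance (F G : ModuleFunctor k E N M) : Zero (F ⟶ G) :=
  ⟨{ app P := 0
     naturality f := by simp
     module X P := by simp [IsExactAction.actionHomRight_zero k] }⟩

instance (F G : ModuleFunctor k E N M) : Add (F ⟶ G) :=
  ⟨fun a b =>
   { app P := a.app P + b.app P
     naturality f := by simp [a.naturality, b.naturality]
     module X P := by simp [a.module, b.module, IsExactAction.actionHomRight_add k] }⟩

instance (F G : ModuleFunctor k E N M) : Neg (F ⟶ G) :=
  ⟨fun a =>
   { app P := - a.app P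
     naturality f := by simp [a.naturality]
     module X P := by simp [a.module, IsExactAction.actionHomRight_neg k] }⟩

instance (F G : ModuleFunctor k E N M) : SMul k (F ⟶ G) :=
  ⟨fun r a =>
   { app P := r • a.app P
     naturality f := by simp [a.naturality]
     module X P := by simp [a.module, IsExactAction.actionHomRight_smul k] }⟩

@[simp] lemma zero_app (F G : ModuleFunctor k E N M) (P : N) : Hom.app (0 : F ⟶ G) P = 0 := rfl
@[simp] lemma add_app {F G : ModuleFunctor k E N M} (a b : F ⟶ G) (P : N) :
    Hom.app (a + b) P = a.app P + b.app P := rfl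
@[simp] lemma neg_app {F G : ModuleFunctor k E N M} (a : F ⟶ G) (P : N) :
    Hom.app (-a) P = - a.app P := rfl
@[simp] lemma smul_app {F G : ModuleFunctor k E N M} (r : k) (a : F ⟶ G) (P : N) :
    Hom.app (r • a) P = r • a.app P := rfl

instance (F G : ModuleFunctor k E N M) : AddCommGroup (F ⟶ G) where
  add_assoc a b c := by ext; simp [add_assoc]
  zero_add a := by ext; simp
  add_zero a := by ext; simp
  add_comm a b := by ext; simp [add_comm]
  neg_add_cancel a := by ext; simp
  nsmul := nsmulRec
  zsmul := zsmulRec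

instance (F G : ModuleFunctor k E N M) : Module k (F ⟶ G) where
  one_smul a := by ext; simp
  mul_smul r s a := by ext; simp [mul_smul]
  smul_zero r := by ext; simp
  smul_add r a b := by ext; simp
  add_smul r s a := by ext; simp [add_smul]
  zero_smul a := by ext; simp

instance : Preadditive (ModuleFunctor k E N M) where
  add_comp _ _ _ a b c := by ext; simp
  comp_add _ _ _ a b c := by ext; simp

instance : Linear k (ModuleFunctor k E N M) where
  smul_comp _ _ _ r a b := by ext; simp
  comp_smul _ _ _ a r b := by ext; simp

variable (k E M) in
/-- The evaluation `F ↦ F P`. -/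
@[simps]
def evaluation (P : N) : ModuleFunctor k E N M ⥤ M where
  obj F := F.functor.obj P
  map a := a.app P

instance (P : N) : (evaluation k E M P).Additive where
instance (P : N) : (evaluation k E M P).Linear k where

/-! ### Pointwise quotients, subobjects and sums of module functors -/

/-- Pointwise quotients `π P : F P ⟶ obj P` form a quotient of the module functor `F` if the
structure maps of `F` descend to them. -/
noncomputable def quotient (F : ModuleFunctor k E N M) (obj : N → M)
    (π : ∀ P, F.functor.obj P ⟶ obj P) (hπ : ∀ P, Epi (π P))
    (hmap : ∀ {P P' : N} (f : P ⟶ P'), ∃ t, π P ≫ t = F.functor.map f ≫ π P')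
    (hc : ∀ (X : E) (P : N), ∃ t, π (X ⊙ₗ P) ≫ t = (F.c X P).hom ≫ X ⊴ₗ π P)
    (hc' : ∀ (X : E) (P : N), ∃ t, X ⊴ₗ π P ≫ t = (F.c X P).inv ≫ π (X ⊙ₗ P)) :
    ModuleFunctor k E N M :=
  have hm {P P' : N} (f : P ⟶ P') := (hmap f).choose_spec
  have hi (X : E) (P : N) := (hc X P).choose_spec
  have hi' (X : E) (P : N) := (hc' X P).choose_spec
  have hX (X : E) (P : N) : Epi (X ⊴ₗ π P) := IsExactAction.epi_actionHomRight k X (π P)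
  { functor :=
      { obj := obj
        map f := (hmap f).choose
        map_id P := by rw [← cancel_epi (π P), hm]; simp
        map_comp f g := by
          rw [← cancel_epi (π _), hm, reassoc_of% (hm f), hm]; simp }
    additive :=
      { map_add := fun {P P' f g} => by
          change (hmap (f + g)).choose = (hmap f).choose + (hmap g).choose
          rw [← cancel_epi (π _), hm, Preadditive.comp_add, hm, hm, Functor.map_add,
            Preadditive.add_comp] }
    linear :=
      { map_smul := fun {P P'} f r => by
          change (hmap (r • f)).choose = r • (hmap f).choose
          rw [← cancel_epi (π _), hm, Linear.comp_smul, hm, Functor.map_smul, Linear.smul_comp] }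
    c X P :=
      { hom := (hc X P).choose
        inv := (hc' X P).choose
        hom_inv_id := by rw [← cancel_epi (π _), reassoc_of% (hi X P), hi' X P]; simp
        inv_hom_id := by rw [← cancel_epi (X ⊴ₗ π P), reassoc_of% (hi' X P), hi X P]; simp }
    natural_left {X X'} f P := by
      dsimp only
      rw [← cancel_epi (π _), reassoc_of% (hm (f ⊵ₗ P)), hi, reassoc_of% (hi X P),
        reassoc_of% (F.natural_left f P), MonoidalLeftAction.action_exchange]
    natural_right X {P P'} f := by
      dsimp only
      rw [← cancel_epi (π _), reassoc_of% (hm (X ⊴ₗ f)), hi, reassoc_of% (hi X P),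
        reassoc_of% (F.natural_right X f), ← MonoidalLeftAction.actionHomRight_comp,
        ← MonoidalLeftAction.actionHomRight_comp, hm]
    assoc X Y P := by
      dsimp only
      rw [← cancel_epi (π _), reassoc_of% (hm (αₗ X Y P).hom), reassoc_of% (hi X (Y ⊙ₗ P)),
        reassoc_of% (hi (X ⊗ Y) P), ← MonoidalLeftAction.actionHomRight_comp, hi Y P,
        MonoidalLeftAction.actionHomRight_comp, reassoc_of% (F.assoc X Y P)]
      simp
    unit P := by
      dsimp only
      rw [← cancel_epi (π _), hm, reassoc_of% (hi (𝟙_ E) P),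
        ← MonoidalLeftAction.actionUnitIso_hom_naturality, reassoc_of% (F.unit P)] }

/-- The projection onto a pointwise quotient. -/
@[simps]
noncomputable def quotientπ (F : ModuleFunctor k E N M) (obj : N → M)
    (π : ∀ P, F.functor.obj P ⟶ obj P) (hπ : ∀ P, Epi (π P))
    (hmap : ∀ {P P' : N} (f : P ⟶ P'), ∃ t, π P ≫ t = F.functor.map f ≫ π P')
    (hc : ∀ (X : E) (P : N), ∃ t, π (X ⊙ₗ P) ≫ t = (F.c X P).hom ≫ X ⊴ₗ π P)
    (hc' : ∀ (X : E) (P : N), ∃ t, X ⊴ₗ π P ≫ t = (F.c X P).inv ≫ π (X ⊙ₗ P)) :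
    F ⟶ F.quotient obj π hπ hmap hc hc' where
  app := π
  naturality f := (hmap f).choose_spec.symm
  module X P := (hc X P).choose_spec

/-- Pointwise subobjects `ι P : obj P ⟶ F P` form a subobject of the module functor `F` if the
structure maps of `F` restrict to them. -/
noncomputable def sub (F : ModuleFunctor k E N M) (obj : N → M)
    (ι : ∀ P, obj P ⟶ F.functor.obj P) (hι : ∀ P, Mono (ι P))
    (hmap : ∀ {P P' : N} (f : P ⟶ P'), ∃ t, t ≫ ι P' = ι P ≫ F.functor.map f)
    (hc : ∀ (X : E) (P : N), ∃ t, t ≫ X ⊴ₗ ι P = ι (X ⊙ₗ P) ≫ (F.c X P).hom)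
    (hc' : ∀ (X : E) (P : N), ∃ t, t ≫ ι (X ⊙ₗ P) = X ⊴ₗ ι P ≫ (F.c X P).inv) :
    ModuleFunctor k E N M :=
  have hm {P P' : N} (f : P ⟶ P') := (hmap f).choose_spec
  have hi (X : E) (P : N) := (hc X P).choose_spec
  have hi' (X : E) (P : N) := (hc' X P).choose_spec
  have hX (X : E) (P : N) : Mono (X ⊴ₗ ι P) := IsExactAction.mono_actionHomRight k X (ι P)
  have hXY (X Y : E) (P : N) : Mono (X ⊴ₗ Y ⊴ₗ ι P) :=
    IsExactAction.mono_actionHomRight k X _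
  { functor :=
      { obj := obj
        map f := (hmap f).choose
        map_id P := by rw [← cancel_mono (ι P), hm]; simp
        map_comp f g := by
          rw [← cancel_mono (ι _), hm, Category.assoc, hm g, ← Category.assoc, hm f]; simp }
    additive :=
      { map_add := fun {P P' f g} => by
          change (hmap (f + g)).choose = (hmap f).choose + (hmap g).choose
          rw [← cancel_mono (ι _), hm, Preadditive.add_comp, hm, hm, Functor.map_add,
            Preadditive.comp_add] }
    linear :=
      { map_smul := fun {P P'} f r => by
          change (hmap (r • f)).choose = r • (hmap f).choose
          rw [← cancel_mono (ι _), hm, Linear.smul_comp, hm, Functor.map_smul, Linear.comp_smul] }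
    c X P :=
      { hom := (hc X P).choose
        inv := (hc' X P).choose
        hom_inv_id := by
          rw [← cancel_mono (ι _), Category.assoc, hi' X P, reassoc_of% (hi X P)]; simp
        inv_hom_id := by
          rw [← cancel_mono (X ⊴ₗ ι P), Category.assoc, hi X P, reassoc_of% (hi' X P)]; simp }
    natural_left {X X'} f P := by
      dsimp only
      rw [← cancel_mono (X' ⊴ₗ ι P), Category.assoc, Category.assoc, hi,
        reassoc_of% (hm (f ⊵ₗ P)), ← MonoidalLeftAction.action_exchange, reassoc_of% (hi X P),
        F.natural_left f P]
    natural_right X {P P'} f := by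
      dsimp only
      rw [← cancel_mono (X ⊴ₗ ι P'), Category.assoc, Category.assoc, hi,
        reassoc_of% (hm (X ⊴ₗ f)), ← MonoidalLeftAction.actionHomRight_comp, hm,
        MonoidalLeftAction.actionHomRight_comp, reassoc_of% (hi X P), F.natural_right X f]
    assoc X Y P := by
      dsimp only
      rw [← cancel_mono (X ⊴ₗ Y ⊴ₗ ι P)]
      simp only [Category.assoc]
      rw [← MonoidalLeftAction.actionHomRight_comp, hi Y P,
        MonoidalLeftAction.actionHomRight_comp, reassoc_of% (hi X (Y ⊙ₗ P)),
        reassoc_of% (hm (αₗ X Y P).hom), F.assoc X Y P, ← reassoc_of% (hi (X ⊗ Y) P)]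
      simp
    unit P := by
      dsimp only
      rw [← cancel_mono (ι _), hm, Category.assoc,
        MonoidalLeftAction.actionUnitIso_hom_naturality, reassoc_of% (hi (𝟙_ E) P), F.unit P] }

/-- The inclusion of a pointwise subobject. -/
@[simps]
noncomputable def subι (F : ModuleFunctor k E N M) (obj : N → M)
    (ι : ∀ P, obj P ⟶ F.functor.obj P) (hι : ∀ P, Mono (ι P))
    (hmap : ∀ {P P' : N} (f : P ⟶ P'), ∃ t, t ≫ ι P' = ι P ≫ F.functor.map f)
    (hc : ∀ (X : E) (P : N), ∃ t, t ≫ X ⊴ₗ ι P = ι (X ⊙ₗ P) ≫ (F.c X P).hom)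
    (hc' : ∀ (X : E) (P : N), ∃ t, t ≫ ι (X ⊙ₗ P) = X ⊴ₗ ι P ≫ (F.c X P).inv) :
    F.sub obj ι hι hmap hc hc' ⟶ F where
  app := ι
  naturality f := (hmap f).choose_spec
  module X P := (hc X P).choose_spec.symm

end

end ModuleFunctor

namespace ModuleFunctor

section

variable {k : Type w} [Field k] {E : Type u₁} [Category.{v₁} E] [MonoidalCategory E]
  {N : Type u₃} [Category.{v₃} N] [Preadditive N] [Linear k N] [MonoidalLeftAction E N]
  {M : Type u₂} [Category.{v₂} M] [Abelian M] [Linear k M] [MonoidalLeftAction E M]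
  [hM : IsExactAction k E M]

omit hM in
lemma mono_of_mono_app {K F : ModuleFunctor k E N M} (ι : K ⟶ F) (hι : ∀ P, Mono (ι.app P)) :
    Mono ι where
  right_cancellation a b h := by
    ext P
    rw [← cancel_mono (ι.app P)]
    exact congrArg (fun t => Hom.app t P) h

omit hM in
lemma epi_of_epi_app {F Q : ModuleFunctor k E N M} (π : F ⟶ Q) (hπ : ∀ P, Epi (π.app P)) :
    Epi π where
  left_cancellation a b h := by
    ext P
    rw [← cancel_epi (π.app P)]
    exact congrArg (fun t => Hom.app t P) h

/-- A pointwise factorization through a pointwise monomorphism is a module transformation. -/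
def liftOfMono {W K F : ModuleFunctor k E N M} (ι : K ⟶ F) (hι : ∀ P, Mono (ι.app P))
    (g : W ⟶ F) (t : ∀ P, W.functor.obj P ⟶ K.functor.obj P)
    (ht : ∀ P, t P ≫ ι.app P = g.app P) : W ⟶ K :=
  { app := t
    naturality := fun {P P'} a => by
      rw [← cancel_mono (ι.app P'), Category.assoc, Category.assoc, ht, ι.naturality,
        reassoc_of% (ht P), g.naturality]
    module := fun X P => by
      have := IsExactAction.mono_actionHomRight k X (ι.app P)
      rw [← cancel_mono (X ⊴ₗ ι.app P), Category.assoc, Category.assoc, ← ι.module,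
        reassoc_of% (ht (X ⊙ₗ P)), ← MonoidalLeftAction.actionHomRight_comp, ht, g.module] }

/-- A pointwise factorization through a pointwise epimorphism is a module transformation. -/
def descOfEpi {W Q F : ModuleFunctor k E N M} (π : F ⟶ Q) (hπ : ∀ P, Epi (π.app P))
    (g : F ⟶ W) (t : ∀ P, Q.functor.obj P ⟶ W.functor.obj P)
    (ht : ∀ P, π.app P ≫ t P = g.app P) : Q ⟶ W :=
  { app := t
    naturality := fun {P P'} a => by
      rw [← cancel_epi (π.app P), reassoc_of% (ht P), ← reassoc_of% (π.naturality a), ht,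
        g.naturality]
    module := fun X P => by
      rw [← cancel_epi (π.app (X ⊙ₗ P)), reassoc_of% (ht (X ⊙ₗ P)),
        reassoc_of% (π.module X P), ← MonoidalLeftAction.actionHomRight_comp, ht, g.module] }

/-- The pointwise kernel of a module transformation. -/
noncomputable def kernelFork {F G : ModuleFunctor k E N M} (f : F ⟶ G) : KernelFork f :=
  KernelFork.ofι
    (F.subι (fun P => kernel (f.app P)) (fun P => kernel.ι (f.app P)) (fun _ => inferInstance)
      (fun g => ⟨kernel.lift _ (kernel.ι (f.app _) ≫ F.functor.map g) (by
        rw [Category.assoc, f.naturality, kernel.condition_assoc, zero_comp]),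
        kernel.lift_ι _ _ _⟩)
      (fun X P => IsExactAction.exists_lift_kernel k X (f.app P) _ (by
        rw [Category.assoc, ← f.module, kernel.condition_assoc, zero_comp]))
      (fun X P => ⟨kernel.lift _ (X ⊴ₗ kernel.ι (f.app P) ≫ (F.c X P).inv) (by
        rw [← cancel_mono (G.c X P).hom, Category.assoc, Category.assoc, f.module,
          Iso.inv_hom_id_assoc, ← MonoidalLeftAction.actionHomRight_comp, kernel.condition,
          IsExactAction.actionHomRight_zero k, zero_comp]), kernel.lift_ι _ _ _⟩))
    (by ext P; exact kernel.condition (f.app P))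

/-- The pointwise kernel is a kernel. -/
noncomputable def isLimitKernelFork {F G : ModuleFunctor k E N M} (f : F ⟶ G) :
    IsLimit (kernelFork f) :=
  have hm (P : N) : Mono ((kernelFork f).ι.app P) := inferInstanceAs (Mono (kernel.ι (f.app P)))
  have : Mono (kernelFork f).ι := mono_of_mono_app _ hm
  have ht {W : ModuleFunctor k E N M} (g : W ⟶ F) (hg : g ≫ f = 0) (P : N) :
      kernel.lift (f.app P) (g.app P) (congrArg (fun t => Hom.app t P) hg) ≫
        kernel.ι (f.app P) = g.app P := kernel.lift_ι _ _ _
  KernelFork.IsLimit.ofι' (kernelFork f).ι (KernelFork.condition _) fun {_} g hg =>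
    ⟨liftOfMono _ hm g (fun P => kernel.lift (f.app P) (g.app P) _) (ht g hg),
      by ext P; exact ht g hg P⟩

/-- The pointwise cokernel of a module transformation. -/
noncomputable def cokernelCofork {F G : ModuleFunctor k E N M} (f : F ⟶ G) : CokernelCofork f :=
  CokernelCofork.ofπ
    (G.quotientπ (fun P => cokernel (f.app P)) (fun P => cokernel.π (f.app P))
      (fun _ => inferInstance)
      (fun g => ⟨cokernel.desc _ (G.functor.map g ≫ cokernel.π (f.app _)) (by
        rw [← reassoc_of% (f.naturality g), cokernel.condition, comp_zero]),
        cokernel.π_desc _ _ _⟩)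
      (fun X P => ⟨cokernel.desc _ ((G.c X P).hom ≫ X ⊴ₗ cokernel.π (f.app P)) (by
        rw [reassoc_of% (f.module X P), ← MonoidalLeftAction.actionHomRight_comp,
          cokernel.condition, IsExactAction.actionHomRight_zero k, comp_zero]),
        cokernel.π_desc _ _ _⟩)
      (fun X P => IsExactAction.exists_desc_cokernel k X (f.app P) _ (by
        rw [← cancel_epi (F.c X P).hom, ← reassoc_of% (f.module X P), Iso.hom_inv_id_assoc,
          cokernel.condition, comp_zero])))
    (by ext P; exact cokernel.condition (f.app P))

/-- The pointwise cokernel is a cokernel. -/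
noncomputable def isColimitCokernelCofork {F G : ModuleFunctor k E N M} (f : F ⟶ G) :
    IsColimit (cokernelCofork f) :=
  have hm (P : N) : Epi ((cokernelCofork f).π.app P) :=
    inferInstanceAs (Epi (cokernel.π (f.app P)))
  have : Epi (cokernelCofork f).π := epi_of_epi_app _ hm
  have ht {W : ModuleFunctor k E N M} (g : G ⟶ W) (hg : f ≫ g = 0) (P : N) :
      cokernel.π (f.app P) ≫
        cokernel.desc (f.app P) (g.app P) (congrArg (fun t => Hom.app t P) hg) = g.app P :=
    cokernel.π_desc _ _ _
  CokernelCofork.IsColimit.ofπ' (cokernelCofork f).π (CokernelCofork.condition _) fun {_} g hg =>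
    ⟨descOfEpi _ hm g (fun P => cokernel.desc (f.app P) (g.app P) _) (ht g hg),
      by ext P; exact ht g hg P⟩

instance : HasKernels (ModuleFunctor k E N M) :=
  ⟨fun f => ⟨⟨⟨kernelFork f, isLimitKernelFork f⟩⟩⟩⟩

instance : HasCokernels (ModuleFunctor k E N M) :=
  ⟨fun f => ⟨⟨⟨cokernelCofork f, isColimitCokernelCofork f⟩⟩⟩⟩

instance (P : N) {F G : ModuleFunctor k E N M} (f : F ⟶ G) :
    PreservesLimit (parallelPair f 0) (evaluation k E M P) :=
  preservesLimit_of_preserves_limit_cone (isLimitKernelFork f)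
    ((KernelFork.isLimitMapConeEquiv _ (evaluation k E M P)).symm
      (IsLimit.ofIsoLimit (kernelIsKernel (f.app P)) (Fork.ext (Iso.refl _)
        ((Category.id_comp _).trans rfl))))

instance (P : N) {F G : ModuleFunctor k E N M} (f : F ⟶ G) :
    PreservesColimit (parallelPair f 0) (evaluation k E M P) :=
  preservesColimit_of_preserves_colimit_cocone (isColimitCokernelCofork f)
    ((CokernelCofork.isColimitMapCoconeEquiv _ (evaluation k E M P)).symm
      (IsColimit.ofIsoColimit (cokernelIsCokernel (f.app P)) (Cofork.ext (Iso.refl _)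
        ((Category.comp_id _).trans rfl))))

/-- The pointwise direct sum of two module functors. -/
@[simps! functor_obj functor_map]
noncomputable def sum (F G : ModuleFunctor k E N M) : ModuleFunctor k E N M where
  functor :=
    { obj P := F.functor.obj P ⊞ G.functor.obj P
      map f := biprod.map (F.functor.map f) (G.functor.map f) }
  additive := { map_add := by intros; ext <;> simp }
  linear := { map_smul := by intros; ext <;> simp }
  c X P :=
    { hom := biprod.desc ((F.c X P).hom ≫ X ⊴ₗ biprod.inl) ((G.c X P).hom ≫ X ⊴ₗ biprod.inr)
      inv := X ⊴ₗ biprod.fst ≫ (F.c X P).inv ≫ biprod.inl +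
        X ⊴ₗ biprod.snd ≫ (G.c X P).inv ≫ biprod.inr
      hom_inv_id := by
        ext <;> simp [← MonoidalLeftAction.actionHomRight_comp_assoc,
          IsExactAction.actionHomRight_zero k]
      inv_hom_id := by
        simp [← MonoidalLeftAction.actionHomRight_comp, ← IsExactAction.actionHomRight_add k] }
  natural_left f P := by
    ext
    · simp [reassoc_of% (F.natural_left f P), MonoidalLeftAction.action_exchange,
        -MonoidalLeftAction.actionHomLeft_action]
    · simp [reassoc_of% (G.natural_left f P), MonoidalLeftAction.action_exchange]
  natural_right X P P' f := by
    ext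
    · simp [reassoc_of% (F.natural_right X f), ← MonoidalLeftAction.actionHomRight_comp]
    · simp [reassoc_of% (G.natural_right X f), ← MonoidalLeftAction.actionHomRight_comp]
  assoc X Y P := by
    ext
    · simp [← reassoc_of% (F.assoc X Y P), ← MonoidalLeftAction.actionHomRight_comp]
    · simp [← reassoc_of% (G.assoc X Y P), ← MonoidalLeftAction.actionHomRight_comp]
  unit P := by
    change biprod.desc ((F.c (𝟙_ E) P).hom ≫ _) ((G.c (𝟙_ E) P).hom ≫ _) ≫ _ =
      biprod.map (F.functor.map _) (G.functor.map _)
    rw [← F.unit, ← G.unit]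
    refine biprod.hom_ext' _ _ ?_ ?_
    · rw [biprod.inl_desc_assoc, biprod.inl_map, Category.assoc, Category.assoc,
        MonoidalLeftAction.actionUnitIso_hom_naturality]
    · rw [biprod.inr_desc_assoc, biprod.inr_map, Category.assoc, Category.assoc,
        MonoidalLeftAction.actionUnitIso_hom_naturality]

instance : HasBinaryBiproducts (ModuleFunctor k E N M) :=
  ⟨fun F G => hasBinaryBiproduct_of_total
    { pt := sum F G
      fst :=
        { app P := biprod.fst
          naturality f := biprod.map_fst _ _
          module X P := by
            change biprod.fst ≫ (F.c X P).hom = biprod.desc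
              ((F.c X P).hom ≫ X ⊴ₗ (biprod.inl : _ ⟶ F.functor.obj P ⊞ G.functor.obj P))
              ((G.c X P).hom ≫ X ⊴ₗ (biprod.inr : _ ⟶ F.functor.obj P ⊞ G.functor.obj P)) ≫
              X ⊴ₗ (biprod.fst : F.functor.obj P ⊞ G.functor.obj P ⟶ _)
            refine biprod.hom_ext' _ _ ?_ ?_
            · rw [biprod.inl_fst_assoc, biprod.inl_desc_assoc, Category.assoc,
                ← MonoidalLeftAction.actionHomRight_comp, biprod.inl_fst]
              simp
            · rw [biprod.inr_fst_assoc, biprod.inr_desc_assoc, Category.assoc,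
                ← MonoidalLeftAction.actionHomRight_comp, biprod.inr_fst,
                IsExactAction.actionHomRight_zero k, zero_comp, comp_zero] }
      snd :=
        { app P := biprod.snd
          naturality f := biprod.map_snd _ _
          module X P := by
            change biprod.snd ≫ (G.c X P).hom = biprod.desc
              ((F.c X P).hom ≫ X ⊴ₗ (biprod.inl : _ ⟶ F.functor.obj P ⊞ G.functor.obj P))
              ((G.c X P).hom ≫ X ⊴ₗ (biprod.inr : _ ⟶ F.functor.obj P ⊞ G.functor.obj P)) ≫
              X ⊴ₗ (biprod.snd : F.functor.obj P ⊞ G.functor.obj P ⟶ _)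
            refine biprod.hom_ext' _ _ ?_ ?_
            · rw [biprod.inl_snd_assoc, biprod.inl_desc_assoc, Category.assoc,
                ← MonoidalLeftAction.actionHomRight_comp, biprod.inl_snd,
                IsExactAction.actionHomRight_zero k, zero_comp, comp_zero]
            · rw [biprod.inr_snd_assoc, biprod.inr_desc_assoc, Category.assoc,
                ← MonoidalLeftAction.actionHomRight_comp, biprod.inr_snd]
              simp }
      inl :=
        { app P := biprod.inl
          naturality f := (biprod.inl_map _ _).symm
          module X P := biprod.inl_desc _ _ }
      inr :=
        { app P := biprod.inr
          naturality f := (biprod.inr_map _ _).symm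
          module X P := biprod.inr_desc _ _ }
      inl_fst := by ext P; exact biprod.inl_fst
      inl_snd := by ext P; exact biprod.inl_snd
      inr_fst := by ext P; exact biprod.inr_fst
      inr_snd := by ext P; exact biprod.inr_snd }
    (by ext P : 1; exact biprod.total)⟩

open scoped ZeroObject in
instance : HasZeroObject (ModuleFunctor k E N M) := by
  have hz (X : E) : IsZero (X ⊙ₗ (0 : M)) := by
    rw [IsZero.iff_id_eq_zero, ← MonoidalLeftAction.actionHomRight_id,
      (isZero_zero M).eq_of_src (𝟙 (0 : M)) 0, IsExactAction.actionHomRight_zero k]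
  let Z : ModuleFunctor k E N M :=
    { functor := (Functor.const N).obj 0
      additive := { map_add := (isZero_zero M).eq_of_src _ _ }
      linear := { map_smul := fun _ _ => (isZero_zero M).eq_of_src _ _ }
      c X P := (isZero_zero M).iso (hz X)
      natural_left f P := (isZero_zero M).eq_of_src _ _
      natural_right X {P P'} f := (isZero_zero M).eq_of_src _ _
      assoc X Y P := (isZero_zero M).eq_of_src _ _
      unit P := (isZero_zero M).eq_of_src _ _ }
  refine ⟨Z, (IsZero.iff_id_eq_zero Z).2 ?_⟩
  ext P
  exact (isZero_zero M).eq_of_src _ _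

instance : HasFiniteProducts (ModuleFunctor k E N M) :=
  hasFiniteProducts_of_has_binary_and_terminal

noncomputable instance : Abelian (ModuleFunctor k E N M) :=
  have (F G : ModuleFunctor k E N M) (f : F ⟶ G) : IsIso (Abelian.coimageImageComparison f) :=
    isIso_of_isIso_app _ fun P => (Arrow.isIso_iff_isIso_of_isIso
      (Abelian.PreservesCoimageImageComparison.iso (evaluation k E M P) f).hom).2
        (inferInstanceAs (IsIso (Abelian.coimageImageComparison ((evaluation k E M P).map f))))
  Abelian.ofCoimageImageComparisonIsIso

instance (P : N) : PreservesFiniteLimits (evaluation k E M P) :=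
  Functor.preservesFiniteLimits_of_preservesKernels _

instance (P : N) : PreservesFiniteColimits (evaluation k E M P) :=
  Functor.preservesFiniteColimits_of_preservesCokernels _

end

end ModuleFunctor

/-! ### Duals and adjunctions between action functors -/

namespace CategoryTheory.MonoidalCategory.MonoidalLeftAction

variable {E : Type u₁} [Category.{v₁} E] [MonoidalCategory E]
  {N : Type u₃} [Category.{v₃} N] [MonoidalLeftAction E N]

/-- The morphism `P ⟶ X ▷ (Y ▷ P)` given by the coevaluation of a dual pair. -/
abbrev actionCoev (X Y : E) [ExactPairing X Y] (P : N) : P ⟶ X ⊙ₗ (Y ⊙ₗ P) :=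
  (λₗ P).inv ≫ η_ X Y ⊵ₗ P ≫ (αₗ X Y P).hom

/-- The morphism `Y ▷ (X ▷ P) ⟶ P` given by the evaluation of a dual pair. -/
abbrev actionEv (X Y : E) [ExactPairing X Y] (P : N) : Y ⊙ₗ (X ⊙ₗ P) ⟶ P :=
  (αₗ Y X P).inv ≫ ε_ X Y ⊵ₗ P ≫ (λₗ P).hom

variable (X Y : E) [ExactPairing X Y]

lemma actionCoev_naturality {P P' : N} (f : P ⟶ P') :
    f ≫ actionCoev X Y P' = actionCoev X Y P ≫ X ⊴ₗ (Y ⊴ₗ f) := by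
  rw [← actionUnitIso_inv_naturality_assoc, action_exchange_assoc]
  simp

lemma actionEv_naturality {P P' : N} (f : P ⟶ P') :
    Y ⊴ₗ (X ⊴ₗ f) ≫ actionEv X Y P' = actionEv X Y P ≫ f := by
  simp only [Category.assoc, actionUnitIso_hom_naturality]
  rw [← action_exchange_assoc]
  simp

lemma actionEv_left_triangle (P : N) :
    Y ⊴ₗ actionCoev X Y P ≫ actionEv X Y (Y ⊙ₗ P) = 𝟙 _ := by
  have h := congrArg (fun t => t ⊵ₗ P) (ExactPairing.coevaluation_evaluation X Y)
  have ha : (α_ Y X Y).inv ⊵ₗ P = (αₗ Y (X ⊗ Y) P).hom ≫ Y ⊴ₗ (αₗ X Y P).hom ≫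
      (αₗ Y X (Y ⊙ₗ P)).inv ≫ (αₗ (Y ⊗ X) Y P).inv := by
    rw [← cancel_epi ((α_ Y X Y).hom ⊵ₗ P)]
    simp
  have hl : (λ_ Y).inv ⊵ₗ P = (λₗ (Y ⊙ₗ P)).inv ≫ (αₗ (𝟙_ E) Y P).inv := by
    rw [← cancel_epi ((λ_ Y).hom ⊵ₗ P), hom_inv_actionHomLeft, leftUnitor_actionHom]
    simp
  simp only [comp_actionHomLeft, whiskerLeft_actionHomLeft, ha, whiskerRight_actionHomLeft,
    rightUnitor_actionHom, hl, Category.assoc, Iso.inv_hom_id_assoc, Iso.cancel_iso_hom_left] at h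
  simp only [← Category.assoc, Iso.cancel_iso_inv_right] at h
  simp only [Category.assoc] at h
  simp only [actionHomRight_comp, Category.assoc]
  rw [reassoc_of% h]
  simp

lemma actionEv_right_triangle (P : N) :
    actionCoev X Y (X ⊙ₗ P) ≫ X ⊴ₗ actionEv X Y P = 𝟙 _ := by
  have h := congrArg (fun t => t ⊵ₗ P) (ExactPairing.evaluation_coevaluation X Y)
  have hl : (ρ_ X).inv ⊵ₗ P = X ⊴ₗ (λₗ P).inv ≫ (αₗ X (𝟙_ E) P).inv := by
    rw [← cancel_epi ((ρ_ X).hom ⊵ₗ P), hom_inv_actionHomLeft, rightUnitor_actionHom]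
    simp
  have ha : (α_ X Y X).hom ⊵ₗ P = (αₗ (X ⊗ Y) X P).hom ≫ (αₗ X Y (X ⊙ₗ P)).hom ≫
      X ⊴ₗ (αₗ Y X P).inv ≫ (αₗ X (Y ⊗ X) P).inv := by
    rw [← associator_actionHom_assoc]
    simp
  simp only [comp_actionHomLeft, whiskerLeft_actionHomLeft, ha, whiskerRight_actionHomLeft,
    leftUnitor_actionHom, hl, Category.assoc, Iso.inv_hom_id_assoc, Iso.cancel_iso_hom_left] at h
  simp only [← Category.assoc, Iso.cancel_iso_inv_right] at h
  simp only [Category.assoc] at h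
  simp only [actionHomRight_comp, Category.assoc]
  rw [reassoc_of% h]
  simp

variable (N) in
/-- If `Y` is a dual of `X`, then `Y ▷ -` is left adjoint to `X ▷ -`. -/
def actionAdjunction :
    (curriedAction E N).obj Y ⊣ (curriedAction E N).obj X :=
  Adjunction.mkOfUnitCounit
    { unit := { app := actionCoev X Y, naturality _ _ f := actionCoev_naturality X Y f }
      counit := { app := actionEv X Y, naturality _ _ f := actionEv_naturality X Y f }
      left_triangle := by
        ext P
        exact (congrArg _ (Category.id_comp _)).trans (actionEv_left_triangle X Y P)
      right_triangle := by
        ext P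
        exact (congrArg _ (Category.id_comp _)).trans (actionEv_right_triangle X Y P) }

end CategoryTheory.MonoidalCategory.MonoidalLeftAction

open MonoidalLeftAction

/-- A morphism to `X ▷ B` is zero if its transpose `Y ▷ A ⟶ B` is zero. -/
lemma IsExactAction.eq_zero_of_actionEv (k : Type w) [Field k] {E : Type u₁} [Category.{v₁} E]
    [MonoidalCategory E] {M : Type u₂} [Category.{v₂} M] [Preadditive M] [Linear k M]
    [MonoidalLeftAction E M] [IsExactAction k E M] (X Y : E) [ExactPairing X Y] {A B : M}
    (t : A ⟶ X ⊙ₗ B) (h : Y ⊴ₗ t ≫ actionEv X Y B = 0) : t = 0 := by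
  rw [← Category.comp_id t, ← actionEv_right_triangle X Y B,
    ← Category.assoc, actionCoev_naturality, Category.assoc, ← actionHomRight_comp, h,
    IsExactAction.actionHomRight_zero k, comp_zero]

namespace ModuleFunctor

variable {k : Type w} [Field k] {E : Type u₁} [Category.{v₁} E] [MonoidalCategory E]
  {N : Type u₃} [Category.{v₃} N] [Preadditive N] [Linear k N] [MonoidalLeftAction E N]
  {M : Type u₂} [Category.{v₂} M] [Abelian M] [Linear k M] [MonoidalLeftAction E M]

lemma c_comp_actionEv (F : ModuleFunctor k E N M) (X Y : E) [ExactPairing X Y] (P : N) :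
    Y ⊴ₗ (F.c X P).hom ≫ actionEv X Y (F.functor.obj P) =
      (F.c Y (X ⊙ₗ P)).inv ≫ F.functor.map (actionEv X Y P) := by
  rw [Iso.eq_inv_comp, ← cancel_epi (F.functor.map (αₗ Y X P).hom),
    reassoc_of% (F.assoc Y X P), Iso.hom_inv_id_assoc, ← reassoc_of% (F.natural_left (ε_ X Y) P),
    F.unit, ← F.functor.map_comp, ← F.functor.map_comp, Iso.hom_inv_id_assoc]

/-- The morphism `X ▷ G₀ ⟶ F (X ▷ G)` induced by an element `v : G₀ ⟶ F G`. -/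
def act (F : ModuleFunctor k E N M) {G₀ : M} {G : N} (v : G₀ ⟶ F.functor.obj G) (X : E) :
    X ⊙ₗ G₀ ⟶ F.functor.obj (X ⊙ₗ G) :=
  X ⊴ₗ v ≫ (F.c X G).inv

lemma act_naturality (F : ModuleFunctor k E N M) {G₀ : M} {G : N} (v : G₀ ⟶ F.functor.obj G)
    {X Y : E} (f : X ⟶ Y) :
    f ⊵ₗ G₀ ≫ F.act v Y = F.act v X ≫ F.functor.map (f ⊵ₗ G) := by
  rw [act, act, ← action_exchange_assoc, c_inv_left, Category.assoc]

lemma act_tensor (F : ModuleFunctor k E N M) {G₀ : M} {G : N} (v : G₀ ⟶ F.functor.obj G)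
    (X Y : E) :
    X ⊴ₗ F.act v Y ≫ (F.c X (Y ⊙ₗ G)).inv =
      (αₗ X Y G₀).inv ≫ F.act v (X ⊗ Y) ≫ F.functor.map (αₗ X Y G).hom := by
  rw [Iso.eq_inv_comp]
  simp only [act, Category.assoc, actionHomRight_comp]
  rw [← F.c_inv_assoc X Y G]
  simp

variable [hM : IsExactAction k E M]

attribute [local instance] Abelian.hasFiniteBiproducts

/-- The pointwise quotient of `F` by the images of all `X ▷ G₀ ⟶ F (X ▷ G) ⟶ F P`, which form the
module subfunctor generated by `v : G₀ ⟶ F G`. It suffices to take `X = Q`, if the morphisms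
`Q ⟶ X` induce a jointly epimorphic family `Q ▷ G₀ ⟶ X ▷ G₀`. The duals in `E` are used to
show that the module structure of `F` descends. -/
lemma exists_quotient_of_element (F : ModuleFunctor k E N M) {G₀ : M} {G : N}
    (v : G₀ ⟶ F.functor.obj G) (hE : ∀ X : E, ∃ Y, Nonempty (ExactPairing X Y)) (Q : E)
    (hQ : ∀ (X : E) {Z : M} (g : X ⊙ₗ G₀ ⟶ Z), (∀ f : Q ⟶ X, f ⊵ₗ G₀ ≫ g = 0) → g = 0)
    (hfin : ∀ P : N, Module.Finite k (Q ⊙ₗ G ⟶ P)) :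
    ∃ (F' : ModuleFunctor k E N M) (π : F ⟶ F'), v ≫ π.app G = 0 ∧
      (π.app G = 0 → ∃ p : (⨁ fun _ : Fin (Module.finrank k (Q ⊙ₗ G ⟶ G)) => Q ⊙ₗ G₀) ⟶
        F.functor.obj G, Epi p) := by
  let s (P : N) : (⨁ fun _ : Fin (Module.finrank k (Q ⊙ₗ G ⟶ P)) => Q ⊙ₗ G₀) ⟶ F.functor.obj P :=
    biproduct.desc fun i => F.act v Q ≫ F.functor.map (Module.finBasis k (Q ⊙ₗ G ⟶ P) i)
  -- `cokernel.π (s P)` kills the images of all `X ▷ G₀`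
  have hkillQ {P : N} (h : Q ⊙ₗ G ⟶ P) :
      F.act v Q ≫ F.functor.map h ≫ cokernel.π (s P) = 0 := by
    rw [← (Module.finBasis k (Q ⊙ₗ G ⟶ P)).sum_repr h, F.functor.map_sum, Preadditive.sum_comp,
      Preadditive.comp_sum]
    refine Finset.sum_eq_zero fun i _ => ?_
    have := biproduct.ι _ i ≫= cokernel.condition (s P)
    rw [biproduct.ι_desc_assoc, comp_zero, Category.assoc] at this
    rw [F.functor.map_smul, Linear.smul_comp, Linear.comp_smul, this, smul_zero]
  have hkill {X : E} {P : N} (h : X ⊙ₗ G ⟶ P) :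
      F.act v X ≫ F.functor.map h ≫ cokernel.π (s P) = 0 :=
    hQ X _ fun f => by
      rw [reassoc_of% (F.act_naturality v f), ← F.functor.map_comp_assoc, hkillQ]
  have hdesc {P : N} {Z : M} (g : F.functor.obj P ⟶ Z)
      (hg : ∀ h : Q ⊙ₗ G ⟶ P, F.act v Q ≫ F.functor.map h ≫ g = 0) :
      ∃ t, cokernel.π (s P) ≫ t = g :=
    ⟨cokernel.desc _ g (by
      refine biproduct.hom_ext' _ _ fun i => ?_
      rw [biproduct.ι_desc_assoc, comp_zero, Category.assoc, hg]), cokernel.π_desc _ _ _⟩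
  let F' := F.quotient (fun P => cokernel (s P)) (fun P => cokernel.π (s P))
    (fun _ => inferInstance)
    (fun {P P'} a => hdesc _ fun h => by rw [← F.functor.map_comp_assoc, hkillQ])
    (fun X P => hdesc _ fun h => by
      -- transport along the adjunction between `Y ▷ -` and `X ▷ -`, where `Y` is dual to `X`
      obtain ⟨Y, ⟨_⟩⟩ := hE X
      have key : Y ⊴ₗ (F.act v Q ≫ F.functor.map h ≫ (F.c X P).hom ≫ X ⊴ₗ cokernel.π (s P)) ≫
          actionEv X Y (cokernel (s P)) = 0 := by
        have h1 := actionEv_naturality X Y (cokernel.π (s P))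
        have h2 := F.c_comp_actionEv X Y P
        have h3 := F.c_inv_right Y h
        simp only [actionHomRight_comp, Category.assoc] at h1 h2 ⊢
        rw [h1, reassoc_of% h2, reassoc_of% h3, reassoc_of% (F.act_tensor v Y Q)]
        simp only [← F.functor.map_comp_assoc]
        rw [hkill, comp_zero]
      exact IsExactAction.eq_zero_of_actionEv k X Y _ key)
    (fun X P => IsExactAction.exists_desc_cokernel k X (s P) _ (by
      rw [← Category.id_comp (X ⊴ₗ s P ≫ _), ← actionHomRight_id, ← biproduct.total,
        IsExactAction.actionHomRight_sum k, Preadditive.sum_comp]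
      refine Finset.sum_eq_zero fun i _ => ?_
      rw [← actionHomRight_comp_assoc, Category.assoc, biproduct.ι_desc, actionHomRight_comp,
        Category.assoc,
        actionHomRight_comp, Category.assoc, reassoc_of% (F.c_inv_right X _),
        reassoc_of% (F.act_tensor v X Q), ← F.functor.map_comp_assoc, hkill, comp_zero,
        comp_zero]))
  refine ⟨F', F.quotientπ _ _ _ _ _ _, ?_, fun hπ => ?_⟩
  · change v ≫ cokernel.π (s G) = 0
    have h1 := hkill (λₗ G).hom
    rw [act, Category.assoc, ← reassoc_of% (F.c_inv_unit G),
      ← actionUnitIso_hom_naturality_assoc] at h1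
    exact (Preadditive.IsIso.comp_left_eq_zero _ _).1 h1
  · change cokernel.π (s G) = 0 at hπ
    exact ⟨s G, Preadditive.epi_of_cokernel_zero hπ⟩

end ModuleFunctor

/-! ### Right exact functors and their restrictions to projective objects -/

namespace CategoryTheory

/-- The full subcategory of projective objects. -/
abbrev Proj (M : Type u₂) [Category.{v₂} M] := (isProjective M).FullSubcategory

instance {M : Type u₂} [Category.{v₂} M] (P : Proj M) : Projective P.obj := P.property

namespace Proj

/-- A projective object, as an object of the category of projective objects. -/
abbrev of {M : Type u₂} [Category.{v₂} M] (P : M) [h : Projective P] : Proj M := ⟨P, h⟩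

/-- A morphism of projective objects, as a morphism of the category of projective objects. -/
abbrev ofHom {M : Type u₂} [Category.{v₂} M] {P P' : Proj M} (f : P.obj ⟶ P'.obj) : P ⟶ P' :=
  ObjectProperty.homMk f

end Proj

section Restriction

variable {M : Type u₂} [Category.{v₂} M] [Abelian M] [EnoughProjectives M]
  {B : Type u₃} [Category.{v₃} B] [Preadditive B]

/-- The chosen projective object that covers `N`; it need not be a projective cover. -/
noncomputable abbrev Proj.cover (N : M) : Proj M := Proj.of (Projective.over N)

omit [EnoughProjectives M] in
/-- A right exact functor sends an epimorphism to the cokernel of its kernel. -/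
lemma exists_desc_of_rightExact (H : M ⥤ B) [H.Additive] [PreservesFiniteColimits H] {P N : M}
    (π : P ⟶ N) [Epi π] {Y : B} (g : H.obj P ⟶ Y) (hg : H.map (kernel.ι π) ≫ g = 0) :
    ∃ t, H.map π ≫ t = g :=
  ⟨_, (isColimitCoforkMapOfIsColimit' H (kernel.condition π)
    (Abelian.epiIsCokernelOfKernel (KernelFork.ofι (kernel.ι π) (kernel.condition π))
      (kernelIsKernel π))).fac
      (CokernelCofork.ofπ g hg) WalkingParallelPair.one⟩

/-- A right exact functor `H` is determined by its restriction to projective objects: morphisms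
`H N ⟶ Y` are compatible families of morphisms `H P ⟶ Y` for `P ⟶ N` with `P` projective. -/
lemma exists_desc_of_projective (H : M ⥤ B) [H.Additive] [PreservesFiniteColimits H] {N : M}
    {Y : B} (φ : ∀ {P : Proj M}, (P.obj ⟶ N) → (H.obj P.obj ⟶ Y))
    (hφ : ∀ {P P' : Proj M} (a : P.obj ⟶ P'.obj) (h : P'.obj ⟶ N),
      H.map a ≫ φ h = φ (a ≫ h)) :
    ∃ t : H.obj N ⟶ Y, ∀ {P : Proj M} (h : P.obj ⟶ N), H.map h ≫ t = φ h := by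
  have h0 (P : Proj M) : φ (0 : P.obj ⟶ N) = 0 := by
    have := hφ (0 : P.obj ⟶ P.obj) (0 : P.obj ⟶ N)
    rwa [H.map_zero, zero_comp, comp_zero, eq_comm] at this
  obtain ⟨t, ht⟩ := exists_desc_of_rightExact H (Projective.π N)
    (φ (P := Proj.cover N) (Projective.π N)) (by
      rw [← cancel_epi (H.map (Projective.π (kernel (Projective.π N)))), ← H.map_comp_assoc,
        hφ (P := Proj.cover _) (P' := Proj.cover N), Category.assoc, kernel.condition, comp_zero,
        h0, comp_zero])
  refine ⟨t, fun {P} h => ?_⟩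
  rw [← Projective.factorThru_comp h (Projective.π N), H.map_comp, Category.assoc, ht,
    hφ (P' := Proj.cover N)]

omit [Abelian M] [Preadditive B] in
lemma hom_ext_of_projective (H : M ⥤ B) [H.PreservesEpimorphisms] {N : M} {Y : B}
    {s t : H.obj N ⟶ Y} (h : ∀ (P : Proj M) (h : P.obj ⟶ N), H.map h ≫ s = H.map h ≫ t) :
    s = t := by
  rw [← cancel_epi (H.map (Projective.π N))]
  exact h (Proj.cover N) _

omit [Abelian M] [Preadditive B] in
/-- Natural transformations from a right exact functor are determined on projective objects. -/
lemma natTrans_ext_of_projective {H H' : M ⥤ B} [H.PreservesEpimorphisms] {a b : H ⟶ H'}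
    (h : ∀ P : Proj M, a.app P.obj = b.app P.obj) : a = b := by
  ext N
  refine hom_ext_of_projective H fun P f => ?_
  rw [a.naturality, b.naturality, h]

/-- A natural transformation between the restrictions to projective objects extends to all
objects, if the source is right exact. -/
lemma exists_natTrans_of_projective (H H' : M ⥤ B) [H.Additive] [PreservesFiniteColimits H]
    (τ : (isProjective M).ι ⋙ H ⟶ (isProjective M).ι ⋙ H') :
    ∃ a : H ⟶ H', ∀ P : Proj M, a.app P.obj = τ.app P := by
  have hτ {P P' : Proj M} (f : P.obj ⟶ P'.obj) : H.map f ≫ τ.app P' = τ.app P ≫ H'.map f :=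
    τ.naturality (Proj.ofHom f)
  have h (N : M) := exists_desc_of_projective H (N := N) (fun {P} h => τ.app P ≫ H'.map h)
    (fun a h => by rw [← Category.assoc, hτ, Category.assoc, H'.map_comp])
  choose t ht using h
  refine ⟨{ app := t, naturality := fun {N N'} f => ?_ }, fun P => ?_⟩
  · refine hom_ext_of_projective H fun P g => ?_
    rw [← H.map_comp_assoc, ht, reassoc_of% (ht N g), H'.map_comp]
  · have := ht P.obj (𝟙 P.obj)
    simpa using this

/-- A natural isomorphism between the restrictions of right exact functors to projective objects
extends to all objects. -/
lemma exists_natIso_of_projective (H H' : M ⥤ B) [H.Additive] [PreservesFiniteColimits H]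
    [H'.Additive] [PreservesFiniteColimits H']
    (τ : (isProjective M).ι ⋙ H ≅ (isProjective M).ι ⋙ H') :
    ∃ a : H ≅ H', ∀ P : Proj M, a.hom.app P.obj = τ.hom.app P := by
  obtain ⟨a, ha⟩ := exists_natTrans_of_projective H H' τ.hom
  obtain ⟨b, hb⟩ := exists_natTrans_of_projective H' H τ.inv
  exact ⟨⟨a, b, natTrans_ext_of_projective fun P => by simp [ha, hb],
    natTrans_ext_of_projective fun P => by simp [ha, hb]⟩, ha⟩

end Restriction

/-! ### Extending functors from projective objects -/

namespace Proj

variable {M : Type u₂} [Category.{v₂} M] [Abelian M] [EnoughProjectives M]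
  {B : Type u₃} [Category.{v₃} B] [Abelian B] (F : Proj M ⥤ B) [F.Additive]

/-- The first morphism `P₁ ⟶ P₀` of a projective presentation `P₁ ⟶ P₀ ⟶ N ⟶ 0`. -/
noncomputable def presentation (N : M) :
    Proj.cover (kernel (Projective.π N)) ⟶ Proj.cover N :=
  Proj.ofHom (Projective.π _ ≫ kernel.ι _)

/-- The value at `N` of the right exact extension of `F`. -/
noncomputable abbrev extObj (N : M) : B := cokernel (F.map (presentation N))

/-- The morphism from `F P` to the extension of `F` given by a morphism `h : P ⟶ N`. -/
noncomputable def extObjι {P : Proj M} {N : M} (h : P.obj ⟶ N) : F.obj P ⟶ extObj F N :=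
  F.map (Proj.ofHom (P' := Proj.cover N) (Projective.factorThru h (Projective.π N))) ≫
    cokernel.π (F.map (presentation N))

omit [F.Additive] in
lemma map_comp_cokernel_π {P : Proj M} {N : M} (u : P ⟶ Proj.cover N)
    (hu : u.hom ≫ Projective.π N = 0) :
    F.map u ≫ cokernel.π (F.map (presentation N)) = 0 := by
  have hu' : u = Proj.ofHom (P' := Proj.cover (kernel (Projective.π N)))
      (Projective.factorThru (kernel.lift _ _ hu) (Projective.π _)) ≫ presentation N := by
    ext
    simp [presentation]
  rw [hu', F.map_comp, Category.assoc, cokernel.condition, comp_zero]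

/-- Any lift of `h : P ⟶ N` to `Proj.cover N` can be used in the definition. -/
lemma extObjι_eq {P : Proj M} {N : M} (h : P.obj ⟶ N) (u : P ⟶ Proj.cover N)
    (hu : u.hom ≫ Projective.π N = h) :
    extObjι F h = F.map u ≫ cokernel.π (F.map (presentation N)) := by
  rw [extObjι, ← sub_eq_zero, ← Preadditive.sub_comp, ← F.map_sub]
  refine map_comp_cokernel_π F _ ?_
  change (Projective.factorThru h (Projective.π N) - u.hom) ≫ Projective.π N = 0
  rw [Preadditive.sub_comp, Projective.factorThru_comp, hu, sub_self]

lemma map_comp_extObjι {P P' : Proj M} {N : M} (a : P ⟶ P') (h : P'.obj ⟶ N) :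
    F.map a ≫ extObjι F h = extObjι F (a.hom ≫ h) := by
  rw [extObjι_eq F (a.hom ≫ h)
    (a ≫ Proj.ofHom (P' := Proj.cover N) (Projective.factorThru h (Projective.π N)))
    (by simp), F.map_comp, Category.assoc]
  rfl

lemma extObjι_add {P : Proj M} {N : M} (h h' : P.obj ⟶ N) :
    extObjι F (h + h') = extObjι F h + extObjι F h' := by
  rw [extObjι_eq F (h + h') (Proj.ofHom (Projective.factorThru h (Projective.π N)) +
    Proj.ofHom (Projective.factorThru h' (Projective.π N))) ?_, F.map_add, Preadditive.add_comp]
  · rfl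
  · change (Projective.factorThru h (Projective.π N) +
      Projective.factorThru h' (Projective.π N)) ≫ Projective.π N = _
    rw [Preadditive.add_comp, Projective.factorThru_comp, Projective.factorThru_comp]

lemma extObj_hom_ext {N : M} {Y : B} {s t : extObj F N ⟶ Y}
    (h : ∀ {P : Proj M} (h : P.obj ⟶ N), extObjι F h ≫ s = extObjι F h ≫ t) : s = t := by
  have h1 := h (P := Proj.cover N) (Projective.π N)
  rw [extObjι_eq F (P := Proj.cover N) (Projective.π N) (𝟙 _) (by simp), F.map_id,
    Category.id_comp] at h1
  exact (cancel_epi (cokernel.π (F.map (presentation N)))).1 h1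

/-- Compatible families of morphisms `F P ⟶ Y` for `P ⟶ N` induce a morphism from the value at `N`
of the extension of `F`. -/
lemma exists_extObj_desc {N : M} {Y : B} (φ : ∀ {P : Proj M}, (P.obj ⟶ N) → (F.obj P ⟶ Y))
    (hφ : ∀ {P P' : Proj M} (a : P ⟶ P') (h : P'.obj ⟶ N), F.map a ≫ φ h = φ (a.hom ≫ h)) :
    ∃ t : extObj F N ⟶ Y, ∀ {P : Proj M} (h : P.obj ⟶ N), extObjι F h ≫ t = φ h := by
  have h0 (P : Proj M) : φ (0 : P.obj ⟶ N) = 0 := by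
    have := hφ (0 : P ⟶ P) (0 : P.obj ⟶ N)
    rwa [F.map_zero, zero_comp, comp_zero, eq_comm] at this
  refine ⟨cokernel.desc _ (φ (P := Proj.cover N) (Projective.π N)) ?_, fun {P} h => ?_⟩
  · rw [hφ, presentation, ObjectProperty.homMk_hom, Category.assoc, kernel.condition, comp_zero,
      h0]
  · rw [extObjι, Category.assoc, cokernel.π_desc, hφ, ObjectProperty.homMk_hom,
      Projective.factorThru_comp]

lemma exists_extObj_map {N N' : M} (f : N ⟶ N') : ∃ t : extObj F N ⟶ extObj F N',
    ∀ {P : Proj M} (h : P.obj ⟶ N), extObjι F h ≫ t = extObjι F (h ≫ f) :=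
  exists_extObj_desc F (fun {_} h => extObjι F (h ≫ f)) fun a h => by
    rw [map_comp_extObjι, Category.assoc]

/-- The right exact functor on `M` that extends the functor `F` on projective objects; its value
at `N` is the cokernel of `F P₁ ⟶ F P₀` for a projective presentation `P₁ ⟶ P₀ ⟶ N ⟶ 0`. -/
noncomputable def ext : M ⥤ B where
  obj N := extObj F N
  map f := (exists_extObj_map F f).choose
  map_id N := extObj_hom_ext F fun h => by
    rw [(exists_extObj_map F (𝟙 N)).choose_spec h, Category.comp_id, Category.comp_id]
  map_comp f g := extObj_hom_ext F fun h => by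
    have h1 := (exists_extObj_map F f).choose_spec h
    have h2 := (exists_extObj_map F g).choose_spec (h ≫ f)
    refine ((exists_extObj_map F (f ≫ g)).choose_spec h).trans ?_
    rw [reassoc_of% h1, h2, Category.assoc]

/-- The morphism from `F P` to the extension of `F` given by a morphism `h : P ⟶ N`. -/
noncomputable def extι {P : Proj M} {N : M} (h : P.obj ⟶ N) : F.obj P ⟶ (ext F).obj N :=
  extObjι F h

lemma extι_comp_map {P : Proj M} {N N' : M} (h : P.obj ⟶ N) (f : N ⟶ N') :
    extι F h ≫ (ext F).map f = extι F (h ≫ f) :=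
  (exists_extObj_map F f).choose_spec h

lemma map_comp_extι {P P' : Proj M} {N : M} (a : P ⟶ P') (h : P'.obj ⟶ N) :
    F.map a ≫ extι F h = extι F (a.hom ≫ h) :=
  map_comp_extObjι F a h

lemma extι_add {P : Proj M} {N : M} (h h' : P.obj ⟶ N) :
    extι F (h + h') = extι F h + extι F h' :=
  extObjι_add F h h'

variable {F} in
lemma ext_hom_ext {N : M} {Y : B} {s t : (ext F).obj N ⟶ Y}
    (h : ∀ {P : Proj M} (h : P.obj ⟶ N), extι F h ≫ s = extι F h ≫ t) : s = t :=
  extObj_hom_ext F h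

/-- Compatible families of morphisms `F P ⟶ Y` for `P ⟶ N` induce a morphism from the value at `N`
of the extension of `F`. -/
lemma exists_ext_desc {N : M} {Y : B} (φ : ∀ {P : Proj M}, (P.obj ⟶ N) → (F.obj P ⟶ Y))
    (hφ : ∀ {P P' : Proj M} (a : P ⟶ P') (h : P'.obj ⟶ N), F.map a ≫ φ h = φ (a.hom ≫ h)) :
    ∃ t : (ext F).obj N ⟶ Y, ∀ {P : Proj M} (h : P.obj ⟶ N), extι F h ≫ t = φ h :=
  exists_extObj_desc F φ hφ

instance : (ext F).Additive where
  map_add {N N' f g} := ext_hom_ext fun h => by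
    rw [Preadditive.comp_add, extι_comp_map, extι_comp_map, extι_comp_map, Preadditive.comp_add,
      extι_add]

lemma ext_linear (k : Type w) [Field k] [Linear k M] [Linear k B] [F.Linear k] :
    (ext F).Linear k where
  map_smul {N N'} f r := ext_hom_ext fun {P} h => by
    rw [Linear.comp_smul, extι_comp_map, extι_comp_map, Linear.comp_smul]
    have h1 : r • (h ≫ f) = (r • 𝟙 P : P ⟶ P).hom ≫ h ≫ f := by
      change _ = (r • 𝟙 P.obj) ≫ _
      rw [Linear.smul_comp, Category.id_comp]
    rw [h1, ← map_comp_extι, F.map_smul, F.map_id, Linear.smul_comp, Category.id_comp]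

/-- The extension of `F` is right exact, since a morphism from a projective object to a quotient
lifts, and lifts differ by morphisms to the kernel. -/
instance : PreservesFiniteColimits (ext F) := by
  refine ((Functor.preservesFiniteColimits_tfae (ext F)).out 0 3).1 fun S hS => ?_
  have := hS.mono_f
  have := hS.epi_g
  refine ((S.map (ext F)).exact_and_epi_g_iff_g_is_cokernel).2 ⟨?_⟩
  have hepi : Epi ((ext F).map S.g) := Preadditive.epi_of_cancel_zero _ fun {Y} g hg =>
    ext_hom_ext fun h => by
      rw [← Projective.factorThru_comp h S.g, ← extι_comp_map, Category.assoc, hg,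
        comp_zero, comp_zero]
  refine CokernelCofork.IsColimit.ofπ' ((ext F).map S.g) _ fun {Y} g hg => ?_
  have hg' : (ext F).map S.f ≫ g = 0 := hg
  have key {P : Proj M} (u : P.obj ⟶ S.X₂) (hu : u ≫ S.g = 0) : extι F u ≫ g = 0 := by
    rw [← hS.exact.lift_f u hu, ← extι_comp_map, Category.assoc, hg', comp_zero]
  have key' {P : Proj M} (u u' : P.obj ⟶ S.X₂) (hu : u ≫ S.g = u' ≫ S.g) :
      extι F u ≫ g = extι F u' ≫ g := by
    have h1 := key (u - u') (by rw [Preadditive.sub_comp, hu, sub_self])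
    have h2 := extι_add F (u - u') u'
    rw [sub_add_cancel] at h2
    rw [h2, Preadditive.add_comp, h1, zero_add]
  have hd := exists_ext_desc F (N := S.X₃)
    (fun {_} h => extι F (Projective.factorThru h S.g) ≫ g) (fun a h => by
      rw [reassoc_of% (map_comp_extι F a)]
      exact key' _ _ (by simp))
  refine ⟨hd.choose, ext_hom_ext fun {P} u => ?_⟩
  have h1 := hd.choose_spec (u ≫ S.g)
  rw [reassoc_of% (extι_comp_map F u S.g), h1]
  exact key' _ _ (by simp)

/-- The extension of `F` agrees with `F` on projective objects. -/
noncomputable def extIso : F ≅ (isProjective M).ι ⋙ ext F :=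
  NatIso.ofComponents (fun P =>
    have hd := exists_ext_desc F (N := P.obj) (fun {P'} h => F.map (Proj.ofHom (P' := P) h))
      (fun a h => by rw [← F.map_comp]; rfl)
    { hom := extι F (𝟙 P.obj)
      inv := hd.choose
      hom_inv_id := (hd.choose_spec (𝟙 P.obj)).trans (F.map_id P)
      inv_hom_id := ext_hom_ext fun {P'} h => by
        have h1 := hd.choose_spec h
        rw [reassoc_of% h1, map_comp_extι]
        simp }) fun {P P'} f => by
    have h1 := map_comp_extι F f (𝟙 P'.obj)
    have h2 := extι_comp_map F (𝟙 P.obj) f.hom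
    rw [Category.comp_id] at h1
    rw [Category.id_comp] at h2
    exact h1.trans h2.symm

end Proj

end CategoryTheory

/-! ### Module endofunctors are determined by projective objects -/

/-- A monoidal category in which every object has a left and a right dual. -/
class HasDuals (E : Type u₁) [Category.{v₁} E] [MonoidalCategory E] : Prop where
  exists_right (X : E) : ∃ Y, Nonempty (ExactPairing X Y)
  exists_left (X : E) : ∃ Y, Nonempty (ExactPairing Y X)

namespace HasDuals

variable {E : Type u₁} [Category.{v₁} E] [MonoidalCategory E] [HasDuals E]
  {M : Type u₂} [Category.{v₂} M] [MonoidalLeftAction E M]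

variable (M) in
lemma isLeftAdjoint_action (X : E) : ((curriedAction E M).obj X).IsLeftAdjoint := by
  obtain ⟨Y, ⟨_⟩⟩ := exists_left X
  exact (actionAdjunction M Y X).isLeftAdjoint

variable (M) in
lemma isRightAdjoint_action (X : E) : ((curriedAction E M).obj X).IsRightAdjoint := by
  obtain ⟨Y, ⟨_⟩⟩ := exists_right X
  exact (actionAdjunction M X Y).isRightAdjoint

instance projective_action (X : E) (P : M) [hP : Projective P] : Projective (X ⊙ₗ P) := by
  obtain ⟨Y, ⟨_⟩⟩ := exists_left X
  have := isLeftAdjoint_action M Y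
  exact (actionAdjunction M Y X).map_projective P hP

/-- The action on projective objects. -/
instance : MonoidalLeftAction E (Proj M) where
  actionObj X P := ⟨X ⊙ₗ P.obj, projective_action X P.obj⟩
  actionHomLeft f P := ObjectProperty.homMk (f ⊵ₗ P.obj)
  actionHomRight X _ _ f := ObjectProperty.homMk (X ⊴ₗ f.hom)
  actionHom f g := ObjectProperty.homMk (f ⊙ₗₘ g.hom)
  actionAssocIso X Y P := ObjectProperty.isoMk _ (αₗ X Y P.obj)
  actionUnitIso P := ObjectProperty.isoMk _ (λₗ P.obj)
  actionHom_def f g := ObjectProperty.hom_ext _ (actionHom_def f g.hom)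
  actionHomRight_id X P := ObjectProperty.hom_ext _ (actionHomRight_id X P.obj)
  id_actionHomLeft X P := ObjectProperty.hom_ext _ (id_actionHomLeft X P.obj)
  actionHom_comp f₁ f₂ g₁ g₂ := ObjectProperty.hom_ext _ (actionHom_comp f₁ f₂ g₁.hom g₂.hom)
  actionAssocIso_hom_naturality f g h :=
    ObjectProperty.hom_ext _ (actionAssocIso_hom_naturality f g h.hom)
  actionUnitIso_hom_naturality f := ObjectProperty.hom_ext _ (actionUnitIso_hom_naturality f.hom)
  whiskerLeft_actionHomLeft X _ _ f P :=
    ObjectProperty.hom_ext _ (whiskerLeft_actionHomLeft X f P.obj)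
  whiskerRight_actionHomLeft X f P :=
    ObjectProperty.hom_ext _ (whiskerRight_actionHomLeft X f P.obj)
  associator_actionHom X Y Z P := ObjectProperty.hom_ext _ (associator_actionHom X Y Z P.obj)
  leftUnitor_actionHom X P := ObjectProperty.hom_ext _ (leftUnitor_actionHom X P.obj)
  rightUnitor_actionHom X P := ObjectProperty.hom_ext _ (rightUnitor_actionHom X P.obj)

end HasDuals

namespace ModuleEnd

variable {k : Type w} [Field k] {E : Type u₁} [Category.{v₁} E] [MonoidalCategory E] [HasDuals E]
  {M : Type u₂} [Category.{v₂} M]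

section

variable [Preadditive M] [Linear k M] [MonoidalLeftAction E M]

attribute [local instance] additive linear rightExact

/-- The restriction of module endofunctors to projective objects. -/
@[simps]
def restriction (k : Type w) [Field k] (E : Type u₁) [Category.{v₁} E] [MonoidalCategory E]
    [HasDuals E] (M : Type u₂) [Category.{v₂} M] [Preadditive M] [Linear k M]
    [MonoidalLeftAction E M] : ModuleEnd k E M ⥤ ModuleFunctor k E (Proj M) M where
  obj F :=
    { functor := (isProjective M).ι ⋙ F.functor
      additive := inferInstance
      linear := inferInstance
      c := fun X P => F.c X P.obj
      natural_left := fun f P => F.natural_left f P.obj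
      natural_right := fun X _ _ f => F.natural_right X f.hom
      assoc := fun X Y P => F.assoc X Y P.obj
      unit := fun P => F.unit P.obj }
  map a :=
    { app := fun P => a.app P.obj
      naturality := fun f => a.naturality f.hom
      module := fun X P => a.module X P.obj }

end

section

variable [Abelian M] [EnoughProjectives M] [Linear k M] [MonoidalLeftAction E M]

attribute [local instance] additive linear rightExact

instance : (restriction k E M).Faithful where
  map_injective {F G a b} h := by
    ext N
    refine hom_ext_of_projective F.functor fun P f => ?_
    rw [a.naturality, b.naturality]
    exact congrArg (fun t => ModuleFunctor.Hom.app t P ≫ G.functor.map f) h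

instance : (restriction k E M).Full where
  map_surjective {F G} τ := by
    obtain ⟨a, ha⟩ := exists_natTrans_of_projective F.functor G.functor
      { app := τ.app, naturality := fun _ _ f => τ.naturality f }
    refine ⟨{ app := a.app, naturality := fun f => a.naturality f,
               module := fun X N => ?_ }, ?_⟩
    · have := HasDuals.isLeftAdjoint_action M X
      refine hom_ext_of_projective ((curriedAction E M).obj X ⋙ F.functor) fun P f => ?_
      have h : a.app (X ⊙ₗ P.obj) ≫ (G.c X P.obj).hom = (F.c X P.obj).hom ≫ X ⊴ₗ a.app P.obj := by
        rw [ha P]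
        exact (ha (X ⊙ₗ P) =≫ _).trans (τ.module X P)
      change F.functor.map (X ⊴ₗ f) ≫ _ = F.functor.map (X ⊴ₗ f) ≫ _
      rw [a.naturality_assoc, G.natural_right, reassoc_of% (F.natural_right X f),
        ← actionHomRight_comp, a.naturality, actionHomRight_comp, ← reassoc_of% h]
    · ext P
      exact ha P

/-- A right exact functor `L` that extends the functor underlying a module functor `F` on
projective objects inherits the structure of a module endofunctor from `F`. -/
lemma mem_essImage_restriction [IsExactAction k E M] (F : ModuleFunctor k E (Proj M) M)
    (L : M ⥤ M) [L.Additive] [L.Linear k] [PreservesFiniteColimits L]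
    (θ : ∀ P, F.functor.obj P ≅ L.obj P.obj)
    (hθ : ∀ {P P' : Proj M} (f : P ⟶ P'),
      F.functor.map f ≫ (θ P').hom = (θ P).hom ≫ L.map f.hom) :
    (restriction k E M).essImage F := by
  have hex (X : E) : ∃ c : ∀ N : M, L.obj (X ⊙ₗ N) ≅ X ⊙ₗ L.obj N,
      (∀ {N N' : M} (f : N ⟶ N'), L.map (X ⊴ₗ f) ≫ (c N').hom = (c N).hom ≫ X ⊴ₗ L.map f) ∧
      ∀ P : Proj M, (θ (X ⊙ₗ P)).hom ≫ (c P.obj).hom = (F.c X P).hom ≫ X ⊴ₗ (θ P).hom := by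
    have := (IsExactAction.isLinearExact (k := k) (M := M) X).additive
    have := (IsExactAction.isLinearExact (k := k) (M := M) X).preservesFiniteColimits
    let T := (curriedAction E M).obj X
    let τ : (isProjective M).ι ⋙ T ⋙ L ≅ (isProjective M).ι ⋙ L ⋙ T :=
      NatIso.ofComponents (fun P => (θ (X ⊙ₗ P)).symm ≪≫ F.c X P ≪≫ T.mapIso (θ P))
        fun {P P'} f => by
          have h1 := hθ (X ⊴ₗ f)
          have h2 : X ⊴ₗ F.functor.map f ≫ X ⊴ₗ (θ P').hom =
              X ⊴ₗ (θ P).hom ≫ X ⊴ₗ L.map f.hom := by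
            rw [← actionHomRight_comp, ← actionHomRight_comp, hθ]
          have h3 := F.natural_right X f
          change L.map (X ⊴ₗ f.hom) ≫ (θ (X ⊙ₗ P')).inv ≫ (F.c X P').hom ≫ X ⊴ₗ (θ P').hom =
            ((θ (X ⊙ₗ P)).inv ≫ (F.c X P).hom ≫ X ⊴ₗ (θ P).hom) ≫ X ⊴ₗ L.map f.hom
          rw [← cancel_epi (θ (X ⊙ₗ P)).hom]
          simp only [Category.assoc, Iso.hom_inv_id_assoc]
          rw [← h2, ← reassoc_of% h3]
          change (θ (X ⊙ₗ P)).hom ≫ L.map (X ⊴ₗ f).hom ≫ _ = _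
          rw [← reassoc_of% h1, Iso.hom_inv_id_assoc]
    obtain ⟨a, ha⟩ := exists_natIso_of_projective (T ⋙ L) (L ⋙ T) τ
    refine ⟨fun N => a.app N, fun f => a.hom.naturality f, fun P => ?_⟩
    refine ((θ (X ⊙ₗ P)).hom ≫= ha P).trans ?_
    change (θ (X ⊙ₗ P)).hom ≫ (θ (X ⊙ₗ P)).inv ≫ (F.c X P).hom ≫ X ⊴ₗ (θ P).hom = _
    rw [Iso.hom_inv_id_assoc]
  choose c hnat hc using hex
  -- identities between natural transformations can be checked on projective objects
  have hepi {N : M} (X : E) {Y : M} {s t : L.obj (X ⊙ₗ N) ⟶ Y}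
      (h : ∀ (P : Proj M) (h : P.obj ⟶ N), L.map (X ⊴ₗ h) ≫ s = L.map (X ⊴ₗ h) ≫ t) : s = t :=
    have := HasDuals.isLeftAdjoint_action M X
    hom_ext_of_projective ((curriedAction E M).obj X ⋙ L) h
  let L' : ModuleEnd k E M :=
    { functor := L
      additive := inferInstance
      linear := inferInstance
      rightExact := inferInstance
      c := c
      natural_left := fun {X X'} f N => hepi X fun P h => by
        have key : L.map (f ⊵ₗ P.obj) ≫ (c X' P.obj).hom =
            (c X P.obj).hom ≫ f ⊵ₗ L.obj P.obj := by
          rw [← cancel_epi (θ (X ⊙ₗ P)).hom, reassoc_of% (hc X P), action_exchange,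
            ← reassoc_of% (F.natural_left f P), ← hc, reassoc_of% (hθ (f ⊵ₗ P))]
          rfl
        rw [← L.map_comp_assoc, action_exchange, L.map_comp_assoc, hnat, reassoc_of% key,
          reassoc_of% (hnat X h), action_exchange]
      natural_right := fun X _ _ f => hnat X f
      assoc := fun X Y N => hepi (X ⊗ Y) fun P h => by
        have hα {N N' : M} (g : N ⟶ N') :
            (X ⊗ Y) ⊴ₗ g ≫ (αₗ X Y N').hom = (αₗ X Y N).hom ≫ X ⊴ₗ Y ⊴ₗ g := by simp
        have key : L.map (αₗ X Y P.obj).hom ≫ (c X (Y ⊙ₗ P.obj)).hom ≫ X ⊴ₗ (c Y P.obj).hom =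
            (c (X ⊗ Y) P.obj).hom ≫ (αₗ X Y (L.obj P.obj)).hom := by
          have h1 := hθ (αₗ X Y P).hom
          have h2 := hc X (Y ⊙ₗ P)
          have h3 := congrArg (fun t => X ⊴ₗ t) (hc Y P)
          simp only [actionHomRight_comp] at h3
          rw [← cancel_epi (θ ((X ⊗ Y) ⊙ₗ P)).hom, reassoc_of% (hc (X ⊗ Y) P), hα,
            ← reassoc_of% (F.assoc X Y P), ← h3, ← reassoc_of% h2, reassoc_of% h1]
          rfl
        rw [← L.map_comp_assoc, hα, L.map_comp_assoc, reassoc_of% (hnat X (Y ⊴ₗ h)),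
          ← actionHomRight_comp, hnat Y h, actionHomRight_comp, reassoc_of% key,
          reassoc_of% (hnat (X ⊗ Y) h), hα]
      unit := fun N => hepi (𝟙_ E) fun P h => by
        have key : (c (𝟙_ E) P.obj).hom ≫ (λₗ (L.obj P.obj)).hom = L.map (λₗ P.obj).hom := by
          rw [← cancel_epi (θ (𝟙_ E ⊙ₗ P)).hom, reassoc_of% (hc (𝟙_ E) P),
            ← actionUnitIso_hom_naturality, reassoc_of% (F.unit P), hθ]
          rfl
        rw [reassoc_of% (hnat (𝟙_ E) h), ← actionUnitIso_hom_naturality, reassoc_of% key,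
          ← L.map_comp, ← L.map_comp, actionUnitIso_hom_naturality] }
  exact ⟨L', ⟨(ModuleFunctor.isoMk θ (fun _ _ f => hθ f) fun X P => hc X P).symm⟩⟩

instance [IsExactAction k E M] : (restriction k E M).EssSurj where
  mem_essImage F :=
    have := Proj.ext_linear F.functor k
    mem_essImage_restriction F (Proj.ext F.functor) (fun P => (Proj.extIso F.functor).app P)
      fun f => (Proj.extIso F.functor).hom.naturality f

instance [IsExactAction k E M] : (restriction k E M).IsEquivalence where

end

end ModuleEnd

/-! ### Categories of module functors are finite -/

/-- The object `Q` of `E` generates for the action on `M`: the morphisms `Q ▷ N ⟶ X ▷ N` induced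
by the morphisms `Q ⟶ X` are jointly epimorphic. -/
def IsActionGenerator {E : Type u₁} [Category.{v₁} E] [MonoidalCategory E] (Q : E)
    (M : Type u₂) [Category.{v₂} M] [HasZeroMorphisms M] [MonoidalLeftAction E M] : Prop :=
  ∀ (X : E) {N Z : M} (g : X ⊙ₗ N ⟶ Z), (∀ f : Q ⟶ X, f ⊵ₗ N ≫ g = 0) → g = 0

attribute [local instance] Abelian.hasFiniteBiproducts

/-- A projective object is a direct summand of a sum of copies of a given generator. -/
lemma Proj.exists_sum_comp_eq_id (k : Type w) [Field k] {M : Type u₂} [Category.{v₂} M] [Abelian M]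
    [Linear k M] [h : IsFiniteAbelian k M] {G : Proj M} (hG : IsSeparator G.obj) (P : Proj M) :
    ∃ (n : ℕ) (u : Fin n → (P ⟶ G)) (v : Fin n → (G ⟶ P)), ∑ i, u i ≫ v i = 𝟙 P := by
  have := h.finite_hom G.obj P.obj
  obtain ⟨n, p, hp⟩ := hG.exists_epi_biproduct (k := k) P.obj
  let s := Projective.factorThru (𝟙 P.obj) p
  refine ⟨n, fun i => Proj.ofHom (s ≫ biproduct.π _ i),
    fun i => Proj.ofHom (biproduct.ι (fun _ : Fin n => G.obj) i ≫ p), ?_⟩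
  have h1 : s ≫ (∑ i, biproduct.π (fun _ : Fin n => G.obj) i ≫
      biproduct.ι (fun _ : Fin n => G.obj) i) ≫ p =
      𝟙 P.obj := by
    rw [biproduct.total, Category.id_comp]
    exact Projective.factorThru_comp _ _
  refine (isProjective M).ι.map_injective ?_
  rw [Functor.map_sum]
  refine Eq.trans ?_ h1
  rw [Preadditive.sum_comp, Preadditive.comp_sum]
  exact Finset.sum_congr rfl fun i _ => by simp

namespace ModuleFunctor

variable {k : Type w} [Field k] {E : Type u₁} [Category.{v₁} E] [MonoidalCategory E] [HasDuals E]
  {M : Type u₂} [Category.{v₂} M] [Abelian M] [Linear k M] [hfin : IsFiniteAbelian k M]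
  [MonoidalLeftAction E M] [IsExactAction k E M]

omit [IsExactAction k E M] in
lemma evaluation_faithful {G : Proj M} (hG : IsSeparator G.obj) :
    (evaluation k E M G).Faithful where
  map_injective {F F' a b} h := by
    change a.app G = b.app G at h
    ext P
    obtain ⟨n, u, v, huv⟩ := Proj.exists_sum_comp_eq_id k hG P
    have key (c : F ⟶ F') :
        c.app P = ∑ i, F.functor.map (u i) ≫ c.app G ≫ F'.functor.map (v i) := by
      have h1 : F.functor.map (𝟙 P) ≫ c.app P = c.app P := by simp
      rw [← h1, ← huv, F.functor.map_sum, Preadditive.sum_comp]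
      exact Finset.sum_congr rfl fun i _ => by
        rw [F.functor.map_comp, Category.assoc, c.naturality]
    rw [key a, key b, h]

/-- If the action has a generator `Q`, then the category of module functors from the projective
objects of `M` to `M` is finite: a module functor generated by one element of `Hom(G, F G)`, where
`G` is a projective generator of `M`, takes at `G` a quotient of a bounded power of `Q ▷ G`. -/
theorem isFiniteAbelian {Q : E} (hQ : IsActionGenerator Q M) :
    IsFiniteAbelian k (ModuleFunctor k E (Proj M) M) := by
  obtain ⟨G₀, hP, hG⟩ := exists_projective_separator k M
  let G : Proj M := Proj.of G₀
  have := evaluation_faithful (k := k) (E := E) (G := G) hG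
  have hfinP (P P' : Proj M) : Module.Finite k (P ⟶ P') :=
    have : Module.Finite k ((isProjective M).ι.obj P ⟶ (isProjective M).ι.obj P') :=
      hfin.finite_hom P.obj P'.obj
    Module.Finite.of_injective ((isProjective M).ι.mapLinearMap k : (P ⟶ P') →ₗ[k] _)
      (isProjective M).ι.map_injective
  refine isFiniteAbelian_of_bound k (evaluation k E M G) hfin.finite_hom hG
    (Module.finrank k (G₀ ⟶
      ⨁ fun _ : Fin (Module.finrank k (Q ⊙ₗ G ⟶ G)) => Q ⊙ₗ G₀)) fun {F} x hx => ?_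
  obtain ⟨F', π, hπ, hp⟩ := F.exists_quotient_of_element x HasDuals.exists_right Q
    (fun X _ g => hQ X g) (hfinP _)
  obtain ⟨(p : _ ⟶ (evaluation k E M G).obj F), (hp : Epi p)⟩ := hp (by rw [hx π hπ]; rfl)
  have := hfin.finite_hom G₀ (⨁ fun _ : Fin (Module.finrank k (Q ⊙ₗ G ⟶ G)) => Q ⊙ₗ G₀)
  exact LinearMap.finrank_le_finrank_of_surjective (f := Linear.rightComp k G₀ p)
    fun y => ⟨Projective.factorThru y p, Projective.factorThru_comp y p⟩

end ModuleFunctor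

/-- Finiteness of abelian categories is invariant under linear equivalences. -/
lemma IsFiniteAbelian.of_isEquivalence (k : Type w) [Field k] {A : Type u₁} [Category.{v₁} A]
    [Preadditive A] [Linear k A] {B : Type u₂} [Category.{v₂} B] [Abelian B] [Linear k B]
    [h : IsFiniteAbelian k B] (Φ : A ⥤ B) [Φ.Additive] [Φ.Linear k] [Φ.IsEquivalence] :
    IsFiniteAbelian k A := by
  have : HasFiniteProducts A := ⟨fun n => Adjunction.hasLimitsOfShape_of_equivalence Φ⟩
  let _ : Abelian A := abelianOfEquivalence Φ
  obtain ⟨G, hP, hG⟩ := exists_projective_separator k B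
  refine isFiniteAbelian_of_bound k Φ h.finite_hom hG (Module.finrank k (G ⟶ G))
    fun {X} x hx => ?_
  have : Epi x := Preadditive.epi_of_cancel_zero _ fun {Z} g hg => by
    have h1 := hx (Φ.preimage (g ≫ (Φ.objObjPreimageIso Z).inv)) (by
      rw [Φ.map_preimage, reassoc_of% hg, zero_comp])
    have h2 := congrArg Φ.map h1
    rw [Φ.map_preimage, Φ.map_zero] at h2
    exact (Preadditive.IsIso.comp_right_eq_zero _ _).1 h2
  have := h.finite_hom G G
  exact LinearMap.finrank_le_finrank_of_surjective (f := Linear.rightComp k G x)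
    fun y => ⟨Projective.factorThru y x, Projective.factorThru_comp y x⟩

/-! ### The action of a finite tensor category -/

section FiniteTensor

variable (k : Type w) [Field k] (C : Type u₁) [Category.{v₁} C]

lemma IsFiniteTensorCategory.hasDuals [Preadditive C] [Linear k C] [MonoidalCategory C]
    [hC : IsFiniteTensorCategory k C] : HasDuals C := by
  obtain ⟨_⟩ := hC.rigid
  exact ⟨fun X => ⟨Xᘁ, ⟨inferInstance⟩⟩, fun X => ⟨ᘁX, ⟨inferInstance⟩⟩⟩

lemma IsLeftModuleCategory.isExactAction [Preadditive C] [Linear k C] [MonoidalCategory C]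
    (M : Type u₂) [Category.{v₂} M] [Preadditive M] [Linear k M] [MonoidalLeftAction C M]
    [hM : IsLeftModuleCategory k C M] : IsExactAction k C M :=
  ⟨hM.exact_right⟩

lemma IsLeftModuleCategory.exists_isActionGenerator [Abelian C] [Linear k C] [MonoidalCategory C]
    [hC : IsFiniteAbelian k C]
    (M : Type u₂) [Category.{v₂} M] [Preadditive M] [Linear k M] [MonoidalLeftAction C M]
    [hM : IsLeftModuleCategory k C M] : ∃ Q : C, IsActionGenerator Q M := by
  obtain ⟨Q, -, hQ⟩ := exists_projective_separator k C
  refine ⟨Q, fun X N Z g hg => ?_⟩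
  have := hC.finite_hom Q X
  have := (hM.exact_left N).additive
  have := (hM.exact_left N).preservesFiniteColimits
  exact hQ.eq_zero_of_map_comp (k := k) X ((curriedAction C M).flip.obj N) g hg

end FiniteTensor

/-! ### The action of a tensor subcategory of the dual category by evaluation -/

namespace ModuleEnd

variable {k : Type w} [Field k] {C : Type u₁} [Category.{v₁} C] [MonoidalCategory C]
  {M : Type u₂} [Category.{v₂} M]

section

variable [Preadditive M] [Linear k M] [MonoidalLeftAction C M]
  (P : ObjectProperty (ModuleEnd k C M))

/-- A monoidal full subcategory of the category of module endofunctors of `M` acts on `M` by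
evaluation, `D ▷ N = D N`. -/
instance evaluationAction [P.IsMonoidal] : MonoidalLeftAction P.FullSubcategory M where
  actionObj D N := D.obj.functor.obj N
  actionHomLeft a N := a.hom.app N
  actionHomRight D _ _ f := D.obj.functor.map f
  actionAssocIso D D' N := Iso.refl _
  actionUnitIso N := Iso.refl _
  actionHomRight_id D N := D.obj.functor.map_id N
  id_actionHomLeft D N := rfl
  actionHom_comp {D D' D'' N N' N''} f₁ f₂ g₁ g₂ := by
    change (f₁.hom.app N ≫ f₂.hom.app N) ≫ D''.obj.functor.map (g₁ ≫ g₂) =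
      (f₁.hom.app N ≫ D'.obj.functor.map g₁) ≫ f₂.hom.app N' ≫ D''.obj.functor.map g₂
    rw [Functor.map_comp, Category.assoc, Category.assoc, reassoc_of% f₂.hom.naturality]
  actionAssocIso_hom_naturality {D₁ D₂ D₃ D₄ N N'} f g h := by
    change ((f.hom.app _ ≫ D₂.obj.functor.map (g.hom.app N)) ≫
      D₂.obj.functor.map (D₄.obj.functor.map h)) ≫ 𝟙 _ =
      𝟙 _ ≫ f.hom.app _ ≫ D₂.obj.functor.map (g.hom.app N ≫ D₄.obj.functor.map h)
    simp
  actionUnitIso_hom_naturality f := by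
    change 𝟙 _ ≫ f = f ≫ 𝟙 _
    simp
  whiskerLeft_actionHomLeft D _ _ f N := by
    change D.obj.functor.map (f.hom.app N) = 𝟙 _ ≫ D.obj.functor.map (f.hom.app N) ≫ 𝟙 _
    simp
  whiskerRight_actionHomLeft D'' f N := by
    change f.hom.app _ = 𝟙 _ ≫ f.hom.app _ ≫ 𝟙 _
    simp
  associator_actionHom D₁ D₂ D₃ N := by
    change 𝟙 _ ≫ 𝟙 _ ≫ D₁.obj.functor.map (𝟙 _) = 𝟙 _ ≫ 𝟙 _
    simp
  leftUnitor_actionHom D N := by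
    change 𝟙 _ = 𝟙 _ ≫ 𝟙 _
    simp
  rightUnitor_actionHom D N := by
    change 𝟙 _ = 𝟙 _ ≫ D.obj.functor.map (𝟙 _)
    simp

instance [h : IsTensorSubcategory P] : HasDuals P.FullSubcategory where
  exists_right D := by
    obtain ⟨D', hD', ⟨p⟩⟩ := h.rightDual D.obj D.property
    let E : P.FullSubcategory := ⟨D', hD'⟩
    have : ExactPairing (P.ι.obj D) (P.ι.obj E) := p
    exact ⟨E, ⟨ExactPairing.ofFullyFaithful P.ι D E⟩⟩
  exists_left D := by
    obtain ⟨D', hD', ⟨p⟩⟩ := h.leftDual D.obj D.property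
    let E : P.FullSubcategory := ⟨D', hD'⟩
    have : ExactPairing (P.ι.obj E) (P.ι.obj D) := p
    exact ⟨E, ⟨ExactPairing.ofFullyFaithful P.ι E D⟩⟩

/-- Module functors in a tensor subcategory are left exact, since they have left adjoints. -/
instance [IsTensorSubcategory P] : IsExactAction k P.FullSubcategory M where
  isLinearExact D :=
    { additive := D.obj.additive
      linear := D.obj.linear
      preservesFiniteLimits := by
        have := HasDuals.isRightAdjoint_action M D
        infer_instance
      preservesFiniteColimits := D.obj.rightExact }

end

variable [Abelian M] [Linear k M] [hfin : IsFiniteAbelian k M] [MonoidalLeftAction C M]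
  [HasDuals C] [IsExactAction k C M] (P : ObjectProperty (ModuleEnd k C M))
  [hP : IsTensorSubcategory P]

/-- A tensor subcategory of the dual category contains a generator for its action on `M`: the
largest quotient, among those in the subcategory, of a projective generator of the category of
module functors. -/
lemma exists_isActionGenerator_fullSubcategory {Q : C} (hQ : IsActionGenerator Q M) :
    ∃ D : P.FullSubcategory, IsActionGenerator D M := by
  have := hfin.enoughProjectives
  have hZ := ModuleFunctor.isFiniteAbelian (k := k) hQ
  obtain ⟨U, hU, hUs⟩ := exists_projective_separator k (ModuleFunctor k C (Proj M) M)
  have := hZ.artinian U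
  have := hP.closedUnderSubobjects
  have := hP.closedUnderFiniteProducts
  let R := (restriction k C M).asEquivalence
  obtain ⟨D, q, hD, hq, hmax⟩ := exists_largest_quotient (Q := U) (P.inverseImage R.inverse)
    ⟨R.functor.obj (𝟙_ _), P.prop_of_iso (R.unitIso.app _) P.prop_unit⟩
    (fun i _ hY => P.prop_of_mono (R.inverse.map i) hY)
    (fun {X Y} hX hY => P.prop_of_isLimit
      (isLimitOfPreserves R.inverse (BinaryBiproduct.isLimit X Y)) (by
        rintro ⟨_ | _⟩ <;> assumption))
  refine ⟨⟨R.inverse.obj D, hD⟩, fun X N Z g hg => ?_⟩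
  -- on projective objects, use that evaluation is exact
  have key (N : Proj M) {Z : M} (g : X.obj.functor.obj N.obj ⟶ Z)
      (hg : ∀ f : R.inverse.obj D ⟶ X.obj, f.app N.obj ≫ g = 0) : g = 0 := by
    have := hZ.finite_hom U (R.functor.obj X.obj)
    refine hUs.eq_zero_of_map_comp (k := k) (R.functor.obj X.obj)
      (ModuleFunctor.evaluation k C M N) g fun f => ?_
    obtain ⟨f', rfl⟩ := hmax (P.prop_of_iso (R.unitIso.app _) X.property) f
    obtain ⟨t, ht⟩ := R.functor.map_surjective ((R.counitIso.app D).hom ≫ f')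
    have h1 : f' = (R.counitIso.app D).inv ≫ R.functor.map t := by rw [ht]; simp
    let c : D.functor.obj N ⟶ (R.inverse.obj D).functor.obj N.obj := (R.counitIso.app D).inv.app N
    have h2 : f'.app N = c ≫ t.app N.obj := congrArg (fun a => ModuleFunctor.Hom.app a N) h1
    have h3 : (q.app N ≫ c ≫ t.app N.obj) ≫ g = 0 := by
      rw [Category.assoc, Category.assoc, hg, comp_zero, comp_zero]
    exact (congrArg (fun s => (q.app N ≫ s) ≫ g) h2).trans h3
  have := X.obj.rightExact
  refine hom_ext_of_projective X.obj.functor fun A h => ?_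
  rw [comp_zero]
  refine key A _ fun f => ?_
  have h1 := hg (ObjectProperty.homMk f)
  change f.app N ≫ g = 0 at h1
  rw [← reassoc_of% f.naturality, h1, comp_zero]

end ModuleEnd

/-! ### The relative center as a category of module functors -/

namespace RelCenter

variable {k : Type w} [Field k] {C : Type u₁} [Category.{v₁} C] [MonoidalCategory C]
  {M : Type u₂} [Category.{v₂} M]

section

variable [Preadditive M] [Linear k M] [MonoidalLeftAction C M]
  (P : ObjectProperty (ModuleEnd k C M)) [P.IsMonoidal]

/-- The hexagon axiom for the unit object shows that its half-braiding is trivial. -/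
lemma γ_unit (F : RelCenter P) (N : M) :
    (F.γ (𝟙_ _) P.prop_unit N).hom = 𝟙 (F.functor.obj N) := by
  have h1 := F.hexagon P.prop_unit P.prop_unit N
  have h2 := F.natural_half (P.prop_tensor P.prop_unit P.prop_unit) P.prop_unit
    (λ_ (𝟙_ (ModuleEnd k C M))).hom N
  have h3 : F.functor.map (𝟙 N) ≫ (F.γ (𝟙_ _) P.prop_unit N).hom =
    ((F.γ (𝟙_ _) P.prop_unit N).hom ≫ (F.γ (𝟙_ _) P.prop_unit N).hom) ≫ 𝟙 _ :=
    h2.trans (h1 =≫ _)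
  rw [F.functor.map_id, Category.id_comp, Category.comp_id] at h3
  rw [← cancel_epi (F.γ (𝟙_ _) P.prop_unit N).hom]
  exact h3.symm.trans (Category.comp_id _).symm

/-- An object of the relative center is a module functor over the tensor subcategory, which acts
by evaluation. -/
@[simps]
def toModuleEnd : RelCenter P ⥤ ModuleEnd k P.FullSubcategory M where
  obj F :=
    { functor := F.functor
      additive := F.additive
      linear := F.linear
      rightExact := F.rightExact
      c := fun D N => F.γ D.obj D.property N
      natural_left := fun f N => F.natural_half _ _ f.hom N
      natural_right := fun D _ _ f => F.natural D.obj D.property f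
      assoc := fun D D' N => by
        refine Eq.trans ?_ (Category.comp_id _).symm
        change F.functor.map (𝟙 _) ≫ _ = _
        rw [F.functor.map_id, Category.id_comp]
        exact (F.hexagon D.property D'.property N).symm
      unit := fun N => by
        refine (Category.comp_id _).trans ((F.γ_unit P N).trans ?_)
        exact (F.functor.map_id N).symm }
  map a :=
    { app := a.app
      naturality := a.naturality
      module := fun D N => a.comm D.obj D.property N }

instance : (toModuleEnd P).Faithful where
  map_injective h := by
    ext N
    exact congrArg (fun t => ModuleEnd.Hom.app t N) h

instance : (toModuleEnd P).Full where
  map_surjective a :=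
    ⟨{ app := a.app
       naturality := a.naturality
       comm := fun D hD N => a.module ⟨D, hD⟩ N }, rfl⟩

instance : (toModuleEnd P).EssSurj where
  mem_essImage F :=
    ⟨{ functor := F.functor
       additive := F.additive
       linear := F.linear
       rightExact := F.rightExact
       γ := fun D hD N => F.c ⟨D, hD⟩ N
       natural := fun D hD _ _ f => F.natural_right ⟨D, hD⟩ f
       natural_half := fun {D D'} hD hD' f N =>
        F.natural_left (X := ⟨D, hD⟩) (X' := ⟨D', hD'⟩) (ObjectProperty.homMk f) N
       hexagon := fun {D D'} hD hD' N => by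
        have h := F.assoc ⟨D, hD⟩ ⟨D', hD'⟩ N
        refine ((Category.comp_id _).symm.trans h.symm).trans ?_
        change F.functor.map (𝟙 _) ≫ _ = _
        rw [F.functor.map_id, Category.id_comp]
        rfl }, ⟨Iso.refl _⟩⟩

instance : (toModuleEnd P).IsEquivalence where

end

section

variable [Abelian M] [Linear k M] [hfin : IsFiniteAbelian k M] [MonoidalLeftAction C M]
  [HasDuals C] [IsExactAction k C M] (P : ObjectProperty (ModuleEnd k C M))
  [hP : IsTensorSubcategory P]

/-- The restriction of objects of the relative center to projective objects. -/
abbrev restriction : RelCenter P ⥤ ModuleFunctor k P.FullSubcategory (Proj M) M :=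
  toModuleEnd P ⋙ ModuleEnd.restriction k P.FullSubcategory M

instance : (restriction P).Additive where
instance : (restriction P).Linear k where

instance isEquivalence_restriction : (restriction P).IsEquivalence :=
  have := hfin.enoughProjectives
  inferInstance

/-- The relative center is a finite abelian category, being equivalent to a category of module
functors over the tensor subcategory. -/
theorem isFiniteAbelian {Q : C} (hQ : IsActionGenerator Q M) : IsFiniteAbelian k (RelCenter P) := by
  obtain ⟨D, hD⟩ := ModuleEnd.exists_isActionGenerator_fullSubcategory P hQ
  have := ModuleFunctor.isFiniteAbelian (k := k) hD
  exact IsFiniteAbelian.of_isEquivalence k (restriction P)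

/-- The evaluation `F ↦ F N`. -/
@[simps]
def evaluation (N : M) : RelCenter P ⥤ M where
  obj F := F.functor.obj N
  map a := a.app N

instance (N : M) : (evaluation P N).Additive where
instance (N : M) : (evaluation P N).Linear k where

instance (N : M) [Projective N] : PreservesFiniteLimits (evaluation P N) :=
  inferInstanceAs (PreservesFiniteLimits
    (restriction P ⋙ ModuleFunctor.evaluation k P.FullSubcategory M (Proj.of N)))

instance (N : M) [Projective N] : PreservesFiniteColimits (evaluation P N) :=
  inferInstanceAs (PreservesFiniteColimits
    (restriction P ⋙ ModuleFunctor.evaluation k P.FullSubcategory M (Proj.of N)))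

omit [HasDuals C] [IsExactAction k C M] in
lemma evaluation_faithful {N : M} [Projective N] (hN : IsSeparator N) :
    (evaluation P N).Faithful :=
  have : (ModuleFunctor.evaluation k P.FullSubcategory M (Proj.of N)).Faithful :=
    ModuleFunctor.evaluation_faithful hN
  inferInstanceAs (restriction P ⋙ ModuleFunctor.evaluation k P.FullSubcategory M
    (Proj.of N)).Faithful

end

end RelCenter

namespace RelCenter

variable {k : Type w} [Field k] {C : Type u₁} [Category.{v₁} C] [Preadditive C] [Linear k C]
  [MonoidalCategory C] {M : Type u₂} [Category.{v₂} M]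

/-! ### The bimodule axioms -/

section Axioms

variable [Preadditive M] [Linear k M] [MonoidalLeftAction C M] [hM : IsLeftModuleCategory k C M]
  {P : ObjectProperty (ModuleEnd k C M)} [P.IsMonoidal]

lemma actionAssocIso_hom_app (X Y : C) (F : RelCenter P) (N : M) :
    Hom.app (αₗ X Y F).hom N = (αₗ X Y (F.functor.obj N)).hom :=
  Category.comp_id _

lemma actionUnitIso_hom_app (F : RelCenter P) (N : M) :
    Hom.app (MonoidalLeftActionStruct.actionUnitIso (C := C) F).hom N =
      (λₗ (F.functor.obj N)).hom :=
  Category.comp_id _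

lemma rightActionAssocIso_hom_app (F : RelCenter P) (X Y : C) (N : M) :
    Hom.app (αᵣ F X Y).hom N = F.functor.map (αₗ X Y N).hom :=
  Category.comp_id _

lemma rightActionUnitIso_hom_app (F : RelCenter P) (N : M) :
    Hom.app (MonoidalRightActionStruct.actionUnitIso (C := C) F).hom N =
      F.functor.map (λₗ N).hom :=
  Category.comp_id _

/-- The left action of `C` on the relative center; its axioms are those of the action on `M`. -/
abbrev leftAction : MonoidalLeftAction C (RelCenter P) where
  toMonoidalLeftActionStruct := leftActionStruct
  actionHom_def _ _ := rfl
  actionHomRight_id X F := by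
    ext N
    exact actionHomRight_id X _
  id_actionHomLeft X F := by
    ext N
    exact id_actionHomLeft X _
  actionHom_comp {X X' X'' F F' F''} f₁ f₂ g₁ g₂ := by
    ext N
    change (f₁ ≫ f₂) ⊵ₗ F.functor.obj N ≫ X'' ⊴ₗ (g₁.app N ≫ g₂.app N) =
      (f₁ ⊵ₗ F.functor.obj N ≫ X' ⊴ₗ g₁.app N) ≫ f₂ ⊵ₗ F'.functor.obj N ≫ X'' ⊴ₗ g₂.app N
    simp [action_exchange_assoc]
  actionAssocIso_hom_naturality {X₁ X₂ X₃ X₄ F F'} f g h := by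
    ext N
    rw [comp_app, comp_app, actionAssocIso_hom_app, actionAssocIso_hom_app]
    change ((f ⊗ₘ g) ⊵ₗ F.functor.obj N ≫ (X₂ ⊗ X₄) ⊴ₗ h.app N) ≫ _ =
      _ ≫ f ⊵ₗ (X₃ ⊙ₗ F.functor.obj N) ≫ X₂ ⊴ₗ (g ⊵ₗ F.functor.obj N ≫ X₄ ⊴ₗ h.app N)
    rw [← actionHom_def, ← actionHom_def, ← actionHom_def, actionAssocIso_hom_naturality]
  actionUnitIso_hom_naturality {F F'} f := by
    ext N
    rw [comp_app, comp_app, actionUnitIso_hom_app, actionUnitIso_hom_app]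
    exact actionUnitIso_hom_naturality (f.app N)
  whiskerLeft_actionHomLeft X Y Y' f F := by
    rw [← Category.assoc, Iso.eq_comp_inv]
    ext N
    rw [comp_app, comp_app, actionAssocIso_hom_app, actionAssocIso_hom_app]
    change (X ◁ f) ⊵ₗ F.functor.obj N ≫ _ = _ ≫ X ⊴ₗ f ⊵ₗ F.functor.obj N
    simp
  whiskerRight_actionHomLeft {X X'} Y f F := by
    rw [← Category.assoc, Iso.eq_comp_inv]
    ext N
    rw [comp_app, comp_app, actionAssocIso_hom_app, actionAssocIso_hom_app]
    change (f ▷ Y) ⊵ₗ F.functor.obj N ≫ _ = _ ≫ f ⊵ₗ (Y ⊙ₗ F.functor.obj N)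
    rw [whiskerRight_actionHomLeft]
    simp
  associator_actionHom X Y Z F := by
    ext N
    rw [comp_app, comp_app, comp_app, actionAssocIso_hom_app, actionAssocIso_hom_app,
      actionAssocIso_hom_app]
    change _ ≫ _ ≫ X ⊴ₗ Hom.app (αₗ Y Z F).hom N = _
    rw [actionAssocIso_hom_app]
    exact associator_actionHom X Y Z _
  leftUnitor_actionHom X F := by
    ext N
    rw [comp_app, actionAssocIso_hom_app, actionUnitIso_hom_app]
    exact leftUnitor_actionHom X _
  rightUnitor_actionHom X F := by
    ext N
    rw [comp_app, actionAssocIso_hom_app]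
    change _ = _ ≫ X ⊴ₗ Hom.app (MonoidalLeftActionStruct.actionUnitIso (C := C) F).hom N
    rw [actionUnitIso_hom_app]
    exact rightUnitor_actionHom X _

/-- The right action of `C` on the relative center; its axioms are the images under the functors
`F` of the axioms of the action on `M`. -/
abbrev rightAction : MonoidalRightAction C (RelCenter P) where
  toMonoidalRightActionStruct := rightActionStruct
  actionHom_def _ _ := rfl
  id_actionHomLeft F X := by
    ext N
    rfl
  actionHomRight_id X F := by
    ext N
    exact (congrArg F.functor.map (id_actionHomLeft X N)).trans (F.functor.map_id _)
  actionHom_comp {X X' X'' F F' F''} f₁ f₂ g₁ g₂ := by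
    ext N
    change (f₁.app _ ≫ f₂.app _) ≫ F''.functor.map ((g₁ ≫ g₂) ⊵ₗ N) =
      (f₁.app _ ≫ F'.functor.map (g₁ ⊵ₗ N)) ≫ f₂.app _ ≫ F''.functor.map (g₂ ⊵ₗ N)
    rw [comp_actionHomLeft, Functor.map_comp, Category.assoc, Category.assoc,
      reassoc_of% f₂.naturality]
  actionAssocIso_hom_naturality {F F' X₁ X₂ X₃ X₄} f g h := by
    ext N
    rw [comp_app, comp_app, rightActionAssocIso_hom_app, rightActionAssocIso_hom_app]
    change (f.app _ ≫ F'.functor.map ((g ⊗ₘ h) ⊵ₗ N)) ≫ _ =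
      _ ≫ (f.app _ ≫ F'.functor.map (g ⊵ₗ _)) ≫ F'.functor.map (X₂ ⊴ₗ h ⊵ₗ N)
    have h1 := actionAssocIso_hom_naturality g h (𝟙 N)
    simp only [actionHom_id] at h1
    rw [Category.assoc, ← F'.functor.map_comp, h1, Category.assoc, ← F'.functor.map_comp,
      reassoc_of% f.naturality, ← F'.functor.map_comp, ← actionHom_def]
  actionUnitIso_hom_naturality {F F'} f := by
    ext N
    rw [comp_app, comp_app, rightActionUnitIso_hom_app, rightActionUnitIso_hom_app]
    exact f.naturality _
  actionHomRight_whiskerRight {X X'} f Y F := by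
    rw [← Category.assoc, Iso.eq_comp_inv]
    ext N
    rw [comp_app, comp_app, rightActionAssocIso_hom_app, rightActionAssocIso_hom_app]
    change F.functor.map ((f ▷ Y) ⊵ₗ N) ≫ _ = _ ≫ F.functor.map (f ⊵ₗ (Y ⊙ₗ N))
    rw [← F.functor.map_comp, ← F.functor.map_comp, whiskerRight_actionHomLeft]
    simp
  whiskerRight_actionHomLeft Y X X' f F := by
    rw [← Category.assoc, Iso.eq_comp_inv]
    ext N
    rw [comp_app, comp_app, rightActionAssocIso_hom_app, rightActionAssocIso_hom_app]
    change F.functor.map ((Y ◁ f) ⊵ₗ N) ≫ _ = _ ≫ F.functor.map (Y ⊴ₗ f ⊵ₗ N)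
    rw [← F.functor.map_comp, ← F.functor.map_comp, whiskerLeft_actionHomLeft]
    simp
  actionHom_associator X Y Z F := by
    ext N
    rw [comp_app, comp_app, comp_app, rightActionAssocIso_hom_app, rightActionAssocIso_hom_app,
      rightActionAssocIso_hom_app]
    change F.functor.map ((α_ X Y Z).hom ⊵ₗ N) ≫ _ ≫ F.functor.map (X ⊴ₗ (αₗ Y Z N).hom) =
      _ ≫ Hom.app (αᵣ F X Y).hom (Z ⊙ₗ N)
    rw [rightActionAssocIso_hom_app]
    simp only [← F.functor.map_comp]
    rw [associator_actionHom]
  actionHom_leftUnitor X F := by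
    ext N
    rw [comp_app, rightActionAssocIso_hom_app]
    change F.functor.map ((λ_ X).hom ⊵ₗ N) =
      _ ≫ Hom.app (MonoidalRightActionStruct.actionUnitIso (C := C) F).hom (X ⊙ₗ N)
    rw [rightActionUnitIso_hom_app, ← F.functor.map_comp, leftUnitor_actionHom]
  actionHom_rightUnitor X F := by
    ext N
    rw [comp_app, rightActionAssocIso_hom_app]
    change F.functor.map ((ρ_ X).hom ⊵ₗ N) =
      _ ≫ Hom.app (MonoidalRightActionStruct.actionUnitIso (C := C)
        (MonoidalRightActionStruct.actionObj F X)).hom N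
    rw [rightActionUnitIso_hom_app]
    change _ = F.functor.map _ ≫ F.functor.map (X ⊴ₗ (λₗ N).hom)
    rw [← F.functor.map_comp, rightUnitor_actionHom]

/-- The axioms of a bimodule category that do not concern a single action. -/
lemma isBimoduleCategory 
    (hl : @IsLeftModuleCategory k _ C _ _ _ _ (RelCenter P) _ _ _ leftAction)
    (hr : @IsRightModuleCategory k _ C _ _ _ _ (RelCenter P) _ _ _ rightAction) :
    IsBimoduleCategory k C C (RelCenter P) middleIso where
  left := ⟨leftAction, rfl, hl⟩
  right := ⟨rightAction, rfl, hr⟩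
  natural_left f F Y := by
    ext N
    exact (Category.comp_id _).trans (Category.id_comp _).symm
  natural_middle X _ _ f Y := by
    ext N
    exact (Category.comp_id _).trans (Category.id_comp _).symm
  natural_right X F _ _ f := by
    ext N
    exact (Category.comp_id _).trans (Category.id_comp _).symm
  pentagon_left X X' F Y := by
    ext N
    change Hom.app (αₗ X X' F).hom (Y ⊙ₗ N) ≫ 𝟙 _ ≫ X ⊴ₗ 𝟙 _ =
      𝟙 _ ≫ Hom.app (αₗ X X' (F ⊙ᵣ Y)).hom N
    rw [actionAssocIso_hom_app, actionAssocIso_hom_app]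
    simp only [Category.id_comp, actionHomRight_id]
    exact Category.comp_id _
  pentagon_right X F Y Y' := by
    ext N
    change Hom.app (αᵣ (X ⊙ₗ F) Y Y').hom N ≫ 𝟙 _ ≫ 𝟙 _ =
      𝟙 _ ≫ X ⊴ₗ Hom.app (αᵣ F Y Y').hom N
    rw [rightActionAssocIso_hom_app, rightActionAssocIso_hom_app]
    simp
    rfl
  triangle_left F Y := by
    ext N
    change 𝟙 _ ≫ Hom.app (MonoidalLeftActionStruct.actionUnitIso (C := C) (F ⊙ᵣ Y)).hom N =
      Hom.app (MonoidalLeftActionStruct.actionUnitIso (C := C) F).hom (Y ⊙ₗ N)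
    rw [actionUnitIso_hom_app, actionUnitIso_hom_app]
    simp
    rfl
  triangle_right X F := by
    ext N
    change 𝟙 _ ≫ X ⊴ₗ Hom.app (MonoidalRightActionStruct.actionUnitIso (C := C) F).hom N =
      Hom.app (MonoidalRightActionStruct.actionUnitIso (C := C) (X ⊙ₗ F)).hom N
    rw [rightActionUnitIso_hom_app, rightActionUnitIso_hom_app]
    simp
    rfl

/-- The monoidal structure of the action functor; its axioms are those of the action on `M`. -/
def rhoCoreMonoidal (P : ObjectProperty (ModuleEnd k C M)) [P.IsMonoidal] :
    (rho P : C ⥤ RelCenter P).CoreMonoidal where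
  εIso := rhoUnit.symm
  μIso X Y := (rhoAssoc X Y).symm
  μIso_hom_natural_left {X X'} f Y := by
    ext N
    change f ⊵ₗ (Y ⊙ₗ N) ≫ (αₗ X' Y N).inv = (αₗ X Y N).inv ≫ (f ▷ Y) ⊵ₗ N
    simp
  μIso_hom_natural_right {Y Y'} X f := by
    ext N
    change X ⊴ₗ f ⊵ₗ N ≫ (αₗ X Y' N).inv = (αₗ X Y N).inv ≫ (X ◁ f) ⊵ₗ N
    simp
  associativity X Y Z := by
    ext N
    change (αₗ X Y (Z ⊙ₗ N)).inv ≫ (αₗ (X ⊗ Y) Z N).inv ≫ (α_ X Y Z).hom ⊵ₗ N =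
      𝟙 _ ≫ X ⊴ₗ (αₗ Y Z N).inv ≫ (αₗ X (Y ⊗ Z) N).inv
    rw [Category.id_comp, Iso.inv_comp_eq, Iso.inv_comp_eq, ← associator_actionHom_assoc]
    simp
  left_unitality X := by
    ext N
    change 𝟙 _ = (λₗ (X ⊙ₗ N)).inv ≫ (αₗ (𝟙_ C) X N).inv ≫ (λ_ X).hom ⊵ₗ N
    simp
  right_unitality X := by
    ext N
    change 𝟙 _ = X ⊴ₗ (λₗ N).inv ≫ (αₗ X (𝟙_ C) N).inv ≫ (ρ_ X).hom ⊵ₗ N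
    simp

end Axioms

end RelCenter

/-! ### Exactness of the actions and of the action functor -/

/-- An additive functor `T` followed by a right exact functor `H` is exact if `T` is exact with
projective values, since then `T` sends short exact sequences to split ones. -/
lemma preservesFiniteLimits_comp_of_projective {A : Type u₁} [Category.{v₁} A] [Abelian A]
    {B : Type u₂} [Category.{v₂} B] [Abelian B] {D : Type u₃} [Category.{v₃} D] [Abelian D]
    (T : A ⥤ B) [T.Additive] [PreservesFiniteLimits T] [PreservesFiniteColimits T]
    (hT : ∀ X, Projective (T.obj X)) (H : B ⥤ D) [H.Additive] :
    PreservesFiniteLimits (T ⋙ H) := by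
  refine ((T ⋙ H).preservesFiniteLimits_iff_forall_exact_map_and_mono).2 fun S hS => ?_
  have h1 : (S.map T).ShortExact := hS.map_of_exact T
  have : Projective (S.map T).X₃ := hT _
  have h2 := (h1.splittingOfProjective.map H).shortExact
  exact ⟨h2.exact, h2.mono_f⟩

namespace RelCenter

variable {k : Type w} [Field k] {C : Type u₁} [Category.{v₁} C] [MonoidalCategory C]
  {M : Type u₂} [Category.{v₂} M]

section

variable [Abelian M] [Linear k M] [hfin : IsFiniteAbelian k M] [MonoidalLeftAction C M]
  {P : ObjectProperty (ModuleEnd k C M)} [hP : IsTensorSubcategory P]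
  (hZ : IsFiniteAbelian k (RelCenter P)) {G : M} [Projective G] (hG : IsSeparator G)
  {B : Type u₃} [Category.{v₃} B] [Preadditive B] [Linear k B]

include hZ hG

/-- Exactness of a functor to the relative center can be tested by evaluation at a projective
generator. -/
lemma isLinearExact_of_evaluation (T : B ⥤ RelCenter P) [T.Additive] [T.Linear k]
    [PreservesFiniteLimits (T ⋙ evaluation P G)] [PreservesFiniteColimits (T ⋙ evaluation P G)] :
    IsLinearExact k T := by
  let _ := IsFiniteAbelian.abelian k (RelCenter P)
  have := evaluation_faithful P hG
  exact
    { additive := inferInstance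
      linear := inferInstance
      preservesFiniteLimits := preservesFiniteLimits_of_reflects_of_preserves T (evaluation P G)
      preservesFiniteColimits :=
        preservesFiniteColimits_of_reflects_of_preserves T (evaluation P G) }

end

section

variable [Abelian C] [Linear k C] [hC : IsFiniteTensorCategory k C]
  [Abelian M] [Linear k M] [MonoidalLeftAction C M] [hM : IsLeftModuleCategory k C M]
  (P : ObjectProperty (ModuleEnd k C M)) [hP : IsTensorSubcategory P]

omit hC in
lemma isLinearExact_rho (hZ : IsFiniteAbelian k (RelCenter P)) : IsLinearExact k (rho P) := by
  have := hM.finite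
  obtain ⟨G, hGp, hG⟩ := exists_projective_separator k M
  have : (rho P).Additive := ⟨fun {X Y f g} => by
    ext N
    exact (hM.exact_left N).additive.map_add⟩
  have : (rho P).Linear k := ⟨fun f r => by
    ext N
    exact (hM.exact_left N).linear.map_smul f r⟩
  have : PreservesFiniteLimits (rho P ⋙ evaluation P G) := (hM.exact_left G).preservesFiniteLimits
  have : PreservesFiniteColimits (rho P ⋙ evaluation P G) :=
    (hM.exact_left G).preservesFiniteColimits
  exact isLinearExact_of_evaluation hZ hG (rho P)

omit hC in
lemma isLeftModuleCategory (hZ : IsFiniteAbelian k (RelCenter P)) :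
    @IsLeftModuleCategory k _ C _ _ _ _ (RelCenter P) _ _ _ leftAction := by
  have := hM.finite
  obtain ⟨G, hGp, hG⟩ := exists_projective_separator k M
  let _ : MonoidalLeftAction C (RelCenter P) := leftAction
  refine { finite := hZ, exact_right := fun X => ?_, exact_left := fun F => ?_ }
  · let T := (curriedAction C (RelCenter P)).obj X
    let T' := (curriedAction C M).obj X
    have hX := hM.exact_right X
    have := hX.preservesFiniteLimits
    have := hX.preservesFiniteColimits
    have : T.Additive := ⟨fun {X Y f g} => by
      ext N
      exact hX.additive.map_add⟩
    have : T.Linear k := ⟨fun f r => by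
      ext N
      exact hX.linear.map_smul _ r⟩
    have : PreservesFiniteLimits (T ⋙ evaluation P G) :=
      inferInstanceAs (PreservesFiniteLimits (evaluation P G ⋙ T'))
    have : PreservesFiniteColimits (T ⋙ evaluation P G) :=
      inferInstanceAs (PreservesFiniteColimits (evaluation P G ⋙ T'))
    exact isLinearExact_of_evaluation hZ hG T
  · let T := (curriedAction C (RelCenter P)).flip.obj F
    have hF (N : M) := hM.exact_left (F.functor.obj N)
    have : T.Additive := ⟨fun {X Y f g} => by
      ext N
      exact (hF N).additive.map_add⟩
    have : T.Linear k := ⟨fun f r => by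
      ext N
      exact (hF N).linear.map_smul f r⟩
    have : PreservesFiniteLimits (T ⋙ evaluation P G) := (hF G).preservesFiniteLimits
    have : PreservesFiniteColimits (T ⋙ evaluation P G) := (hF G).preservesFiniteColimits
    exact isLinearExact_of_evaluation hZ hG T

/-- The objects `X ▷ G` are projective for `G` projective, so that the functors
`(F, γ) ↦ F(X ▷ G)` and `X ↦ F(X ▷ G)` are exact although `F` is only right exact. -/
lemma isRightModuleCategory (hZ : IsFiniteAbelian k (RelCenter P)) :
    @IsRightModuleCategory k _ C _ _ _ _ (RelCenter P) _ _ _ rightAction := by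
  have := hM.finite
  have := IsFiniteTensorCategory.hasDuals k C
  obtain ⟨G, hGp, hG⟩ := exists_projective_separator k M
  let _ : MonoidalRightAction C (RelCenter P) := rightAction
  refine { finite := hZ, exact_left := fun X => ?_, exact_right := fun F => ?_ }
  · let T := (MonoidalRightAction.curriedAction C (RelCenter P)).obj X
    have : T.Additive := ⟨fun {X Y f g} => by
      ext N
      rfl⟩
    have : T.Linear k := ⟨fun f r => by
      ext N
      rfl⟩
    have : PreservesFiniteLimits (T ⋙ evaluation P G) :=
      inferInstanceAs (PreservesFiniteLimits (evaluation P (X ⊙ₗ G)))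
    have : PreservesFiniteColimits (T ⋙ evaluation P G) :=
      inferInstanceAs (PreservesFiniteColimits (evaluation P (X ⊙ₗ G)))
    exact isLinearExact_of_evaluation hZ hG T
  · let T := (MonoidalRightAction.curriedAction C (RelCenter P)).flip.obj F
    let T' := (curriedAction C M).flip.obj G
    have := F.additive
    have := F.rightExact
    have := (hM.exact_left G).additive
    have := (hM.exact_left G).preservesFiniteLimits
    have := (hM.exact_left G).preservesFiniteColimits
    have : T.Additive := ⟨fun {X Y f g} => by
      ext N
      exact (congrArg F.functor.map (hM.exact_left N).additive.map_add).trans F.functor.map_add⟩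
    have : T.Linear k := ⟨fun f r => by
      ext N
      exact (congrArg F.functor.map ((hM.exact_left N).linear.map_smul f r)).trans
        (F.linear.map_smul _ r)⟩
    have : PreservesFiniteLimits (T ⋙ evaluation P G) :=
      preservesFiniteLimits_comp_of_projective T'
        (fun X => HasDuals.projective_action X G) F.functor
    have : PreservesFiniteColimits (T ⋙ evaluation P G) :=
      comp_preservesFiniteColimits T' F.functor
    exact isLinearExact_of_evaluation hZ hG T

end

end RelCenter

/-- The action of a nonzero object `X` on a nonzero object `N` is nonzero: the evaluation
`Xᘁ ⊗ X ⟶ 𝟙_ C` is an epimorphism because `𝟙_ C` is simple, and hence so is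
`Xᘁ ▷ (X ▷ N) ⟶ N`. -/
lemma IsLeftModuleCategory.isZero_of_isZero_action (k : Type w) [Field k] {C : Type u₁}
    [Category.{v₁} C] [Abelian C] [Linear k C] [MonoidalCategory C]
    [hC : IsFiniteTensorCategory k C] {M : Type u₂} [Category.{v₂} M] [Preadditive M] [Linear k M]
    [MonoidalLeftAction C M] [hM : IsLeftModuleCategory k C M] {X : C} {N : M}
    (hN : ¬ IsZero N) (h : IsZero (X ⊙ₗ N)) : IsZero X := by
  obtain ⟨_⟩ := hC.rigid
  have := hC.simple_unit
  have := hC.monoidalPreadditive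
  by_contra hX
  have hε : ε_ X Xᘁ ≠ 0 := fun h0 => hX <| by
    have h1 := ExactPairing.evaluation_coevaluation X Xᘁ
    rw [h0, MonoidalPreadditive.whiskerLeft_zero, comp_zero, comp_zero] at h1
    rw [IsZero.iff_id_eq_zero, ← cancel_epi (λ_ X).hom, ← cancel_mono (ρ_ X).inv, comp_zero,
      zero_comp, Category.comp_id, h1]
  have := epi_of_nonzero_to_simple hε
  have := (hM.exact_left N).preservesFiniteColimits
  have hepi : Epi (ε_ X Xᘁ ⊵ₗ N) :=
    inferInstanceAs (Epi (((curriedAction C M).flip.obj N).map (ε_ X Xᘁ)))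
  have := (hM.exact_right Xᘁ).additive
  have h1 : IsZero (Xᘁ ⊙ₗ (X ⊙ₗ N)) := ((curriedAction C M).obj Xᘁ).map_isZero h
  have h2 := IsZero.of_epi (ε_ X Xᘁ ⊵ₗ N) (h1.of_iso (αₗ Xᘁ X N))
  exact hN (h2.of_iso (λₗ N).symm)

/-- The action functor is faithful: if `f` acts by zero, then so does its image, which is thus
zero. -/
lemma RelCenter.faithful_rho {k : Type w} [Field k] {C : Type u₁}
    [Category.{v₁} C] [Abelian C] [Linear k C] [MonoidalCategory C]
    [hC : IsFiniteTensorCategory k C] {M : Type u₂} [Category.{v₂} M] [Preadditive M] [Linear k M]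
    [MonoidalLeftAction C M] [hM : IsLeftModuleCategory k C M] (hne : ∃ N : M, ¬ IsZero N)
    (P : ObjectProperty (ModuleEnd k C M)) [P.IsMonoidal] : (rho P).Faithful where
  map_injective {X Y f g} h := by
    obtain ⟨N, hN⟩ := hne
    have hN' := hM.exact_left N
    have := hN'.additive
    have := hN'.preservesFiniteLimits
    have := hN'.preservesFiniteColimits
    let T := (curriedAction C M).flip.obj N
    have h0 : T.map (f - g) = 0 := by
      rw [T.map_sub, sub_eq_zero]
      exact congrArg (fun t => Hom.app t N) h
    rw [← Abelian.image.fac (f - g), T.map_comp] at h0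
    have h1 : T.map (Abelian.factorThruImage (f - g)) = 0 := by
      rw [← cancel_mono (T.map (Abelian.image.ι (f - g))), h0, zero_comp]
    have h2 : IsZero (T.obj (Abelian.image (f - g))) := by
      rw [IsZero.iff_id_eq_zero, ← cancel_epi (T.map (Abelian.factorThruImage (f - g))), h1,
        zero_comp, zero_comp]
    have h3 := IsLeftModuleCategory.isZero_of_isZero_action k hN h2
    rw [← sub_eq_zero, ← Abelian.image.fac (f - g), h3.eq_of_src (Abelian.image.ι (f - g)) 0,
      comp_zero]

theorem mainTheorem5 {k : Type w} [Field k] [IsAlgClosed k] [CharZero k]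
    {C : Type u₁} [Category.{v₁} C] [Preadditive C] [Linear k C] [MonoidalCategory C]
    [IsFiniteTensorCategory k C]
    {M : Type u₂} [Category.{v₂} M] [Preadditive M] [Linear k M]
    [MonoidalLeftAction C M] [IsLeftModuleCategory k C M]
    (hexact : IsExactModuleCategory C M) (hindec : IsIndecomposableModuleCategory C M)
    (P : ObjectProperty (ModuleEnd k C M)) [IsTensorSubcategory P] :
    IsBimoduleCategory k C C (RelCenter P) RelCenter.middleIso ∧
    (∀ X : C, ((RelCenter.rho P).obj X).functor = (MonoidalLeftAction.curriedAction C M).obj X ∧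
      ∀ (D : ModuleEnd k C M) (hD : P D) (N : M),
        (((RelCenter.rho P).obj X).γ D hD N).hom = (D.c X N).inv) ∧
    (∃ m : (RelCenter.rho P).Monoidal,
      (∀ (X Y : C) (N : M), (m.μ X Y).app N = (αₗ X Y N).inv) ∧
      ∀ N : M, m.ε.app N = (λₗ N).inv) ∧
    IsLinearExact k (RelCenter.rho P) ∧
    (RelCenter.rho P).Faithful := by
  have hfin := IsLeftModuleCategory.finite (k := k) (C := C) (M := M)
  let _ : Abelian C := IsFiniteAbelian.abelian k C
  let _ : Abelian M := IsFiniteAbelian.abelian k M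
  have := IsFiniteTensorCategory.hasDuals k C
  have := IsLeftModuleCategory.isExactAction k C M
  obtain ⟨Q, hQ⟩ := IsLeftModuleCategory.exists_isActionGenerator k C M
  have hZ : IsFiniteAbelian k (RelCenter P) := RelCenter.isFiniteAbelian P hQ
  exact ⟨RelCenter.isBimoduleCategory (RelCenter.isLeftModuleCategory P hZ)
      (RelCenter.isRightModuleCategory P hZ), fun X => ⟨rfl, fun D hD N => rfl⟩,
    ⟨(RelCenter.rhoCoreMonoidal P).toMonoidal, fun X Y N => rfl, fun N => rfl⟩,
    RelCenter.isLinearExact_rho P hZ, RelCenter.faithful_rho hindec.nonzero P⟩
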